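/- Let $d\ge 1$, $\mathcal H=\ell^2(\mathbb Z^d)$, $\langle x\rangle=(1+|x|^2)^{1/2}$, and let $H_0u(x)=-\sum_{|x-y|=1}(u(y)-u(x))$ be the negative discrete Laplacian on $\mathcal H$. Let $\mathcal F_du(\xi)=\sum_{x\in\mathbb Z^d}e^{-2\pi i x\cdot\xi}u(x)$ be the Fourier expansion, a unitary operator from $\mathcal H$ onto $L^2(\mathbb T^d)$, $\mathbb T^d=\mathbb R^d/\mathbb Z^d$, let $\chi(D)=\mathcal F_d^{-1}\chi\mathcal F_d$, and let $h_0(\xi)=4\sum_{j=1}^d\sin^2(\pi\xi_j)$. Let $\chi\in C^\infty(\mathbb T^d)$ be real-valued with $\operatorname{supp}\chi\subset\{\xi\in\mathbb T^d : \nabla h_0(\xi)\neq 0\}$, and let $\varepsilon>0$. Then $$\sup_{z\in\mathbb C\setminus\mathbb R}\bigl\|\langle x\rangle^{-\frac12-\varepsilon}\chi(D)(H_0-z)^{-1}\chi(D)\langle x\rangle^{-\frac12-\varepsilon}\bigr\|_{B(\mathcal H)}<\infty .$$ Suppose moreover that $0<\varepsilon\le 1$. Write $D_{\eta_1}=(2\pi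 i)^{-1}\partial_{\eta_1}$, and call $\alpha\in(0,1]$ admissible for $\varepsilon$ in dimension $n\ge1$ if the operator $\langle\eta_1\rangle^{-\frac12-\varepsilon}(D_{\eta_1}-z)^{-1}\langle\eta_1\rangle^{-\frac12-\varepsilon}$ is, as a function of $z$, $\alpha$-Hölder continuous in the operator norm of $B(L^2(\mathbb R^n))$ on each of the half-planes $\{\operatorname{Im}z>0\}$ and $\{\operatorname{Im}z<0\}$. Then there is an $\alpha_\varepsilon\in(0,1]$, depending only on $\varepsilon$, that is admissible for $\varepsilon$ in every dimension $n\ge 1$; and for every $\alpha$ admissible for $\varepsilon$ in dimension $d$ (in particular for $\alpha=\alpha_\varepsilon$) there is a constant $C$ such that $$\bigl\|\langle x\rangle^{-\frac12-\varepsilon}\chi(D)\bigl((H_0-z)^{-1}-(H_0-z')^{-1}\bigr)\chi(D)\langle x\rangle^{-\frac12-\varepsilon}\bigr\|_{B(\mathcal H)}\le C|z-z'|^{\alpha}$$ for all $z,z'\in\mathbb C\setminus\mathbb R$ whose imaginary parts have the same sign. -/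

import Mathlib

open MeasureTheory Filter
open scoped ENNReal FourierTransform ContDiff Gradient lp

noncomputable section

namespace DiscreteSchrodinger

/-! ### Multiplication operators -/

/-- The operator of multiplication by an essentially bounded function `m` on `L²(μ)`. -/
def mulOp {X : Type*} [MeasurableSpace X] {μ : Measure X} (m : X → ℂ) (hm : MemLp m ∞ μ) :
    Lp ℂ 2 μ →L[ℂ] Lp ℂ 2 μ :=
  (ContinuousLinearMap.mul ℂ ℂ).holderL μ ∞ 2 2 (hm.toLp m)

theorem coeFn_mulOp {X : Type*} [MeasurableSpace X] {μ : Measure X} (m : X → ℂ)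
    (hm : MemLp m ∞ μ) (f : Lp ℂ 2 μ) :
    mulOp m hm f =ᵐ[μ] fun x => m x * f x := by
  have h1 := (ContinuousLinearMap.mul ℂ ℂ).coeFn_holder (r := 2) (hm.toLp m) f
  filter_upwards [h1, hm.coeFn_toLp] with x hx hx'
  rw [← hx']
  exact hx

/-! ### The lattice `ℤ^d` and the space `ℋ = ℓ²(ℤ^d)` -/

/-- The Hilbert space `ℓ²(ℤ^d)`. -/
abbrev Hil (d : ℕ) : Type := lp (fun _ : Fin d → ℤ => ℂ) 2

/-- The Euclidean norm of a lattice point. -/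
def latNorm {d : ℕ} (x : Fin d → ℤ) : ℝ := Real.sqrt (∑ j, (x j : ℝ) ^ 2)

/-- The Japanese bracket `⟨x⟩ = (1 + |x|²)^{1/2}` of a lattice point. -/
def latJap {d : ℕ} (x : Fin d → ℤ) : ℝ := Real.sqrt (1 + latNorm x ^ 2)

theorem one_le_latJap {d : ℕ} (x : Fin d → ℤ) : 1 ≤ latJap x :=
  Real.one_le_sqrt.2 (le_add_of_nonneg_right (sq_nonneg _))

/-- Multiplication by a bounded function on `ℓ²(ℤ^d)`. -/
def diagOp {d : ℕ} (a : (Fin d → ℤ) → ℂ) (C : ℝ) (ha : ∀ x, ‖a x‖ ≤ C) : Hil d →L[ℂ] Hil d :=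
  LinearMap.mkContinuous
    { toFun := fun u => ⟨fun x => a x * u x, by
        have h : Memℓp (fun x => (C : ℂ) * u x) 2 := (lp.memℓp u).const_smul (C : ℂ)
        refine h.mono' fun x => ?_
        have hC : 0 ≤ C := (norm_nonneg _).trans (ha x)
        simp only [norm_mul, Complex.norm_real, Real.norm_eq_abs, abs_of_nonneg hC]
        exact mul_le_mul_of_nonneg_right (ha x) (norm_nonneg _)⟩
      map_add' := fun u v => by ext x; exact mul_add _ _ _
      map_smul' := fun c u => by ext x; simp [mul_left_comm] }
    C (fun u => by
      have hC : 0 ≤ C := (norm_nonneg _).trans (ha 0)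
      have h : ‖(C : ℂ) • u‖ = C * ‖u‖ := by
        rw [norm_smul, Complex.norm_real, Real.norm_eq_abs, abs_of_nonneg hC]
      rw [← h]
      refine lp.norm_mono (by norm_num) fun x => ?_
      simp only [LinearMap.coe_mk, AddHom.coe_mk, lp.coeFn_smul, Pi.smul_apply, smul_eq_mul,
        norm_mul, Complex.norm_real, Real.norm_eq_abs, abs_of_nonneg hC]
      exact mul_le_mul_of_nonneg_right (ha x) (norm_nonneg _))

theorem diagOp_apply {d : ℕ} (a : (Fin d → ℤ) → ℂ) (C : ℝ) (ha : ∀ x, ‖a x‖ ≤ C) (u : Hil d)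
    (x : Fin d → ℤ) : diagOp a C ha u x = a x * u x := rfl

/-- The operator of multiplication by the weight `⟨x⟩^{-s}`, `s ≥ 0`, on `ℓ²(ℤ^d)`. -/
def latWeight (d : ℕ) (s : ℝ) (hs : 0 ≤ s) : Hil d →L[ℂ] Hil d :=
  diagOp (fun x => ((latJap x ^ (-s) : ℝ) : ℂ)) 1 fun x => by
    have h1 := one_le_latJap x
    have h0 : 0 ≤ latJap x ^ (-s) := Real.rpow_nonneg (by linarith) _
    rw [Complex.norm_real, Real.norm_eq_abs, abs_of_nonneg h0]
    exact Real.rpow_le_one_of_one_le_of_nonpos h1 (by linarith)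

/-! ### The negative discrete Laplacian -/

theorem memℓp_comp_add {d : ℕ} (v : Fin d → ℤ) (u : Hil d) :
    Memℓp (fun x => u (x + v)) 2 := by
  have h := lp.memℓp u
  rw [memℓp_gen_iff (by norm_num)] at h ⊢
  exact (Equiv.addRight v).summable_iff.2 h

/-- The translation `(S_v u)(x) = u(x + v)` on `ℓ²(ℤ^d)`. -/
def shift {d : ℕ} (v : Fin d → ℤ) : Hil d →L[ℂ] Hil d :=
  LinearMap.mkContinuous
    { toFun := fun u => ⟨fun x => u (x + v), memℓp_comp_add v u⟩
      map_add' := fun _ _ => rfl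
      map_smul' := fun _ _ => rfl }
    1 (fun u => by
      have h2 : 0 < (2 : ℝ≥0∞).toReal := by norm_num
      rw [one_mul, lp.norm_eq_tsum_rpow h2, lp.norm_eq_tsum_rpow h2]
      refine le_of_eq (congrArg (· ^ (1 / (2 : ℝ≥0∞).toReal)) ?_)
      exact (Equiv.addRight v).tsum_eq fun x => ‖u x‖ ^ (2 : ℝ≥0∞).toReal)

theorem shift_apply {d : ℕ} (v : Fin d → ℤ) (u : Hil d) (x : Fin d → ℤ) :
    shift v u x = u (x + v) := rfl

/-- The negative discrete Laplacian `H₀ u(x) = -∑_{|x-y|=1} (u(y) - u(x))` on `ℓ²(ℤ^d)`; the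
nearest neighbours of `x` are the points `x + e_j` and `x - e_j` (see `H0_apply`). -/
def H0 (d : ℕ) : Hil d →L[ℂ] Hil d :=
  -∑ j : Fin d, ((shift (Pi.single j 1) - 1) + (shift (-Pi.single j 1) - 1))

theorem H0_apply_sum {d : ℕ} (u : Hil d) (x : Fin d → ℤ) :
    H0 d u x = -∑ j : Fin d,
      ((u (x + Pi.single j 1) - u x) + (u (x + -Pi.single j 1) - u x)) := by
  have h : ∀ s : Finset (Fin d),
      (∑ j ∈ s, ((shift (Pi.single j 1) - 1) + (shift (-Pi.single j 1) - 1)) : Hil d →L[ℂ] Hil d)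
        u x = ∑ j ∈ s, ((u (x + Pi.single j 1) - u x) + (u (x + -Pi.single j 1) - u x)) := by
    intro s
    induction s using Finset.cons_induction with
    | empty => rfl
    | cons a s ha ih =>
      rw [Finset.sum_cons, Finset.sum_cons, ← ih]
      rfl
  rw [← h Finset.univ]
  rfl

theorem latNorm_eq_one_iff {d : ℕ} (v : Fin d → ℤ) :
    latNorm v = 1 ↔ ∃ j, v = Pi.single j 1 ∨ v = -Pi.single j 1 := by
  rw [latNorm, Real.sqrt_eq_one]
  constructor
  · intro h
    have h' : ∑ j, v j ^ 2 = 1 := by exact_mod_cast h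
    obtain ⟨j, hj⟩ : ∃ j, v j ≠ 0 := by
      by_contra! hv
      simp [hv] at h'
    rw [← Finset.add_sum_erase _ _ (Finset.mem_univ j)] at h'
    have h1 : 0 < v j ^ 2 := by positivity
    have h2 : 0 ≤ ∑ i ∈ Finset.univ.erase j, v i ^ 2 := Finset.sum_nonneg fun i _ => sq_nonneg _
    have h3 : ∑ i ∈ Finset.univ.erase j, v i ^ 2 = 0 := by omega
    have h4 : v j ^ 2 = 1 := by omega
    have h5 : ∀ i, i ≠ j → v i = 0 := fun i hi =>
      pow_eq_zero_iff two_ne_zero |>.1 <|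
        (Finset.sum_eq_zero_iff_of_nonneg fun i _ => sq_nonneg (v i)).1 h3 i
          (Finset.mem_erase.2 ⟨hi, Finset.mem_univ i⟩)
    refine ⟨j, (show v j = 1 ∨ v j = -1 by simpa using h4).imp (fun h6 => ?_) fun h6 => ?_⟩ <;>
    · ext i
      by_cases hi : i = j
      · subst hi; simp [h6]
      · simp [hi, h5 i hi]
  · rintro ⟨j, rfl | rfl⟩ <;>
    · rw [Finset.sum_eq_single j] <;> simp +contextual

/-- `H₀` is given by the defining formula of the negative discrete Laplacian. -/
theorem H0_apply {d : ℕ} (u : Hil d) (x : Fin d → ℤ) :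
    H0 d u x = -∑ᶠ y ∈ {y : Fin d → ℤ | latNorm (x - y) = 1}, (u y - u x) := by
  let φ : Fin d × Bool → (Fin d → ℤ) := fun p =>
    cond p.2 (x + Pi.single p.1 1) (x + -Pi.single p.1 1)
  have hφ : Function.Injective φ := by
    rintro ⟨i, a⟩ ⟨j, b⟩ h
    cases a <;> cases b <;> simp only [φ, cond_true, cond_false, add_right_inj] at h
    · rw [neg_inj] at h
      have := congrFun h i
      by_cases hij : i = j
      · rw [hij]
      · simp [hij] at this
    · exfalso
      have := congrFun h i
      by_cases hij : i = j <;> simp [hij] at this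
    · exfalso
      have := congrFun h i
      by_cases hij : i = j <;> simp [hij] at this
    · have := congrFun h i
      by_cases hij : i = j
      · rw [hij]
      · simp [hij] at this
  have hr : {y : Fin d → ℤ | latNorm (x - y) = 1} = Set.range φ := by
    ext y
    rw [Set.mem_ofPred_eq, latNorm_eq_one_iff]
    constructor
    · rintro ⟨j, h | h⟩
      · exact ⟨(j, false), by simp only [φ, cond_false, ← h]; abel⟩
      · exact ⟨(j, true), by
          have h' : Pi.single j 1 = -(x - y) := by rw [h, neg_neg]
          simp only [φ, cond_true, h']; abel⟩
    · rintro ⟨⟨j, b⟩, rfl⟩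
      cases b
      · exact ⟨j, Or.inl (by simp only [φ, cond_false]; abel)⟩
      · exact ⟨j, Or.inr (by simp only [φ, cond_true]; abel)⟩
  rw [H0_apply_sum, hr, finsum_mem_range hφ, finsum_eq_sum_of_fintype, Fintype.sum_prod_type]
  simp only [Fintype.sum_bool, φ, cond_true, cond_false]

theorem H0_isSelfAdjoint (d : ℕ) : IsSelfAdjoint (H0 d) := by
  have hs : ∀ v : Fin d → ℤ, star (shift v) = shift (-v) := fun v => by
    rw [ContinuousLinearMap.star_eq_adjoint, eq_comm, ContinuousLinearMap.eq_adjoint_iff]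
    intro f g
    rw [lp.inner_eq_tsum, lp.inner_eq_tsum]
    simp only [shift_apply]
    rw [← (Equiv.addRight v).tsum_eq]
    simp
  rw [IsSelfAdjoint, H0, star_neg, star_sum]
  refine congrArg _ (Finset.sum_congr rfl fun j _ => ?_)
  rw [star_add, star_sub, star_sub, hs, hs, star_one, neg_neg, add_comm]

/-- `H₀ - z` is invertible for non-real `z`. -/
theorem isUnit_H0_sub {d : ℕ} {z : ℂ} (hz : z.im ≠ 0) :
    IsUnit (H0 d - z • (1 : Hil d →L[ℂ] Hil d)) := by
  have h : z ∉ spectrum ℂ (H0 d) := fun h =>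
    hz (by rw [(H0_isSelfAdjoint d).mem_spectrum_eq_re h]; exact Complex.ofReal_im _)
  rw [spectrum.notMem_iff, Algebra.algebraMap_eq_smul_one] at h
  rw [← IsUnit.neg_iff, neg_sub]
  exact h

/-- The resolvent `(H₀ - z)⁻¹`. It is the inverse operator for every non-real `z`, by
`isUnit_H0_sub`. -/
def resH0 (d : ℕ) (z : ℂ) : Hil d →L[ℂ] Hil d :=
  Ring.inverse (H0 d - z • (1 : Hil d →L[ℂ] Hil d))

/-! ### The torus `𝕋^d = ℝ^d/ℤ^d`, the Fourier expansion and Fourier multipliers -/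

/-- The Haar probability measure on `𝕋^d`. -/
abbrev torusMeasure (d : ℕ) : Measure (UnitAddTorus (Fin d)) :=
  Measure.pi fun _ => AddCircle.haarAddCircle

/-- The projection `ℝ^d → 𝕋^d`. -/
def torusProj {d : ℕ} (ξ : EuclideanSpace ℝ (Fin d)) : UnitAddTorus (Fin d) :=
  fun j => (ξ j : UnitAddCircle)

/-- `f ∈ C^∞(𝕋^d)`: the periodic lift of `f` to `ℝ^d` is smooth. -/
def TorusSmooth {d : ℕ} (f : UnitAddTorus (Fin d) → ℝ) : Prop :=
  ContDiff ℝ ∞ fun ξ : EuclideanSpace ℝ (Fin d) => f (torusProj ξ)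

theorem TorusSmooth.continuous {d : ℕ} {f : UnitAddTorus (Fin d) → ℝ} (hf : TorusSmooth f) :
    Continuous f := by
  have hq : IsOpenQuotientMap fun (ξ : Fin d → ℝ) (j : Fin d) => (ξ j : UnitAddCircle) :=
    .piMap fun _ => QuotientAddGroup.isOpenQuotientMap_mk
  refine hq.isQuotientMap.continuous_iff.2 ?_
  exact (ContDiff.continuous hf).comp (PiLp.continuous_toLp 2 fun _ : Fin d => ℝ)

theorem TorusSmooth.memLp {d : ℕ} {f : UnitAddTorus (Fin d) → ℝ} (hf : TorusSmooth f) :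
    MemLp (fun θ => (f θ : ℂ)) ∞ (torusMeasure d) := by
  have hc : Continuous fun θ => (f θ : ℂ) := Complex.continuous_ofReal.comp hf.continuous
  obtain ⟨C, hC⟩ := isCompact_univ.exists_bound_of_continuousOn hc.continuousOn
  exact memLp_top_of_bound hc.aestronglyMeasurable C (.of_forall fun θ => hC θ (Set.mem_univ θ))

/-- The monomials `ξ ↦ e^{-2πi x·ξ}`, `x ∈ ℤ^d`, as a Hilbert basis of `L²(𝕋^d)`. -/
def torusBasis (d : ℕ) : HilbertBasis (Fin d → ℤ) ℂ (Lp ℂ 2 (torusMeasure d)) :=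
  HilbertBasis.mk (v := fun x : Fin d → ℤ => UnitAddTorus.mFourierLp 2 (-x))
    (UnitAddTorus.orthonormal_mFourier.comp _ neg_injective) (by
      have h : Set.range (fun x : Fin d → ℤ => UnitAddTorus.mFourierLp 2 (-x)) =
          Set.range (UnitAddTorus.mFourierLp (d := Fin d) 2) :=
        neg_surjective.range_comp (UnitAddTorus.mFourierLp (d := Fin d) 2)
      rw [h]
      exact (UnitAddTorus.span_mFourierLp_closure_eq_top (by simp)).ge)

/-- The Fourier expansion `ℱ_d : ℓ²(ℤ^d) → L²(𝕋^d)`, `(ℱ_d u)(ξ) = ∑_x e^{-2πi x·ξ} u(x)`, as a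
unitary operator. -/
def fourierExp (d : ℕ) : Hil d ≃ₗᵢ[ℂ] Lp ℂ 2 (torusMeasure d) :=
  (torusBasis d).repr.symm

theorem hasSum_fourierExp {d : ℕ} (u : Hil d) :
    HasSum (fun x => u x • torusBasis d x) (fourierExp d u) :=
  (torusBasis d).hasSum_repr_symm u

theorem coeFn_torusBasis {d : ℕ} (x : Fin d → ℤ) :
    torusBasis d x =ᵐ[torusMeasure d]
      fun θ => ∏ j, fourier (-x j) (θ j) := by
  rw [torusBasis, HilbertBasis.coe_mk]
  exact UnitAddTorus.coeFn_mFourierLp 2 (-x)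

/-- The Fourier multiplier `χ(D) = ℱ_d⁻¹ χ ℱ_d` on `ℓ²(ℤ^d)`. -/
def chiD {d : ℕ} (χ : UnitAddTorus (Fin d) → ℝ) (hχ : TorusSmooth χ) : Hil d →L[ℂ] Hil d :=
  (fourierExp d).symm.toContinuousLinearEquiv.toContinuousLinearMap ∘L
    mulOp (fun θ => (χ θ : ℂ)) hχ.memLp ∘L
    (fourierExp d).toContinuousLinearEquiv.toContinuousLinearMap

/-- The symbol `h₀(ξ) = 4 ∑_j sin²(π ξ_j)` of `H₀`, as a `ℤ^d`-periodic function on `ℝ^d`. -/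
def h0 (d : ℕ) (ξ : EuclideanSpace ℝ (Fin d)) : ℝ :=
  4 * ∑ j, Real.sin (Real.pi * ξ j) ^ 2

/-- The set `{∇h₀ ≠ 0}` of regular points of `h₀` in `𝕋^d`. -/
def regularSet (d : ℕ) : Set (UnitAddTorus (Fin d)) :=
  {θ | ∀ ξ : EuclideanSpace ℝ (Fin d), torusProj ξ = θ → ∇ (h0 d) ξ ≠ 0}

/-- The weighted cut-off resolvent `⟨x⟩^{-1/2-ε} χ(D) (H₀ - z)⁻¹ χ(D) ⟨x⟩^{-1/2-ε}`. -/
def cutoffResolvent {d : ℕ} (χ : UnitAddTorus (Fin d) → ℝ) (hχ : TorusSmooth χ) (ε : ℝ)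
    (hε : 0 < ε) (z : ℂ) : Hil d →L[ℂ] Hil d :=
  latWeight d (1 / 2 + ε) (by positivity) ∘L chiD χ hχ ∘L resH0 d z ∘L chiD χ hχ ∘L
    latWeight d (1 / 2 + ε) (by positivity)

/-! ### The model operator `D_{η₁}` on `L²(ℝ^d)` -/

/-- The space `L²(ℝ^d)`. -/
abbrev L2Euc (d : ℕ) : Type :=
  Lp ℂ 2 (volume : Measure (EuclideanSpace ℝ (Fin d)))

theorem memLp_eucWeight (d : ℕ) [NeZero d] (s : ℝ) (hs : 0 ≤ s) :
    MemLp (fun η : EuclideanSpace ℝ (Fin d) => ((Real.sqrt (1 + η 0 ^ 2) ^ (-s) : ℝ) : ℂ)) ∞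
      volume := by
  refine memLp_top_of_bound (C := 1) ?_ (.of_forall fun η => ?_)
  · have : Measurable fun η : EuclideanSpace ℝ (Fin d) =>
        ((Real.sqrt (1 + η 0 ^ 2) ^ (-s) : ℝ) : ℂ) := by fun_prop
    exact this.aestronglyMeasurable
  · have h1 : 1 ≤ Real.sqrt (1 + η 0 ^ 2) :=
      Real.one_le_sqrt.2 (le_add_of_nonneg_right (sq_nonneg _))
    rw [Complex.norm_real, Real.norm_eq_abs, abs_of_nonneg (Real.rpow_nonneg (by linarith) _)]
    exact Real.rpow_le_one_of_one_le_of_nonpos h1 (by linarith)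

/-- The operator of multiplication by `⟨η₁⟩^{-s}`, `s ≥ 0`, on `L²(ℝ^d)`. -/
def eucWeight (d : ℕ) [NeZero d] (s : ℝ) (hs : 0 ≤ s) : L2Euc d →L[ℂ] L2Euc d :=
  mulOp (fun η : EuclideanSpace ℝ (Fin d) => ((Real.sqrt (1 + η 0 ^ 2) ^ (-s) : ℝ) : ℂ))
    (memLp_eucWeight d s hs)

theorem memLp_resSymbol (d : ℕ) [NeZero d] (z : ℂ) (hz : z.im ≠ 0) :
    MemLp (fun ξ : EuclideanSpace ℝ (Fin d) => (((ξ 0 : ℝ) : ℂ) - z)⁻¹) ∞ volume := by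
  refine memLp_top_of_bound (C := |z.im|⁻¹) ?_ (.of_forall fun ξ => ?_)
  · have : Measurable fun ξ : EuclideanSpace ℝ (Fin d) => (((ξ 0 : ℝ) : ℂ) - z)⁻¹ := by fun_prop
    exact this.aestronglyMeasurable
  · rw [norm_inv]
    refine inv_anti₀ (abs_pos.2 hz) ?_
    simpa using Complex.abs_im_le_norm (((ξ 0 : ℝ) : ℂ) - z)

/-- The resolvent `(D_{η₁} - z)⁻¹` on `L²(ℝ^d)`, `z ∉ ℝ`, where `D_{η₁} = (2πi)⁻¹ ∂_{η₁}`: the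
Fourier multiplier with symbol `(ξ₁ - z)⁻¹`, for the Fourier transform
`∫ e^{-2πi η·ξ} f(η) dη`. -/
def resD1 (d : ℕ) [NeZero d] (z : ℂ) (hz : z.im ≠ 0) : L2Euc d →L[ℂ] L2Euc d :=
  (Lp.fourierTransformₗᵢ (EuclideanSpace ℝ (Fin d))
      ℂ).symm.toContinuousLinearEquiv.toContinuousLinearMap ∘L
    mulOp (fun ξ : EuclideanSpace ℝ (Fin d) => (((ξ 0 : ℝ) : ℂ) - z)⁻¹)
      (memLp_resSymbol d z hz) ∘L
    (Lp.fourierTransformₗᵢ (EuclideanSpace ℝ (Fin d))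
      ℂ).toContinuousLinearEquiv.toContinuousLinearMap

/-- The weighted resolvent `⟨η₁⟩^{-1/2-ε} (D_{η₁} - z)⁻¹ ⟨η₁⟩^{-1/2-ε}` on `L²(ℝ^d)`. -/
def modelResolvent (d : ℕ) [NeZero d] (ε : ℝ) (hε : 0 < ε) (z : ℂ) (hz : z.im ≠ 0) :
    L2Euc d →L[ℂ] L2Euc d :=
  eucWeight d (1 / 2 + ε) (by positivity) ∘L resD1 d z hz ∘L
    eucWeight d (1 / 2 + ε) (by positivity)

/-- `α ∈ (0, 1]` is a Hölder exponent of the model: the weighted resolvent of `D_{η₁}` on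
`L²(ℝ^d)` is `α`-Hölder continuous in operator norm on each of the half-planes `Im z > 0` and
`Im z < 0`. -/
def IsModelHolderExponent (d : ℕ) [NeZero d] (ε : ℝ) (hε : 0 < ε) (α : ℝ) : Prop :=
  0 < α ∧ α ≤ 1 ∧ ∃ C : ℝ, ∀ (z z' : ℂ) (hz : z.im ≠ 0) (hz' : z'.im ≠ 0),
    0 < z.im * z'.im →
      ‖modelResolvent d ε hε z hz - modelResolvent d ε hε z' hz'‖ ≤ C * ‖z - z'‖ ^ α

end DiscreteSchrodinger

end

open DiscreteSchrodinger

noncomputable section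

namespace DiscreteSchrodinger

/-! ### Fourier multipliers with continuous symbols on `ℓ²(ℤ^d)` -/

section Multiplier

variable {d : ℕ}

/-! The Fourier expansion turns the cut-off resolvent into a weighted multiplier with symbol χ²/(h₀
- z). Where ∇h₀ ≠ 0, some partial derivative is nonzero, so `exists_localization` writes χ² as a
finite sum of smooth g_j such that, on the support of g_j, κ(ξ_j) = 2 - 2cos(2πξ_j) stays away from
its critical values 0 and 4. As h₀ is a sum of one-variable functions, freezing the other variables
leaves g_j/(κ - w) on a circle, with w equal to z minus a real number.

The circle problem is explicit. If w = 2 - ζ - ζ⁻¹ with |ζ| < 1, the Fourier coefficients of 1/(κ -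
w) are ζ^|k|/(ζ⁻¹ - ζ). They degenerate only for w near 0 or 4, and there the cut-off keeps κ - w
away from zero. Hence (`exists_bound_resCoeff`) the n-th coefficient of g_j/(κ - w) is bounded
uniformly in w, and Lipschitz in w on each half-plane with constant O(1 + |n|).

Cut the lattice into slices {x_j = s}. The block of a multiplier from slice r to slice s is bounded
by the sup norm of the partial Fourier coefficient of index s - r. A Hilbert–Schmidt sum against
⟨s⟩^{-1/2-ε}⟨r⟩^{-1/2-ε} then converges and gives the uniform bound. For a difference of resolvents
the blocks are O(min(1, |z - z'|(1 + |s - r|))), which gives the modulus of continuity C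
√(`modulusSum`) of `exists_cutoffResolvent_bound`.

It remains to compare this modulus with the model. The resolvent of D_{η₁} is a Laplace-type
integral of translations. Estimating it directly gives every Hölder exponent α ≤ 1 with α < ε, in
every dimension (`norm_modelResolvent_sub_le`). Conversely, on the imaginary axis its kernel has one
sign, so testing a difference of resolvents on bumps at integer points bounds `modulusSum` from
above by the model's own Hölder bound (`IsModelHolderExponent.modulusSum_le`). Every admissible α
therefore passes to the lattice, without conjugating H₀ to D_{η₁}. -/

theorem memLp_continuous_torus (m : C(UnitAddTorus (Fin d), ℂ)) :
    MemLp (fun θ => m θ) ∞ (torusMeasure d) :=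
  memLp_top_of_bound m.continuous.aestronglyMeasurable ‖m‖
    (.of_forall fun θ => m.norm_coe_le_norm θ)

theorem norm_mulOp_le {X : Type*} [MeasurableSpace X] {μ : Measure X} (m : X → ℂ)
    (hm : MemLp m ∞ μ) {C : ℝ} (hC : 0 ≤ C) (h : ∀ x, ‖m x‖ ≤ C) : ‖mulOp m hm‖ ≤ C := by
  refine ContinuousLinearMap.opNorm_le_bound _ hC fun f => ?_
  refine Lp.norm_le_mul_norm_of_ae_le_mul ?_
  filter_upwards [coeFn_mulOp m hm f] with x hx
  rw [hx, norm_mul]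
  exact mul_le_mul_of_nonneg_right (h x) (norm_nonneg _)

/-- The Fourier multiplier on `ℓ²(ℤ^d)` with a continuous symbol. -/
def fmul (m : C(UnitAddTorus (Fin d), ℂ)) : Hil d →L[ℂ] Hil d :=
  (fourierExp d).symm.toContinuousLinearEquiv.toContinuousLinearMap ∘L
    mulOp (fun θ => m θ) (memLp_continuous_torus m) ∘L
    (fourierExp d).toContinuousLinearEquiv.toContinuousLinearMap

theorem fmul_apply (m : C(UnitAddTorus (Fin d), ℂ)) (u : Hil d) :
    fmul m u = (fourierExp d).symm
      (mulOp (fun θ => m θ) (memLp_continuous_torus m) (fourierExp d u)) := rfl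

theorem fourierExp_fmul (m : C(UnitAddTorus (Fin d), ℂ)) (u : Hil d) :
    fourierExp d (fmul m u) =ᵐ[torusMeasure d] fun θ => m θ * fourierExp d u θ := by
  rw [fmul_apply, LinearIsometryEquiv.apply_symm_apply]
  exact coeFn_mulOp _ _ _

theorem norm_fmul_le (m : C(UnitAddTorus (Fin d), ℂ)) {C : ℝ} (hC : 0 ≤ C)
    (h : ∀ θ, ‖m θ‖ ≤ C) : ‖fmul m‖ ≤ C := by
  refine ContinuousLinearMap.opNorm_le_bound _ hC fun u => ?_
  rw [fmul_apply, LinearIsometryEquiv.norm_map, ← (fourierExp d).norm_map u]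
  exact ContinuousLinearMap.le_of_opNorm_le _ (norm_mulOp_le _ _ hC h) _

theorem fmul_ext {m : C(UnitAddTorus (Fin d), ℂ)} {u v : Hil d}
    (h : (fun θ => m θ * fourierExp d u θ) =ᵐ[torusMeasure d] fourierExp d v) :
    fmul m u = v :=
  (fourierExp d).injective (Lp.ext ((fourierExp_fmul m u).trans h))

theorem fmul_one : fmul (1 : C(UnitAddTorus (Fin d), ℂ)) = 1 := by
  ext1 u
  exact fmul_ext (.of_forall fun θ => by simp)

theorem fmul_add (m n : C(UnitAddTorus (Fin d), ℂ)) : fmul (m + n) = fmul m + fmul n := by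
  ext1 u
  refine fmul_ext ?_
  rw [_root_.add_apply, map_add]
  filter_upwards [Lp.coeFn_add (fourierExp d (fmul m u)) (fourierExp d (fmul n u)),
    fourierExp_fmul m u, fourierExp_fmul n u] with θ h1 h2 h3
  rw [h1, Pi.add_apply, h2, h3, ContinuousMap.add_apply, add_mul]

theorem fmul_mul (m n : C(UnitAddTorus (Fin d), ℂ)) : fmul (m * n) = fmul m * fmul n := by
  ext1 u
  refine fmul_ext ?_
  rw [mul_apply_eq_comp]
  filter_upwards [fourierExp_fmul m (fmul n u), fourierExp_fmul n u] with θ h1 h2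
  rw [h1, h2, ContinuousMap.mul_apply, mul_assoc]

theorem fmul_smul (c : ℂ) (m : C(UnitAddTorus (Fin d), ℂ)) : fmul (c • m) = c • fmul m := by
  ext1 u
  refine fmul_ext ?_
  rw [_root_.smul_apply, map_smul]
  filter_upwards [Lp.coeFn_smul c (fourierExp d (fmul m u)), fourierExp_fmul m u] with θ h1 h2
  rw [h1, Pi.smul_apply, h2, ContinuousMap.smul_apply, smul_eq_mul, smul_eq_mul, mul_assoc]

/-- `fmul` as an algebra homomorphism. -/
def fmulHom (d : ℕ) : C(UnitAddTorus (Fin d), ℂ) →ₐ[ℂ] (Hil d →L[ℂ] Hil d) :=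
  AlgHom.ofLinearMap
    { toFun := fmul
      map_add' := fmul_add
      map_smul' := fmul_smul } fmul_one fmul_mul

theorem fmulHom_apply (m : C(UnitAddTorus (Fin d), ℂ)) : fmulHom d m = fmul m := rfl

/-! ### Matrix coefficients of multipliers -/

theorem fourierExp_single (y : Fin d → ℤ) :
    fourierExp d (lp.single 2 y 1) = torusBasis d y :=
  (torusBasis d).repr_symm_single y

theorem coeFn_torusBasis_mFourier (x : Fin d → ℤ) :
    torusBasis d x =ᵐ[torusMeasure d] fun θ => UnitAddTorus.mFourier (-x) θ :=
  coeFn_torusBasis x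

theorem hil_ext {S T : Hil d →L[ℂ] Hil d}
    (h : ∀ y : Fin d → ℤ, S (lp.single 2 y 1) = T (lp.single 2 y 1)) : S = T := by
  refine lp.ext_continuousLinearMap (ENNReal.ofNat_ne_top (n := 2)) fun y => ?_
  ext
  simpa using congrFun (congrArg Subtype.val (h y)) _

/-- The basis vector attached to y is the character of -y, so multiplying it by the character of v
lands on the point y - v. -/
theorem fmul_mFourier (v : Fin d → ℤ) : fmul (UnitAddTorus.mFourier v) = shift v := by
  refine hil_ext fun y => ?_
  have h : shift v (lp.single 2 y (1 : ℂ)) = lp.single 2 (y - v) 1 := by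
    ext x
    rw [shift_apply, lp.single_apply, lp.single_apply, Pi.single_apply, Pi.single_apply]
    simp only [eq_sub_iff_add_eq]
  rw [h]
  refine fmul_ext ?_
  rw [fourierExp_single, fourierExp_single]
  filter_upwards [coeFn_torusBasis_mFourier y, coeFn_torusBasis_mFourier (y - v)] with θ h1 h2
  rw [h1, h2, ← UnitAddTorus.mFourier_add]
  congr 2
  abel

/-- A multiplier has a Toeplitz matrix. The argument is y - x, not x - y, because of the sign in
e^{-2πi x·ξ}. -/
theorem fmul_single_apply (m : C(UnitAddTorus (Fin d), ℂ)) (x y : Fin d → ℤ) :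
    fmul m (lp.single 2 y 1) x = UnitAddTorus.mFourierCoeff m (y - x) := by
  have h : fmul m (lp.single 2 y 1) x =
      inner ℂ (torusBasis d x) (fourierExp d (fmul m (lp.single 2 y 1))) := by
    rw [← HilbertBasis.repr_apply_apply]
    exact congrArg (fun u : Hil d => u x) ((torusBasis d).repr.apply_symm_apply _).symm
  rw [h, L2.inner_def, UnitAddTorus.mFourierCoeff]
  refine integral_congr_ae ?_
  have h4 := fourierExp_fmul m (lp.single 2 y 1)
  rw [fourierExp_single] at h4
  filter_upwards [coeFn_torusBasis_mFourier x, coeFn_torusBasis_mFourier y, h4] with θ h1 h2 h3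
  rw [h3, h2, h1, RCLike.inner_apply, ← UnitAddTorus.mFourier_neg, smul_eq_mul, mul_assoc,
    ← UnitAddTorus.mFourier_add, mul_comm]
  congr 3
  abel

end Multiplier

/-! ### The symbol of `H₀` and its resolvent -/

/-- `2 - 2 cos(2π τ)` as a function on the circle. -/
def kap (τ : UnitAddCircle) : ℝ := 2 - 2 * (fourier 1 τ : ℂ).re

theorem continuous_kap : Continuous kap := by unfold kap; fun_prop

theorem kap_coe (t : ℝ) : kap (t : UnitAddCircle) = 2 - 2 * Real.cos (2 * Real.pi * t) := by
  rw [kap, fourier_coe_apply]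
  have : (2 * Real.pi * Complex.I * ((1 : ℤ) : ℂ) * t / ((1 : ℝ) : ℂ)) =
      ((2 * Real.pi * t : ℝ) : ℂ) * Complex.I := by push_cast; ring
  rw [this, Complex.exp_ofReal_mul_I_re]

theorem kap_mem (τ : UnitAddCircle) : 0 ≤ kap τ ∧ kap τ ≤ 4 := by
  induction τ using QuotientAddGroup.induction_on with
  | H t =>
    have := kap_coe t
    have h1 := Real.neg_one_le_cos (2 * Real.pi * t)
    have h2 := Real.cos_le_one (2 * Real.pi * t)
    constructor <;> linarith

theorem ofReal_kap (τ : UnitAddCircle) :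
    (kap τ : ℂ) = 2 - fourier 1 τ - fourier (-1) τ := by
  rw [kap, fourier_neg, sub_sub, Complex.add_conj]
  push_cast
  ring

/-- The symbol of `H₀` on the torus. -/
def torusH0 (d : ℕ) (θ : UnitAddTorus (Fin d)) : ℝ := ∑ j, kap (θ j)

theorem continuous_torusH0 (d : ℕ) : Continuous (torusH0 d) :=
  continuous_finsetSum _ fun j _ => continuous_kap.comp (continuous_apply j)

/-- The symbol of `H₀ - z`. -/
def symbolSub (d : ℕ) (z : ℂ) : C(UnitAddTorus (Fin d), ℂ) :=
  ⟨fun θ => (torusH0 d θ : ℂ) - z,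
    (Complex.continuous_ofReal.comp (continuous_torusH0 d)).sub continuous_const⟩

theorem ofReal_sub_ne_zero {z : ℂ} (hz : z.im ≠ 0) (t : ℝ) : (t : ℂ) - z ≠ 0 := fun h => hz (by
  rw [← sub_eq_zero.1 h, Complex.ofReal_im])

/-- The symbol of `(H₀ - z)⁻¹`. -/
def symbolRes (d : ℕ) (z : ℂ) (hz : z.im ≠ 0) : C(UnitAddTorus (Fin d), ℂ) :=
  ⟨fun θ => ((torusH0 d θ : ℂ) - z)⁻¹,
    ((Complex.continuous_ofReal.comp (continuous_torusH0 d)).sub continuous_const).inv₀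
      fun _ => ofReal_sub_ne_zero hz _⟩

theorem mFourier_single_apply {d : ℕ} (j : Fin d) (n : ℤ) (θ : UnitAddTorus (Fin d)) :
    UnitAddTorus.mFourier (Pi.single j n) θ = fourier n (θ j) := by
  rw [UnitAddTorus.mFourier, ContinuousMap.coe_mk, Finset.prod_eq_single j]
  · rw [Pi.single_eq_same]
  · intro i _ hi
    rw [Pi.single_eq_of_ne hi, fourier_zero]
  · intro h
    exact absurd (Finset.mem_univ j) h

theorem fmul_symbolSub (d : ℕ) (z : ℂ) : fmul (symbolSub d z) = H0 d - z • 1 := by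
  have h : symbolSub d z =
      -∑ j : Fin d, ((UnitAddTorus.mFourier (Pi.single j 1) - 1) +
        (UnitAddTorus.mFourier (-Pi.single j 1) - 1)) - z • 1 := by
    ext θ
    simp only [symbolSub, torusH0, ContinuousMap.coe_mk, ContinuousMap.sub_apply,
      ContinuousMap.neg_apply, ContinuousMap.sum_apply, ContinuousMap.add_apply,
      ContinuousMap.one_apply, ContinuousMap.smul_apply, smul_eq_mul, mul_one,
      ← Pi.single_neg, mFourier_single_apply, Complex.ofReal_sum, ofReal_kap]
    rw [← Finset.sum_neg_distrib]
    congr 1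
    refine Finset.sum_congr rfl fun j _ => ?_
    ring
  rw [h, ← fmulHom_apply, map_sub, map_neg, map_sum, map_smul, map_one, H0]
  simp only [map_add, map_sub, map_one, fmulHom_apply, fmul_mFourier]

/-- For non-real z the symbol h₀ - z has no zero, so its reciprocal is continuous; multiplicativity
of `fmul` makes it a two-sided inverse. -/
theorem resH0_eq_fmul (d : ℕ) (z : ℂ) (hz : z.im ≠ 0) :
    resH0 d z = fmul (symbolRes d z hz) := by
  have h1 : symbolSub d z * symbolRes d z hz = 1 := by
    ext θ
    exact mul_inv_cancel₀ (ofReal_sub_ne_zero hz _)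
  have h2 : fmul (symbolSub d z) * fmul (symbolRes d z hz) = 1 := by
    rw [← fmul_mul, h1, fmul_one]
  have h3 : fmul (symbolRes d z hz) * fmul (symbolSub d z) = 1 := by
    rw [← fmul_mul, mul_comm, h1, fmul_one]
  rw [resH0, ← fmul_symbolSub]
  exact Ring.inverse_unit ⟨_, _, h2, h3⟩

/-- A real smooth function on the torus as a continuous complex function. -/
def TorusSmooth.toC {d : ℕ} {χ : UnitAddTorus (Fin d) → ℝ} (hχ : TorusSmooth χ) :
    C(UnitAddTorus (Fin d), ℂ) :=
  ⟨fun θ => (χ θ : ℂ), Complex.continuous_ofReal.comp hχ.continuous⟩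

theorem chiD_eq_fmul {d : ℕ} {χ : UnitAddTorus (Fin d) → ℝ} (hχ : TorusSmooth χ) :
    chiD χ hχ = fmul hχ.toC := rfl

/-- Multipliers commute, so the two cut-offs merge into the single factor χ², which is what gets
localized later. -/
theorem cutoffResolvent_eq {d : ℕ} {χ : UnitAddTorus (Fin d) → ℝ} (hχ : TorusSmooth χ) {ε : ℝ}
    (hε : 0 < ε) {z : ℂ} (hz : z.im ≠ 0) :
    cutoffResolvent χ hχ ε hε z = latWeight d (1 / 2 + ε) (by positivity) ∘L
      fmul (hχ.toC ^ 2 * symbolRes d z hz) ∘L latWeight d (1 / 2 + ε) (by positivity) := by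
  have h : hχ.toC ^ 2 * symbolRes d z hz = hχ.toC * (symbolRes d z hz * hχ.toC) := by ring
  rw [h, fmul_mul, fmul_mul, cutoffResolvent, chiD_eq_fmul, resH0_eq_fmul d z hz]
  rfl

end DiscreteSchrodinger

end

noncomputable section

namespace DiscreteSchrodinger

/-! ### Slices of the lattice -/

section Slice

variable {d : ℕ}

/-- The projection of `ℓ²(ℤ^d)` onto the functions supported on `{x_j = s}`. -/
def sliceProj (j : Fin d) (s : ℤ) : Hil d →L[ℂ] Hil d :=
  diagOp (fun x => if x j = s then 1 else 0) 1 fun x => by split_ifs <;> simp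

theorem sliceProj_apply (j : Fin d) (s : ℤ) (u : Hil d) (x : Fin d → ℤ) :
    sliceProj j s u x = if x j = s then u x else 0 := by
  rw [sliceProj, diagOp_apply]
  split_ifs <;> simp

theorem sliceProj_sliceProj (j : Fin d) (s : ℤ) (u : Hil d) :
    sliceProj j s (sliceProj j s u) = sliceProj j s u := by
  ext x
  simp only [sliceProj_apply]
  split_ifs <;> rfl

theorem sliceProj_diagOp (j : Fin d) (s : ℤ) (a : (Fin d → ℤ) → ℂ) (C : ℝ)
    (ha : ∀ x, ‖a x‖ ≤ C) (u : Hil d) :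
    sliceProj j s (diagOp a C ha u) = diagOp a C ha (sliceProj j s u) := by
  ext x
  simp only [sliceProj_apply, diagOp_apply]
  split_ifs <;> simp

theorem norm_diagOp_sliceProj_le (j : Fin d) (s : ℤ) (a : (Fin d → ℤ) → ℂ) (C : ℝ)
    (ha : ∀ x, ‖a x‖ ≤ C) {w : ℝ} (hw0 : 0 ≤ w) (hw : ∀ x, x j = s → ‖a x‖ ≤ w) (u : Hil d) :
    ‖diagOp a C ha (sliceProj j s u)‖ ≤ w * ‖sliceProj j s u‖ := by
  have h : ‖(w : ℂ) • sliceProj j s u‖ = w * ‖sliceProj j s u‖ := by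
    rw [norm_smul, Complex.norm_real, Real.norm_eq_abs, abs_of_nonneg hw0]
  rw [← h]
  refine lp.norm_mono (by norm_num) fun x => ?_
  simp only [diagOp_apply, lp.coeFn_smul, Pi.smul_apply, smul_eq_mul, norm_mul,
    Complex.norm_real, Real.norm_eq_abs, abs_of_nonneg hw0, sliceProj_apply]
  split_ifs with hx
  · exact mul_le_mul_of_nonneg_right (hw x hx) (norm_nonneg _)
  · simp

theorem norm_sliceProj_le (j : Fin d) (s : ℤ) : ‖sliceProj j s‖ ≤ 1 :=
  ContinuousLinearMap.opNorm_le_bound _ zero_le_one fun u => by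
    rw [one_mul]
    refine lp.norm_mono (by norm_num) fun x => ?_
    rw [sliceProj_apply]
    split_ifs <;> simp

theorem hasSum_sliceProj (j : Fin d) (u : Hil d) : HasSum (fun s => sliceProj j s u) u := by
  have h := lp.hasSum_single (ENNReal.ofNat_ne_top (n := 2)) u
  -- Group the expansion into point masses according to the value of the j-th coordinate.
  rw [← (Equiv.sigmaFiberEquiv fun x : Fin d → ℤ => x j).hasSum_iff] at h
  refine h.sigma fun s => ?_
  have h1 := lp.hasSum_single (ENNReal.ofNat_ne_top (n := 2)) (sliceProj j s u)
  rw [← hasSum_subtype_iff_of_support_subset (s := {x | x j = s})] at h1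
  · convert! h1 using 1
    funext x
    have h2 : sliceProj j s u x.1 = u x.1 := by rw [sliceProj_apply]; exact if_pos x.2
    exact congrArg (lp.single 2 x.1) h2.symm
  · intro x hx
    by_contra hxs
    refine hx ?_
    have h2 : sliceProj j s u x = 0 := by rw [sliceProj_apply]; exact if_neg hxs
    exact (congrArg (lp.single 2 x) h2).trans (lp.single_zero _ _)

/-- Pythagoras for the slices: pair the decomposition of u with u itself and use that each slice map
is an orthogonal projection. -/
theorem hasSum_norm_sliceProj_sq (j : Fin d) (u : Hil d) :
    HasSum (fun s => ‖sliceProj j s u‖ ^ 2) (‖u‖ ^ 2) := by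
  have h := (hasSum_sliceProj j u).mapL (innerSL ℂ u)
  have h2 := h.mapL Complex.reCLM
  have h3 : ∀ s, inner ℂ u (sliceProj j s u) =
      inner ℂ (sliceProj j s u) (sliceProj j s u) := fun s => by
    rw [lp.inner_eq_tsum, lp.inner_eq_tsum]
    congr 1
    ext x
    rw [sliceProj_apply]
    split_ifs <;> simp
  convert! h2 using 1
  · ext s
    rw [innerSL_apply_apply, h3, inner_self_eq_norm_sq_to_K]
    norm_cast
  · rw [innerSL_apply_apply, inner_self_eq_norm_sq_to_K]
    norm_cast

/-- A Hilbert–Schmidt bound for an operator between weights, in terms of its blocks with respect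
to the slices `{x_j = s}`. -/
theorem norm_diagOp_comp_le (j : Fin d) (T : Hil d →L[ℂ] Hil d) (a : (Fin d → ℤ) → ℂ) (C : ℝ)
    (ha : ∀ x, ‖a x‖ ≤ C) (w : ℤ → ℝ) (hw0 : ∀ s, 0 ≤ w s) (hw : ∀ x, ‖a x‖ ≤ w (x j))
    (k : ℤ → ℤ → ℝ)
    (hk : ∀ s r u, ‖sliceProj j s (T (sliceProj j r u))‖ ≤ k s r * ‖u‖)
    {B : ℝ} (hsum : HasSum (fun p : ℤ × ℤ => (k p.1 p.2 * (w p.1 * w p.2)) ^ 2) B) :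
    ‖diagOp a C ha ∘L T ∘L diagOp a C ha‖ ≤ Real.sqrt B := by
  refine ContinuousLinearMap.opNorm_le_bound _ (Real.sqrt_nonneg _) fun u => ?_
  set L := diagOp a C ha with hL
  set K : ℤ → ℤ → ℝ := fun s r => k s r * (w s * w r) with hK
  have hs1 : ∀ s, Summable fun r => K s r ^ 2 := fun s => hsum.summable.prod_factor s
  -- Output on slice s: sum over the input slices r and apply Cauchy–Schwarz against the norms of
  -- the slices of u, whose squares add up to ‖u‖².
  have hrow : ∀ s, ‖sliceProj j s (L (T (L u)))‖ ^ 2 ≤ (∑' r, K s r ^ 2) * ‖u‖ ^ 2 := by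
    intro s
    have h1 : HasSum (fun r => sliceProj j s (L (T (sliceProj j r (L u)))))
        (sliceProj j s (L (T (L u)))) :=
      (hasSum_sliceProj j (L u)).mapL (sliceProj j s ∘L L ∘L T)
    -- The weights are diagonal, hence commute with the slice projections, and the block (s, r)
    -- picks up at most the factor w s * w r.
    have h2 : ∀ r, ‖sliceProj j s (L (T (sliceProj j r (L u))))‖ ≤
        |K s r| * ‖sliceProj j r u‖ := by
      intro r
      rw [hL, sliceProj_diagOp]
      refine (norm_diagOp_sliceProj_le j s a C ha (hw0 s) (fun x hx => hx ▸ hw x) _).trans ?_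
      rw [sliceProj_diagOp, ← sliceProj_sliceProj j r u, ← sliceProj_diagOp]
      have h3 := norm_diagOp_sliceProj_le j r a C ha (hw0 r) (fun x hx => hx ▸ hw x) u
      have h4 := hk s r (diagOp a C ha (sliceProj j r u))
      have h5 : 0 ≤ ‖sliceProj j s (T (sliceProj j r (diagOp a C ha (sliceProj j r u))))‖ :=
        norm_nonneg _
      rw [sliceProj_sliceProj j r u]
      calc w s * ‖sliceProj j s (T (sliceProj j r (diagOp a C ha (sliceProj j r u))))‖
          ≤ w s * (|k s r| * (w r * ‖sliceProj j r u‖)) := by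
            refine mul_le_mul_of_nonneg_left ?_ (hw0 s)
            refine h4.trans ?_
            exact mul_le_mul (le_abs_self _) h3 (norm_nonneg _) (abs_nonneg _)
        _ = |K s r| * ‖sliceProj j r u‖ := by
            rw [hK]
            simp only [abs_mul, abs_of_nonneg (hw0 _)]
            ring
    have h6s := Real.summable_mul_of_Lp_Lq_of_nonneg (p := 2) (q := 2) (f := fun r => |K s r|)
      (g := fun r => ‖sliceProj j r u‖) (by norm_num [Real.holderConjugate_iff])
      (fun r => abs_nonneg _) (fun r => norm_nonneg _)
      (by simpa using hs1 s) (by simpa using (hasSum_norm_sliceProj_sq j u).summable)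
    have h6 := Real.inner_le_Lp_mul_Lq_tsum_of_nonneg (p := 2) (q := 2) (f := fun r => |K s r|)
      (g := fun r => ‖sliceProj j r u‖) (by norm_num [Real.holderConjugate_iff])
      (fun r => abs_nonneg _) (fun r => norm_nonneg _)
      (by simpa using hs1 s) (by simpa using (hasSum_norm_sliceProj_sq j u).summable)
    have h7 : ‖sliceProj j s (L (T (L u)))‖ ≤ ∑' r, |K s r| * ‖sliceProj j r u‖ := by
      rw [← h1.tsum_eq]
      exact tsum_of_norm_bounded h6s.hasSum h2
    have h8 := h7.trans h6
    simp only [Real.rpow_two, sq_abs, ← Real.sqrt_eq_rpow,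
      (hasSum_norm_sliceProj_sq j u).tsum_eq] at h8
    rw [← Real.sqrt_mul (tsum_nonneg fun r => sq_nonneg _)] at h8
    calc _ ≤ Real.sqrt ((∑' r, K s r ^ 2) * ‖u‖ ^ 2) ^ 2 := by gcongr
      _ = _ := Real.sq_sqrt (mul_nonneg (tsum_nonneg fun r => sq_nonneg _) (sq_nonneg _))
  have h9 : HasSum (fun s => ∑' r, K s r ^ 2) B := hsum.prod_fiberwise fun s => (hs1 s).hasSum
  have h10 := hasSum_le hrow (hasSum_norm_sliceProj_sq j (L (T (L u)))) (h9.mul_right (‖u‖ ^ 2))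
  have h11 := Real.sqrt_le_sqrt h10
  rw [Real.sqrt_mul' _ (sq_nonneg _), Real.sqrt_sq (norm_nonneg _), Real.sqrt_sq (norm_nonneg _)]
    at h11
  exact h11

/-! ### Partial Fourier coefficients of a symbol -/

/-- The part of the symbol `m` whose Fourier coefficients are supported on `{y_j = -n}`. -/
def partialSymbol (j : Fin d) (n : ℤ) (m : C(UnitAddTorus (Fin d), ℂ)) :
    C(UnitAddTorus (Fin d), ℂ) :=
  ⟨fun θ => ∫ τ : UnitAddCircle, m (θ + Pi.single j τ) * fourier n τ ∂AddCircle.haarAddCircle, by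
    have hsing : Continuous (fun τ : UnitAddCircle => (Pi.single j τ : UnitAddTorus (Fin d))) :=
      continuous_single (A := fun _ : Fin d => UnitAddCircle) j
    refine continuous_of_dominated (bound := fun _ => ‖m‖) (fun θ => ?_) (fun θ => ?_) ?_ ?_
    · refine Continuous.aestronglyMeasurable ?_
      fun_prop
    · refine .of_forall fun τ => ?_
      rw [norm_mul]
      refine (mul_le_mul (m.norm_coe_le_norm _) ((fourier n).norm_coe_le_norm τ)
        (norm_nonneg _) (norm_nonneg _)).trans ?_
      rw [fourier_norm, mul_one]
    · exact integrable_const _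
    · refine .of_forall fun τ => ?_
      fun_prop⟩

theorem partialSymbol_apply (j : Fin d) (n : ℤ) (m : C(UnitAddTorus (Fin d), ℂ))
    (θ : UnitAddTorus (Fin d)) : partialSymbol j n m θ =
      ∫ τ : UnitAddCircle, m (θ + Pi.single j τ) * fourier n τ ∂AddCircle.haarAddCircle := rfl

theorem mFourier_apply_add (y : Fin d → ℤ) (θ η : UnitAddTorus (Fin d)) :
    UnitAddTorus.mFourier y (θ + η) = UnitAddTorus.mFourier y θ * UnitAddTorus.mFourier y η := by
  simp only [UnitAddTorus.mFourier, ContinuousMap.coe_mk, Pi.add_apply, ← Finset.prod_mul_distrib]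
  refine Finset.prod_congr rfl fun i _ => ?_
  simp [fourier_apply, smul_add, AddCircle.toCircle_add]

theorem mFourier_apply_single (y : Fin d → ℤ) (j : Fin d) (τ : UnitAddCircle) :
    UnitAddTorus.mFourier y (Pi.single j τ) = fourier (y j) τ := by
  rw [UnitAddTorus.mFourier, ContinuousMap.coe_mk, Finset.prod_eq_single j]
  · rw [Pi.single_eq_same]
  · intro i _ hi
    rw [Pi.single_eq_of_ne hi, fourier_eval_zero]
  · intro h
    exact absurd (Finset.mem_univ j) h

/-- Averaging translates in direction j against a character of the circle keeps exactly the Fourier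
modes with the prescribed j-th frequency. The proof is Fubini and translation invariance of Haar
measure. -/
theorem mFourierCoeff_partialSymbol (j : Fin d) (m : C(UnitAddTorus (Fin d), ℂ))
    (y : Fin d → ℤ) :
    UnitAddTorus.mFourierCoeff (partialSymbol j (-y j) m) y = UnitAddTorus.mFourierCoeff m y := by
  have h1 : UnitAddTorus.mFourierCoeff (partialSymbol j (-y j) m) y =
      ∫ θ, ∫ τ : UnitAddCircle, UnitAddTorus.mFourier (-y) (θ + Pi.single j τ) *
        m (θ + Pi.single j τ) ∂AddCircle.haarAddCircle ∂torusMeasure d := by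
    refine integral_congr_ae (.of_forall fun θ => ?_)
    simp only [partialSymbol_apply, smul_eq_mul]
    rw [← integral_const_mul]
    refine integral_congr_ae (.of_forall fun τ => ?_)
    simp only [mFourier_apply_add, mFourier_apply_single, Pi.neg_apply]
    ring
  rw [h1, integral_integral_swap]
  · have h2 : ∀ τ : UnitAddCircle, ∫ θ, UnitAddTorus.mFourier (-y) (θ + Pi.single j τ) *
        m (θ + Pi.single j τ) ∂torusMeasure d = UnitAddTorus.mFourierCoeff m y := fun τ => by
      rw [integral_add_right_eq_self fun θ => UnitAddTorus.mFourier (-y) θ * m θ]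
      rfl
    simp only [h2, integral_const, probReal_univ, one_smul]
  · refine Continuous.integrable_of_hasCompactSupport ?_ ?_
    · have hsing : Continuous (fun τ : UnitAddCircle => (Pi.single j τ : UnitAddTorus (Fin d))) :=
        continuous_single (A := fun _ : Fin d => UnitAddCircle) j
      have hF := (UnitAddTorus.mFourier (-y)).continuous
      fun_prop
    · exact HasCompactSupport.of_compactSpace _

/-- Between slices r and s only matrix entries with (y - x)_j = r - s occur, and these are unchanged
when m is replaced by its partial symbol of index s - r. The sup norm of that partial symbol then
bounds the block. -/
theorem sliceProj_fmul_sliceProj (j : Fin d) (m : C(UnitAddTorus (Fin d), ℂ)) (s r : ℤ) :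
    sliceProj j s ∘L fmul m ∘L sliceProj j r =
      sliceProj j s ∘L fmul (partialSymbol j (s - r) m) ∘L sliceProj j r := by
  refine hil_ext fun y => ?_
  by_cases hy : y j = r
  · have h : sliceProj j r (lp.single 2 y 1) = lp.single 2 y 1 := by
      ext x
      rw [sliceProj_apply, lp.single_apply]
      split_ifs with hx
      · rfl
      · rw [Pi.single_eq_of_ne]
        rintro rfl
        exact hx hy
    simp only [ContinuousLinearMap.comp_apply, h]
    ext x
    rw [sliceProj_apply, sliceProj_apply]
    split_ifs with hx
    · rw [fmul_single_apply, fmul_single_apply, ← mFourierCoeff_partialSymbol j]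
      congr 3
      rw [Pi.sub_apply, hx, hy, neg_sub]
    · rfl
  · have h : sliceProj j r (lp.single 2 y 1) = 0 := by
      ext x
      rw [sliceProj_apply, lp.single_apply]
      split_ifs with hx
      · rw [Pi.single_eq_of_ne]
        · rfl
        · rintro rfl
          exact hy hx
      · rfl
    simp only [ContinuousLinearMap.comp_apply, h, map_zero]

theorem norm_sliceProj_fmul_sliceProj_le (j : Fin d) (m : C(UnitAddTorus (Fin d), ℂ)) (s r : ℤ)
    {C : ℝ} (hC : 0 ≤ C) (h : ∀ θ, ‖partialSymbol j (s - r) m θ‖ ≤ C) (u : Hil d) :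
    ‖sliceProj j s (fmul m (sliceProj j r u))‖ ≤ C * ‖u‖ := by
  have h1 := DFunLike.congr_fun (sliceProj_fmul_sliceProj j m s r) u
  simp only [ContinuousLinearMap.comp_apply] at h1
  rw [h1]
  calc _ ≤ 1 * ‖fmul (partialSymbol j (s - r) m) (sliceProj j r u)‖ :=
        ContinuousLinearMap.le_of_opNorm_le _ (norm_sliceProj_le j s) _
    _ ≤ 1 * (C * ‖sliceProj j r u‖) := by
        gcongr
        exact ContinuousLinearMap.le_of_opNorm_le _ (norm_fmul_le _ hC h) _
    _ ≤ 1 * (C * (1 * ‖u‖)) := by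
        gcongr
        exact ContinuousLinearMap.le_of_opNorm_le _ (norm_sliceProj_le j r) _
    _ = C * ‖u‖ := by ring

end Slice

end DiscreteSchrodinger

end

noncomputable section

namespace DiscreteSchrodinger

/-! ### The resolvent of the one-dimensional discrete Laplacian -/

/-- The two roots of ζ² - (2 - w)ζ + 1 have product 1, so one lies inside the unit disc unless both
are unimodular. The identity Im w = Im ζ (|ζ|⁻² - 1) excludes the unimodular case and shows that Im
ζ has the sign of Im w. -/
theorem exists_decaying_root {w : ℂ} (hw : w.im ≠ 0) :
    ∃ ζ : ℂ, ζ ≠ 0 ∧ ‖ζ‖ < 1 ∧ w = 2 - ζ - ζ⁻¹ ∧ 0 < w.im * ζ.im := by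
  have key : ∀ ζ : ℂ, ζ ≠ 0 → w = 2 - ζ - ζ⁻¹ → w.im = ζ.im * ((‖ζ‖ ^ 2)⁻¹ - 1) := by
    intro ζ h0 h
    rw [h]
    simp only [Complex.sub_im, Complex.im_ofNat, Complex.inv_im, Complex.normSq_eq_norm_sq]
    ring
  have fin : ∀ ζ : ℂ, ζ ≠ 0 → ‖ζ‖ < 1 → w = 2 - ζ - ζ⁻¹ → 0 < w.im * ζ.im := by
    intro ζ h0 h1 h
    have h2 := key ζ h0 h
    have h3 : ζ.im ≠ 0 := fun h3 => hw (by rw [h2, h3, zero_mul])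
    have h4 : 1 < (‖ζ‖ ^ 2)⁻¹ := by
      have h5 : 0 < ‖ζ‖ := norm_pos_iff.2 h0
      rw [one_lt_inv₀ (by positivity)]
      nlinarith
    have h5 : 0 < ζ.im ^ 2 := by positivity
    rw [h2]
    nlinarith
  obtain ⟨D, hD⟩ := IsAlgClosed.exists_eq_mul_self (discrim (1 : ℂ) (-(2 - w)) 1)
  obtain ⟨ζ, hζ⟩ := exists_quadratic_eq_zero (one_ne_zero (α := ℂ)) ⟨D, hD⟩
  have h0 : ζ ≠ 0 := by
    rintro rfl
    simp at hζ
  have h1 : w = 2 - ζ - ζ⁻¹ := by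
    field_simp
    linear_combination hζ
  rcases lt_trichotomy ‖ζ‖ 1 with h | h | h
  · exact ⟨ζ, h0, h, h1, fin ζ h0 h h1⟩
  · refine absurd (key ζ h0 h1) ?_
    rw [h]
    simpa using hw
  · have h2 : w = 2 - ζ⁻¹ - ζ⁻¹⁻¹ := by rw [inv_inv, h1]; ring
    have h3 : ‖ζ⁻¹‖ < 1 := by rw [norm_inv]; exact inv_lt_one_of_one_lt₀ h
    exact ⟨ζ⁻¹, inv_ne_zero h0, h3, h2, fin _ (inv_ne_zero h0) h3 h2⟩

/-- From ζ⁻¹ one reaches ζ by reflecting in the real axis, at cost 2|Im ζ⁻¹|, and contracting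
radially, at cost at most 2(|ζ⁻¹| - 1). Both costs are controlled by the distance to ζ': it lies in
the unit disc, and in the half-plane opposite to that of ζ⁻¹. The common half-plane of ζ and ζ' is
essential. -/
theorem norm_inv_sub_self_le {ζ ζ' : ℂ} (h0 : ζ ≠ 0) (h1 : ‖ζ‖ < 1) (h1' : ‖ζ'‖ < 1)
    (him : 0 < ζ.im * ζ'.im) : ‖ζ⁻¹ - ζ‖ ≤ 4 * ‖ζ⁻¹ - ζ'‖ := by
  have hp : 0 < ‖ζ‖ := norm_pos_iff.2 h0
  have hinv : 1 < ‖ζ⁻¹‖ := by rw [norm_inv]; exact (one_lt_inv₀ hp).2 h1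
  have e1 : ‖ζ⁻¹‖ - 1 ≤ ‖ζ⁻¹ - ζ'‖ := by
    have := norm_sub_norm_le ζ⁻¹ ζ'
    linarith
  have e2 : |(ζ⁻¹).im| ≤ ‖ζ⁻¹ - ζ'‖ := by
    refine le_trans ?_ (Complex.abs_im_le_norm _)
    rw [Complex.sub_im, Complex.inv_im]
    have hn : 0 < Complex.normSq ζ := Complex.normSq_pos.2 h0
    rcases pos_and_pos_or_neg_and_neg_of_mul_pos him with ⟨h, h'⟩ | ⟨h, h'⟩
    · have : 0 < ζ.im / Complex.normSq ζ := div_pos h hn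
      rw [neg_div, abs_of_neg (by linarith), abs_of_neg (by linarith)]
      linarith
    · have : ζ.im / Complex.normSq ζ < 0 := div_neg_of_neg_of_pos h hn
      rw [neg_div, abs_of_pos (by linarith), abs_of_pos (by linarith)]
      linarith
  have e3 : ζ = (starRingEnd ℂ) ζ⁻¹ * ((‖ζ‖ ^ 2 : ℝ) : ℂ) := by
    rw [← Complex.normSq_eq_norm_sq, map_inv₀, ← Complex.mul_conj]
    have : (starRingEnd ℂ) ζ ≠ 0 := by simpa using h0
    field_simp
  have e4 : ζ⁻¹ - ζ = (ζ⁻¹ - (starRingEnd ℂ) ζ⁻¹) +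
      (starRingEnd ℂ) ζ⁻¹ * ((1 - ‖ζ‖ ^ 2 : ℝ) : ℂ) := by
    nth_rw 2 [e3]
    push_cast
    ring
  have e5 : ‖ζ⁻¹ - (starRingEnd ℂ) ζ⁻¹‖ = 2 * |(ζ⁻¹).im| := by
    rw [Complex.sub_conj, norm_mul, Complex.norm_I, mul_one, Complex.norm_real,
      Real.norm_eq_abs, abs_mul, abs_two]
  have e6 : ‖(starRingEnd ℂ) ζ⁻¹ * ((1 - ‖ζ‖ ^ 2 : ℝ) : ℂ)‖ ≤ 2 * (‖ζ⁻¹‖ - 1) := by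
    rw [norm_mul, RCLike.norm_conj, Complex.norm_real, Real.norm_eq_abs,
      abs_of_nonneg (by nlinarith), norm_inv]
    have : ‖ζ‖⁻¹ * (1 - ‖ζ‖ ^ 2) = (‖ζ‖⁻¹ - 1) * (1 + ‖ζ‖) := by field_simp; ring
    rw [this]
    rw [norm_inv] at hinv
    nlinarith
  have e7 := norm_add_le (ζ⁻¹ - (starRingEnd ℂ) ζ⁻¹)
    ((starRingEnd ℂ) ζ⁻¹ * ((1 - ‖ζ‖ ^ 2 : ℝ) : ℂ))
  rw [← e4, e5] at e7
  linarith

/-- The identity w - w' = (ζ - ζ') ζ'⁻¹ (ζ⁻¹ - ζ') shows that the root is a Lipschitz function of w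
away from the thresholds, as long as w stays on one side of the spectrum. -/
theorem norm_root_sub_le {ζ ζ' : ℂ} (h0 : ζ ≠ 0) (h0' : ζ' ≠ 0) (h1 : ‖ζ‖ < 1) (h1' : ‖ζ'‖ < 1)
    (him : 0 < ζ.im * ζ'.im) :
    ‖ζ - ζ'‖ * ‖ζ⁻¹ - ζ‖ ≤ 4 * ‖(2 - ζ - ζ⁻¹) - (2 - ζ' - ζ'⁻¹)‖ := by
  have e1 : (2 - ζ - ζ⁻¹) - (2 - ζ' - ζ'⁻¹) = (ζ - ζ') * (ζ'⁻¹ * (ζ⁻¹ - ζ')) := by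
    field_simp
    ring
  rw [e1, norm_mul, norm_mul, norm_inv]
  have h2 : 1 ≤ ‖ζ'‖⁻¹ := (one_le_inv₀ (norm_pos_iff.2 h0')).2 h1'.le
  have h3 := norm_inv_sub_self_le h0 h1 h1' him
  have h4 : ‖ζ⁻¹ - ζ'‖ ≤ ‖ζ'‖⁻¹ * ‖ζ⁻¹ - ζ'‖ := le_mul_of_one_le_left (norm_nonneg _) h2
  calc _ ≤ ‖ζ - ζ'‖ * (4 * (‖ζ'‖⁻¹ * ‖ζ⁻¹ - ζ'‖)) := by gcongr; linarith
    _ = _ := by ring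

theorem norm_pow_sub_pow_le_of_norm_lt_one {ζ ζ' : ℂ} (h : ‖ζ‖ < 1) (h' : ‖ζ'‖ < 1) (k : ℕ) :
    ‖ζ ^ k - ζ' ^ k‖ ≤ k * ‖ζ - ζ'‖ := by
  induction k with
  | zero => simp
  | succ k ih =>
    have e : ζ ^ (k + 1) - ζ' ^ (k + 1) = (ζ ^ k - ζ' ^ k) * ζ + ζ' ^ k * (ζ - ζ') := by ring
    have h2 : ‖ζ' ^ k‖ ≤ 1 := by rw [norm_pow]; exact pow_le_one₀ (norm_nonneg _) h'.le
    calc _ ≤ ‖ζ ^ k - ζ' ^ k‖ * ‖ζ‖ + ‖ζ' ^ k‖ * ‖ζ - ζ'‖ := by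
          rw [e, ← norm_mul, ← norm_mul]; exact norm_add_le _ _
      _ ≤ (k * ‖ζ - ζ'‖) * 1 + 1 * ‖ζ - ζ'‖ := by gcongr
      _ = _ := by push_cast; ring

/-- The roots differ by at most 4δ/r. Varying ζ^k costs a factor k and one inverse denominator;
varying the denominator ζ⁻¹ - ζ costs δ + 8δ/r and two inverse denominators. -/
theorem norm_greenCoeff_sub_le {ζ ζ' : ℂ} (h0 : ζ ≠ 0) (h0' : ζ' ≠ 0) (h1 : ‖ζ‖ < 1)
    (h1' : ‖ζ'‖ < 1) (him : 0 < ζ.im * ζ'.im) {r : ℝ} (hr : 0 < r) (hD : r ≤ ‖ζ⁻¹ - ζ‖)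
    (hD' : r ≤ ‖ζ'⁻¹ - ζ'‖) (k : ℕ) :
    ‖ζ ^ k * (ζ⁻¹ - ζ)⁻¹ - ζ' ^ k * (ζ'⁻¹ - ζ')⁻¹‖ ≤
      (5 / r ^ 2 + 8 / r ^ 3) * (1 + k) * ‖(2 - ζ - ζ⁻¹) - (2 - ζ' - ζ'⁻¹)‖ := by
  set δ := ‖(2 - ζ - ζ⁻¹) - (2 - ζ' - ζ'⁻¹)‖ with hδ
  have hδ0 : 0 ≤ δ := norm_nonneg _
  have e1 : ‖ζ - ζ'‖ ≤ 4 * δ / r := by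
    rw [le_div_iff₀ hr]
    exact (mul_le_mul_of_nonneg_left hD (norm_nonneg _)).trans
      (norm_root_sub_le h0 h0' h1 h1' him)
  have n1 : ζ⁻¹ - ζ ≠ 0 := norm_pos_iff.1 (hr.trans_le hD)
  have n2 : ζ'⁻¹ - ζ' ≠ 0 := norm_pos_iff.1 (hr.trans_le hD')
  have e2 : ‖(ζ'⁻¹ - ζ') - (ζ⁻¹ - ζ)‖ ≤ δ + 2 * (4 * δ / r) := by
    have : (ζ'⁻¹ - ζ') - (ζ⁻¹ - ζ) = ((2 - ζ - ζ⁻¹) - (2 - ζ' - ζ'⁻¹)) + 2 * (ζ - ζ') := by ring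
    rw [this]
    refine (norm_add_le _ _).trans ?_
    rw [norm_mul, Complex.norm_ofNat]
    gcongr
  have i1 : ‖(ζ⁻¹ - ζ)⁻¹‖ ≤ r⁻¹ := by rw [norm_inv]; gcongr
  have i2 : ‖(ζ'⁻¹ - ζ')⁻¹‖ ≤ r⁻¹ := by rw [norm_inv]; gcongr
  have e3 : ζ ^ k * (ζ⁻¹ - ζ)⁻¹ - ζ' ^ k * (ζ'⁻¹ - ζ')⁻¹ = (ζ ^ k - ζ' ^ k) * (ζ⁻¹ - ζ)⁻¹ +
      ζ' ^ k * (((ζ'⁻¹ - ζ') - (ζ⁻¹ - ζ)) * ((ζ⁻¹ - ζ)⁻¹ * (ζ'⁻¹ - ζ')⁻¹)) := by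
    have : ((ζ'⁻¹ - ζ') - (ζ⁻¹ - ζ)) * ((ζ⁻¹ - ζ)⁻¹ * (ζ'⁻¹ - ζ')⁻¹) =
        (ζ⁻¹ - ζ)⁻¹ - (ζ'⁻¹ - ζ')⁻¹ := by
      rw [inv_sub_inv n1 n2, div_eq_mul_inv, mul_inv]
    rw [this]
    ring
  have h2 : ‖ζ' ^ k‖ ≤ 1 := by rw [norm_pow]; exact pow_le_one₀ (norm_nonneg _) h1'.le
  have h3 := norm_pow_sub_pow_le_of_norm_lt_one h1 h1' k
  calc _ ≤ ‖ζ ^ k - ζ' ^ k‖ * ‖(ζ⁻¹ - ζ)⁻¹‖ + ‖ζ' ^ k‖ * (‖(ζ'⁻¹ - ζ') - (ζ⁻¹ - ζ)‖ *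
        (‖(ζ⁻¹ - ζ)⁻¹‖ * ‖(ζ'⁻¹ - ζ')⁻¹‖)) := by
        rw [e3, ← norm_mul, ← norm_mul, ← norm_mul, ← norm_mul]
        exact norm_add_le _ _
    _ ≤ (k * (4 * δ / r)) * r⁻¹ + 1 * ((δ + 2 * (4 * δ / r)) * (r⁻¹ * r⁻¹)) := by
        gcongr
        exact h3.trans (by gcongr)
    _ = (4 / r ^ 2 * k + (1 / r ^ 2 + 8 / r ^ 3)) * δ := by field_simp; ring
    _ ≤ (5 / r ^ 2 + 8 / r ^ 3) * (1 + k) * δ := by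
        refine mul_le_mul_of_nonneg_right ?_ hδ0
        have p1 : 0 ≤ 1 / r ^ 2 := by positivity
        have p2 : 0 ≤ 8 / r ^ 3 * k := by positivity
        have p3 : 0 ≤ 1 / r ^ 2 * k := by positivity
        have q : (5 / r ^ 2 + 8 / r ^ 3) * (1 + k) = (4 / r ^ 2 * k + (1 / r ^ 2 + 8 / r ^ 3)) +
          (4 * (1 / r ^ 2) + 8 / r ^ 3 * k + 1 / r ^ 2 * k) := by ring
        rw [q]
        linarith

/-! ### Fourier series of the one-dimensional Green function -/

theorem fourier_natCast (k : ℕ) (τ : UnitAddCircle) :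
    (fourier (k : ℤ) τ : ℂ) = (fourier 1 τ) ^ k := by
  induction k with
  | zero => simp
  | succ k ih => rw [Nat.cast_succ, fourier_add, ih, pow_succ]

theorem norm_fourier_apply (k : ℤ) (τ : UnitAddCircle) : ‖(fourier k τ : ℂ)‖ = 1 := by
  rw [fourier_apply, Circle.norm_coe]

/-- With e the basic character and e' its inverse, κ - w = ζ⁻¹(1 - ζe)(1 - ζe'). The series over k ≥
0 and over k < 0 are geometric in ζe and ζe'. -/
theorem hasSum_green {ζ w : ℂ} (h0 : ζ ≠ 0) (h1 : ‖ζ‖ < 1) (hw : w = 2 - ζ - ζ⁻¹)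
    (τ : UnitAddCircle) :
    HasSum (fun k : ℤ => ζ ^ k.natAbs * fourier k τ) ((ζ⁻¹ - ζ) * ((kap τ : ℂ) - w)⁻¹) := by
  set e : ℂ := fourier 1 τ with he
  set e' : ℂ := fourier (-1) τ with he'
  have hee : e * e' = 1 := by rw [he, he', ← fourier_add]; simp
  have hn : ‖e‖ = 1 := norm_fourier_apply _ _
  have hn' : ‖e'‖ = 1 := norm_fourier_apply _ _
  have l1 : ‖ζ * e‖ < 1 := by rw [norm_mul, hn, mul_one]; exact h1
  have l2 : ‖ζ * e'‖ < 1 := by rw [norm_mul, hn', mul_one]; exact h1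
  have ne : ∀ x : ℂ, ‖x‖ < 1 → 1 - x ≠ 0 := fun x hx h => by
    rw [← sub_eq_zero.1 h, norm_one] at hx
    exact lt_irrefl _ hx
  have s1 := hasSum_geometric_of_norm_lt_one l1
  have s2 := (hasSum_geometric_of_norm_lt_one l2).mul_left (ζ * e')
  have hfneg : ∀ k : ℕ, (fourier (-(k : ℤ)) τ : ℂ) = e' ^ k := by
    intro k
    induction k with
    | zero => simp
    | succ k ih =>
      rw [Nat.cast_succ, neg_add, fourier_add, ih, pow_succ]
  have s2' : HasSum (fun k : ℕ => ζ ^ (-((k : ℤ) + 1)).natAbs * (fourier (-((k : ℤ) + 1)) τ : ℂ))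
      (ζ * e' * (1 - ζ * e')⁻¹) := by
    convert! s2 using 1
    funext k
    have h2 : (-((k : ℤ) + 1)).natAbs = k + 1 := by omega
    have h3 := hfneg (k + 1)
    rw [Nat.cast_succ] at h3
    rw [h2, h3]
    ring
  have s := HasSum.of_nat_of_neg_add_one (f := fun k : ℤ => ζ ^ k.natAbs * (fourier k τ : ℂ))
    (by simpa only [Int.natAbs_natCast, fourier_natCast, ← mul_pow] using s1) s2'
  convert! s using 1
  have d1 := ne _ l1
  have d2 := ne _ l2
  have hk : (kap τ : ℂ) - w = ζ⁻¹ * ((1 - ζ * e) * (1 - ζ * e')) := by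
    rw [ofReal_kap, hw, ← he, ← he']
    field_simp
    linear_combination (-ζ ^ 2) * hee
  rw [hk]
  field_simp
  linear_combination ζ ^ 2 * hee

/-- The partial Fourier coefficients of `p / (κ - w)`. -/
def resCoeff (p : UnitAddCircle → ℂ) (n : ℤ) (w : ℂ) : ℂ :=
  ∫ τ : UnitAddCircle, p τ * ((kap τ : ℂ) - w)⁻¹ * fourier n τ ∂AddCircle.haarAddCircle

/-- Integrate the Green series against p term by term: the mode k meets the coefficient of p at l =
-n - k, hence the exponent |-l - n| after reindexing. -/
theorem hasSum_resCoeff (p : C(UnitAddCircle, ℂ)) (n : ℤ) {ζ w : ℂ} (h0 : ζ ≠ 0) (h1 : ‖ζ‖ < 1)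
    (hw : w = 2 - ζ - ζ⁻¹) (hD : ζ⁻¹ - ζ ≠ 0) :
    HasSum (fun l : ℤ => ζ ^ (-l - n).natAbs * (ζ⁻¹ - ζ)⁻¹ * fourierCoeff p l)
      (resCoeff p n w) := by
  have hsg : Summable fun k : ℤ => ‖ζ‖ ^ k.natAbs := by
    refine Summable.of_nat_of_neg ?_ ?_ <;>
    simpa using summable_geometric_of_lt_one (norm_nonneg ζ) h1
  have H := hasSum_integral_of_summable_integral_norm
    (μ := (AddCircle.haarAddCircle : Measure UnitAddCircle))
    (F := fun (k : ℤ) (τ : UnitAddCircle) =>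
      (ζ⁻¹ - ζ)⁻¹ * (p τ * fourier n τ) * (ζ ^ k.natAbs * fourier k τ)) ?_ ?_
  · rw [← ((Equiv.neg ℤ).trans (Equiv.subRight n)).hasSum_iff] at H
    convert! H using 1
    · funext l
      simp only [Function.comp_apply, Equiv.trans_apply, Equiv.neg_apply, Equiv.subRight_apply]
      rw [fourierCoeff, ← integral_const_mul]
      refine integral_congr_ae (.of_forall fun τ => ?_)
      simp only [smul_eq_mul]
      have : (fourier (-l) τ : ℂ) = fourier n τ * fourier (-l - n) τ := by
        rw [← fourier_add]; congr 2; ring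
      rw [this]
      ring
    · refine integral_congr_ae (.of_forall fun τ => ?_)
      simp only
      rw [((hasSum_green h0 h1 hw τ).mul_left _).tsum_eq]
      linear_combination
        (-(p τ * ((kap τ : ℂ) - w)⁻¹ * fourier n τ)) * inv_mul_cancel₀ hD
  · intro k
    refine Continuous.integrable_of_hasCompactSupport ?_ (HasCompactSupport.of_compactSpace _)
    fun_prop
  · refine Summable.of_nonneg_of_le (fun k => integral_nonneg fun τ => norm_nonneg _) (fun k => ?_)
      (hsg.mul_left (‖(ζ⁻¹ - ζ)⁻¹‖ * ‖p‖))
    have hb : ∀ τ : UnitAddCircle,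
        ‖‖(ζ⁻¹ - ζ)⁻¹ * (p τ * fourier n τ) * (ζ ^ k.natAbs * fourier k τ)‖‖ ≤
          ‖(ζ⁻¹ - ζ)⁻¹‖ * ‖p‖ * ‖ζ‖ ^ k.natAbs := by
      intro τ
      rw [norm_norm, norm_mul, norm_mul, norm_mul, norm_mul, norm_fourier_apply,
        norm_fourier_apply, mul_one, mul_one, norm_pow]
      gcongr
      exact p.norm_coe_le_norm τ
    have := norm_integral_le_of_norm_le_const
      (μ := (AddCircle.haarAddCircle : Measure UnitAddCircle)) (.of_forall hb)
    rw [probReal_univ, mul_one] at this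
    exact (le_abs_self _).trans this

end DiscreteSchrodinger

end

noncomputable section

namespace DiscreteSchrodinger

/-! ### Uniform bounds away from the thresholds -/

theorem norm_le_five {w : ℂ} (hw : ‖w * (w - 4)‖ ≤ 1 / 2) : ‖w‖ ≤ 5 := by
  by_contra! h
  have h1 := norm_sub_norm_le w 4
  rw [Complex.norm_ofNat] at h1
  rw [norm_mul] at hw
  nlinarith

/-- The product (κ - w)(4 - κ - w) equals κ(4 - κ) + w(w - 4), hence has modulus at least a/2 when w
is near a threshold. The second factor is at most 9, whence a/18. -/
theorem norm_ofReal_sub_ge {a κ : ℝ} {w : ℂ} (ha1 : a ≤ 1)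
    (hκ : 0 ≤ κ ∧ κ ≤ 4) (hκa : a < κ * (4 - κ)) (hw : ‖w * (w - 4)‖ ≤ a / 2) :
    a / 18 ≤ ‖(κ : ℂ) - w‖ := by
  have h5 : ‖w‖ ≤ 5 := norm_le_five (by linarith)
  have e1 : ((κ : ℂ) - w) * (4 - κ - w) = (κ * (4 - κ) : ℝ) + w * (w - 4) := by
    push_cast
    ring
  have e2 : a / 2 ≤ ‖((κ : ℂ) - w) * (4 - κ - w)‖ := by
    rw [e1]
    have h1 := norm_sub_le_norm_add ((κ * (4 - κ) : ℝ) : ℂ) (w * (w - 4))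
    rw [Complex.norm_real, Real.norm_eq_abs] at h1
    have h2 := le_abs_self (κ * (4 - κ))
    linarith
  have e3 : ‖(4 : ℂ) - κ - w‖ ≤ 9 := by
    have h1 := norm_sub_le ((4 : ℂ) - κ) w
    have h2 : ‖(4 : ℂ) - κ‖ ≤ 4 := by
      have : (4 : ℂ) - κ = ((4 - κ : ℝ) : ℂ) := by push_cast; ring
      rw [this, Complex.norm_real, Real.norm_eq_abs, abs_le]
      constructor <;> linarith
    linarith
  rw [norm_mul] at e2
  nlinarith [norm_nonneg ((κ : ℂ) - w)]

/-- The hypotheses on a symbol on the circle under which the partial Fourier coefficients of its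
product with a resolvent are controlled. -/
structure CircleSymbol (a B S : ℝ) (b : ℤ → ℝ) (p : C(UnitAddCircle, ℂ)) : Prop where
  norm_le : ∀ τ, ‖p τ‖ ≤ B
  supp : ∀ τ, p τ ≠ 0 → a < kap τ * (4 - kap τ)
  coeff_le : ∀ l, ‖fourierCoeff p l‖ ≤ b l
  hasSum : HasSum (fun l : ℤ => (1 + |(l : ℝ)|) * b l) S

section Bounds

variable {a B S : ℝ} {b : ℤ → ℝ} {p : C(UnitAddCircle, ℂ)}

theorem CircleSymbol.norm_mul_inv_le (hp : CircleSymbol a B S b p) (ha : 0 < a) (ha1 : a ≤ 1)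
    {w : ℂ} (hw : ‖w * (w - 4)‖ ≤ a / 2) (τ : UnitAddCircle) :
    ‖p τ * ((kap τ : ℂ) - w)⁻¹‖ ≤ B * (18 / a) := by
  have hB : 0 ≤ B := (norm_nonneg _).trans (hp.norm_le 0)
  by_cases h : p τ = 0
  · rw [h, zero_mul, norm_zero]
    positivity
  · have h1 := norm_ofReal_sub_ge ha1 (kap_mem τ) (hp.supp τ h) hw
    rw [norm_mul, norm_inv]
    refine mul_le_mul (hp.norm_le τ) ?_ (by positivity) hB
    rw [← inv_div]
    exact inv_anti₀ (by positivity) h1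

theorem CircleSymbol.norm_mul_inv_sub_le (hp : CircleSymbol a B S b p) (ha : 0 < a)
    (ha1 : a ≤ 1) {w w' : ℂ} (hw : ‖w * (w - 4)‖ ≤ a / 2) (hw' : ‖w' * (w' - 4)‖ ≤ a / 2)
    (τ : UnitAddCircle) :
    ‖p τ * ((kap τ : ℂ) - w)⁻¹ - p τ * ((kap τ : ℂ) - w')⁻¹‖ ≤
      B * (18 / a) ^ 2 * ‖w - w'‖ := by
  have hB : 0 ≤ B := (norm_nonneg _).trans (hp.norm_le 0)
  by_cases h : p τ = 0
  · rw [h, zero_mul, zero_mul, sub_zero, norm_zero]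
    positivity
  · have h1 := norm_ofReal_sub_ge ha1 (kap_mem τ) (hp.supp τ h) hw
    have h2 := norm_ofReal_sub_ge ha1 (kap_mem τ) (hp.supp τ h) hw'
    have ha' : 0 < a / 18 := by positivity
    have n1 : (kap τ : ℂ) - w ≠ 0 := norm_pos_iff.1 (ha'.trans_le h1)
    have n2 : (kap τ : ℂ) - w' ≠ 0 := norm_pos_iff.1 (ha'.trans_le h2)
    have e : p τ * ((kap τ : ℂ) - w)⁻¹ - p τ * ((kap τ : ℂ) - w')⁻¹ =
        p τ * (((kap τ : ℂ) - w)⁻¹ * ((kap τ : ℂ) - w')⁻¹) * (w - w') := by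
      field_simp
      ring
    rw [e, norm_mul, norm_mul, norm_mul, norm_inv, norm_inv]
    have i1 : ‖(kap τ : ℂ) - w‖⁻¹ ≤ 18 / a := by
      rw [← inv_div]; exact inv_anti₀ (by positivity) h1
    have i2 : ‖(kap τ : ℂ) - w'‖⁻¹ ≤ 18 / a := by
      rw [← inv_div]; exact inv_anti₀ (by positivity) h2
    rw [pow_two]
    gcongr
    exact hp.norm_le τ

theorem norm_integral_mul_fourier_le {f : UnitAddCircle → ℂ} {n : ℤ} {C : ℝ}
    (h : ∀ τ, ‖f τ‖ ≤ C) :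
    ‖∫ τ : UnitAddCircle, f τ * fourier n τ ∂AddCircle.haarAddCircle‖ ≤ C := by
  refine (norm_integral_le_of_norm_le_const (C := C) (.of_forall fun τ => ?_)).trans ?_
  · rw [norm_mul, norm_fourier_apply, mul_one]
    exact h τ
  · rw [probReal_univ, mul_one]

theorem integrable_resCoeff (p : C(UnitAddCircle, ℂ)) (n : ℤ) {w : ℂ} (hw : w.im ≠ 0) :
    Integrable (fun τ : UnitAddCircle => p τ * ((kap τ : ℂ) - w)⁻¹ * fourier n τ)
      AddCircle.haarAddCircle := by
  refine Continuous.integrable_of_hasCompactSupport ?_ (HasCompactSupport.of_compactSpace _)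
  have h1 : Continuous fun τ : UnitAddCircle => ((kap τ : ℂ) - w)⁻¹ :=
    ((Complex.continuous_ofReal.comp continuous_kap).sub continuous_const).inv₀
      fun τ => ofReal_sub_ne_zero hw _
  fun_prop

/-- Near the thresholds the cut-off keeps κ - w away from zero, so the integrand itself is Lipschitz
in w and no cancellation is needed. -/
theorem CircleSymbol.norm_resCoeff_sub_le_of_near (hp : CircleSymbol a B S b p) (ha : 0 < a)
    (ha1 : a ≤ 1) {w w' : ℂ} (h0 : w.im ≠ 0) (h0' : w'.im ≠ 0)
    (hw : ‖w * (w - 4)‖ ≤ a / 2) (hw' : ‖w' * (w' - 4)‖ ≤ a / 2) (n : ℤ) :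
    ‖resCoeff p n w - resCoeff p n w'‖ ≤ B * (18 / a) ^ 2 * ‖w - w'‖ := by
  rw [resCoeff, resCoeff, ← integral_sub (integrable_resCoeff p n h0) (integrable_resCoeff p n h0')]
  simp only [← sub_mul]
  refine norm_integral_mul_fourier_le (f := fun τ => _) fun τ => ?_
  exact hp.norm_mul_inv_sub_le ha ha1 hw hw' τ

theorem CircleSymbol.b_nonneg (hp : CircleSymbol a B S b p) (l : ℤ) : 0 ≤ b l :=
  (norm_nonneg _).trans (hp.coeff_le l)

theorem CircleSymbol.summable_b (hp : CircleSymbol a B S b p) : Summable b :=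
  hp.hasSum.summable.of_nonneg_of_le hp.b_nonneg fun l =>
    le_mul_of_one_le_left (hp.b_nonneg l) (le_add_of_nonneg_right (abs_nonneg _))

theorem CircleSymbol.tsum_b_le (hp : CircleSymbol a B S b p) : ∑' l, b l ≤ S :=
  hasSum_le (fun l => le_mul_of_one_le_left (hp.b_nonneg l)
    (le_add_of_nonneg_right (abs_nonneg _))) hp.summable_b.hasSum hp.hasSum

/-- Since w(w - 4) = (ζ⁻¹ - ζ)², the Green coefficients blow up only at the thresholds 0 and 4,
which correspond to ζ = 1 and ζ = -1. -/
theorem root_norm_ge {ζ w : ℂ} (h0 : ζ ≠ 0) (hw : w = 2 - ζ - ζ⁻¹)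
    (h : a / 4 ≤ ‖w * (w - 4)‖) : Real.sqrt (a / 4) ≤ ‖ζ⁻¹ - ζ‖ := by
  have e : w * (w - 4) = (ζ⁻¹ - ζ) ^ 2 := by
    rw [hw]
    field_simp
    ring
  rw [e, norm_pow] at h
  exact Real.sqrt_le_left (norm_nonneg _) |>.2 h

theorem CircleSymbol.norm_resCoeff_le_of_far (hp : CircleSymbol a B S b p) (ha : 0 < a)
    {w : ℂ} (h0 : w.im ≠ 0) (hw : a / 4 ≤ ‖w * (w - 4)‖) (n : ℤ) :
    ‖resCoeff p n w‖ ≤ (Real.sqrt (a / 4))⁻¹ * S := by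
  obtain ⟨ζ, z0, z1, hz, -⟩ := exists_decaying_root h0
  have hr : 0 < Real.sqrt (a / 4) := Real.sqrt_pos.2 (by positivity)
  have hD := root_norm_ge z0 hz hw
  have hs := hasSum_resCoeff p n z0 z1 hz (norm_pos_iff.1 (hr.trans_le hD))
  rw [← hs.tsum_eq]
  refine (tsum_of_norm_bounded (hp.summable_b.hasSum.mul_left (Real.sqrt (a / 4))⁻¹)
    fun l => ?_).trans ?_
  · rw [norm_mul, norm_mul, norm_pow, norm_inv]
    have h1 : ‖ζ‖ ^ (-l - n).natAbs ≤ 1 := pow_le_one₀ (norm_nonneg _) z1.le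
    have h2 : ‖ζ⁻¹ - ζ‖⁻¹ ≤ (Real.sqrt (a / 4))⁻¹ := inv_anti₀ hr hD
    calc _ ≤ 1 * (Real.sqrt (a / 4))⁻¹ * b l := by
          gcongr
          exact hp.coeff_le l
      _ = _ := by rw [one_mul]
  · exact mul_le_mul_of_nonneg_left hp.tsum_b_le (inv_nonneg.2 hr.le)

/-- The Green coefficient at -l - n varies at rate O(1 + |l + n|), which is at most (1 + |n|)(1 +
|l|). The factor 1 + |l| is absorbed by the weighted summability of the coefficients of p. -/
theorem CircleSymbol.norm_resCoeff_sub_le_of_far (hp : CircleSymbol a B S b p) (ha : 0 < a)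
    {w w' : ℂ} (him : 0 < w.im * w'.im) (hw : a / 4 ≤ ‖w * (w - 4)‖)
    (hw' : a / 4 ≤ ‖w' * (w' - 4)‖) (n : ℤ) :
    ‖resCoeff p n w - resCoeff p n w'‖ ≤
      (5 / Real.sqrt (a / 4) ^ 2 + 8 / Real.sqrt (a / 4) ^ 3) * S * ((1 + |(n : ℝ)|) *
        ‖w - w'‖) := by
  have h0 : w.im ≠ 0 := (mul_ne_zero_iff.1 him.ne').1
  have h0' : w'.im ≠ 0 := (mul_ne_zero_iff.1 him.ne').2
  obtain ⟨ζ, z0, z1, hz, zi⟩ := exists_decaying_root h0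
  obtain ⟨ζ', z0', z1', hz', zi'⟩ := exists_decaying_root h0'
  set r := Real.sqrt (a / 4) with hrdef
  have hr : 0 < r := Real.sqrt_pos.2 (by positivity)
  have hD := root_norm_ge z0 hz hw
  have hD' := root_norm_ge z0' hz' hw'
  -- Each root lies in the same half-plane as its spectral parameter, so the two roots share a
  -- half-plane.
  have hzz : 0 < ζ.im * ζ'.im := by
    have h1 : 0 < (w.im * w'.im) * (ζ.im * ζ'.im) := by
      have := mul_pos zi zi'
      nlinarith
    exact pos_of_mul_pos_right h1 him.le
  have hs := (hasSum_resCoeff p n z0 z1 hz (norm_pos_iff.1 (hr.trans_le hD))).sub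
    (hasSum_resCoeff p n z0' z1' hz' (norm_pos_iff.1 (hr.trans_le hD')))
  rw [← hs.tsum_eq]
  refine (tsum_of_norm_bounded (hp.hasSum.mul_left
    ((5 / r ^ 2 + 8 / r ^ 3) * ((1 + |(n : ℝ)|) * ‖w - w'‖))) fun l => ?_).trans ?_
  · have h3 := norm_greenCoeff_sub_le z0 z0' z1 z1' hzz hr hD hD' (-l - n).natAbs
    rw [← hz, ← hz'] at h3
    have h4 : (1 + ((-l - n).natAbs : ℝ)) ≤ (1 + |(n : ℝ)|) * (1 + |(l : ℝ)|) := by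
      have h5 : ((-l - n).natAbs : ℝ) = |(-(l : ℝ) - n)| := by
        rw [Nat.cast_natAbs]
        push_cast
        rfl
      have h6 : |(-(l : ℝ) - n)| ≤ |(l : ℝ)| + |(n : ℝ)| := by
        have := abs_sub (-(l : ℝ)) n
        rwa [abs_neg] at this
      rw [h5]
      nlinarith [mul_nonneg (abs_nonneg (n : ℝ)) (abs_nonneg (l : ℝ))]
    rw [← sub_mul, norm_mul]
    calc _ ≤ ((5 / r ^ 2 + 8 / r ^ 3) * ((1 + |(n : ℝ)|) * (1 + |(l : ℝ)|)) * ‖w - w'‖) * b l := by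
          refine mul_le_mul (h3.trans ?_) (hp.coeff_le l) (norm_nonneg _) (by positivity)
          gcongr
      _ = _ := by ring
  · exact le_of_eq (by ring)

/-- Uniform bounds for the partial Fourier coefficients of `p / (κ - w)`. -/
theorem exists_bound_resCoeff (ha : 0 < a) (ha1 : a ≤ 1) (B S : ℝ) (hB : 0 ≤ B) (hS : 0 ≤ S) :
    ∃ C : ℝ, 0 ≤ C ∧ ∀ (b : ℤ → ℝ) (p : C(UnitAddCircle, ℂ)), CircleSymbol a B S b p →
      ∀ n : ℤ, (∀ w : ℂ, w.im ≠ 0 → ‖resCoeff p n w‖ ≤ C) ∧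
        ∀ w w' : ℂ, 0 < w.im * w'.im →
          ‖resCoeff p n w - resCoeff p n w'‖ ≤ C * ((1 + |(n : ℝ)|) * ‖w - w'‖) := by
  set C1 := B * (18 / a) + (Real.sqrt (a / 4))⁻¹ * S with hC1
  set C2 := B * (18 / a) ^ 2 with hC2
  set C3 := (5 / Real.sqrt (a / 4) ^ 2 + 8 / Real.sqrt (a / 4) ^ 3) * S with hC3
  have p1 : 0 ≤ C1 := by positivity
  have p2 : 0 ≤ C2 := by positivity
  have p3 : 0 ≤ C3 := by positivity
  have p4 : 0 ≤ 2 * C1 * (60 / a) := by positivity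
  refine ⟨C1 + C2 + C3 + 2 * C1 * (60 / a), by positivity, fun b p hp n => ?_⟩
  have bd : ∀ w : ℂ, w.im ≠ 0 → ‖resCoeff p n w‖ ≤ C1 := by
    intro w h0
    rcases le_total ‖w * (w - 4)‖ (a / 2) with hw | hw
    · refine (norm_integral_mul_fourier_le fun τ => hp.norm_mul_inv_le ha ha1 hw τ).trans ?_
      rw [hC1]
      exact le_add_of_nonneg_right (by positivity)
    · refine (hp.norm_resCoeff_le_of_far ha h0 (by linarith) n).trans ?_
      rw [hC1]
      exact le_add_of_nonneg_left (by positivity)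
  -- If one point is within the a/4 zone and the other outside the a/2 zone, they are far apart: w(w
  -- - 4) changes by at least a/4, at rate at most 14 + 1/60 over distances below 1/60.
  have mixed : ∀ w w' : ℂ, ‖w * (w - 4)‖ ≤ a / 4 → a / 2 ≤ ‖w' * (w' - 4)‖ →
      a / 60 ≤ ‖w - w'‖ := by
    intro w w' h h'
    by_contra! hlt
    have h5 : ‖w‖ ≤ 5 := norm_le_five (by linarith)
    have e : w' * (w' - 4) - w * (w - 4) = (w - w') * ((4 - 2 * w) + (w - w')) := by ring
    have h6 := norm_sub_norm_le (w' * (w' - 4)) (w * (w - 4))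
    rw [e, norm_mul (w - w')] at h6
    have h7 : ‖(4 - 2 * w) + (w - w')‖ ≤ 4 + 2 * 5 + 1 / 60 := by
      refine (norm_add_le _ _).trans ?_
      have h8 := norm_sub_le (4 : ℂ) (2 * w)
      rw [norm_mul, Complex.norm_ofNat, Complex.norm_ofNat] at h8
      linarith
    nlinarith [norm_nonneg (w - w')]
  refine ⟨fun w h0 => (bd w h0).trans (by linarith), fun w w' him => ?_⟩
  have h0 : w.im ≠ 0 := (mul_ne_zero_iff.1 him.ne').1
  have h0' : w'.im ≠ 0 := (mul_ne_zero_iff.1 him.ne').2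
  set δ := (1 + |(n : ℝ)|) * ‖w - w'‖ with hδ
  have hδ1 : ‖w - w'‖ ≤ δ :=
    le_mul_of_one_le_left (norm_nonneg _) (le_add_of_nonneg_right (abs_nonneg _))
  have hδ0 : 0 ≤ δ := (norm_nonneg _).trans hδ1
  have far : a / 60 ≤ ‖w - w'‖ → ‖resCoeff p n w - resCoeff p n w'‖ ≤
      (C1 + C2 + C3 + 2 * C1 * (60 / a)) * δ := by
    intro h
    calc _ ≤ C1 + C1 := (norm_sub_le _ _).trans (add_le_add (bd w h0) (bd w' h0'))
      _ = 2 * C1 * (60 / a) * (a / 60) := by field_simp; ring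
      _ ≤ 2 * C1 * (60 / a) * δ := by gcongr; exact h.trans hδ1
      _ ≤ _ := by gcongr; linarith
  -- The near zone (up to a/2) and the far zone (from a/4) overlap. Two points either lie in a
  -- common zone or are separated by a/60, in which case the uniform bound already gives a Lipschitz
  -- bound.
  rcases le_total ‖w * (w - 4)‖ (a / 4) with hw | hw <;>
    rcases le_total ‖w' * (w' - 4)‖ (a / 4) with hw' | hw'
  · calc _ ≤ C2 * ‖w - w'‖ :=
          hp.norm_resCoeff_sub_le_of_near ha ha1 h0 h0' (by linarith) (by linarith) n
      _ ≤ C2 * δ := by gcongr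
      _ ≤ _ := by gcongr; linarith
  · rcases le_total ‖w' * (w' - 4)‖ (a / 2) with h | h
    · calc _ ≤ C2 * ‖w - w'‖ :=
            hp.norm_resCoeff_sub_le_of_near ha ha1 h0 h0' (by linarith) h n
        _ ≤ C2 * δ := by gcongr
        _ ≤ _ := by gcongr; linarith
    · exact far (mixed w w' hw h)
  · rcases le_total ‖w * (w - 4)‖ (a / 2) with h | h
    · calc _ ≤ C2 * ‖w - w'‖ :=
            hp.norm_resCoeff_sub_le_of_near ha ha1 h0 h0' h (by linarith) n
        _ ≤ C2 * δ := by gcongr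
        _ ≤ _ := by gcongr; linarith
    · exact far (by rw [norm_sub_rev]; exact mixed w' w hw' h)
  · exact (hp.norm_resCoeff_sub_le_of_far ha him hw hw' n).trans
      (mul_le_mul_of_nonneg_right (by linarith) hδ0)

end Bounds

end DiscreteSchrodinger

end

noncomputable section

namespace DiscreteSchrodinger

/-! ### Decay of partial Fourier coefficients of smooth functions on the torus -/

section Decay

variable {d : ℕ}

theorem torusProj_add (ξ η : EuclideanSpace ℝ (Fin d)) :
    torusProj (ξ + η) = torusProj ξ + torusProj η := by
  ext j
  rfl

theorem torusProj_surjective (θ : UnitAddTorus (Fin d)) :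
    ∃ ξ : EuclideanSpace ℝ (Fin d), torusProj ξ = θ := by
  choose f hf using fun j => QuotientAddGroup.mk_surjective (θ j)
  exact ⟨WithLp.toLp 2 f, funext hf⟩

theorem continuous_torusProj : Continuous (torusProj (d := d)) :=
  continuous_pi fun j => (AddCircle.continuous_mk' 1).comp (EuclideanSpace.proj j).continuous

/-- Periodicity with respect to `ℤ^d`. -/
def LatticePeriodic (F : EuclideanSpace ℝ (Fin d) → ℝ) : Prop :=
  ∀ ξ η, torusProj ξ = torusProj η → F ξ = F η

theorem LatticePeriodic.bounded {F : EuclideanSpace ℝ (Fin d) → ℝ} (hF : LatticePeriodic F)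
    (hc : Continuous F) : ∃ M, ∀ ξ, ‖F ξ‖ ≤ M := by
  have hK : IsCompact (WithLp.toLp 2 '' Set.univ.pi fun _ : Fin d => Set.Icc (0 : ℝ) 1) :=
    (isCompact_univ_pi fun _ => isCompact_Icc).image (PiLp.continuous_toLp 2 fun _ : Fin d => ℝ)
  obtain ⟨M, hM⟩ := hK.exists_bound_of_continuousOn hc.continuousOn
  refine ⟨M, fun ξ => ?_⟩
  rw [hF ξ (WithLp.toLp 2 fun j => Int.fract (ξ j))]
  · refine hM _ ⟨_, fun j _ => ⟨Int.fract_nonneg _, (Int.fract_lt_one _).le⟩, rfl⟩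
  · funext j
    refine (QuotientAddGroup.eq_iff_sub_mem).2 ?_
    exact AddSubgroup.mem_zmultiples_iff.2 ⟨⌊ξ j⌋, by
      rw [zsmul_one]; exact (Int.self_sub_fract _).symm⟩

/-- The partial derivative in the direction `e_j`. -/
def partialD (j : Fin d) (F : EuclideanSpace ℝ (Fin d) → ℝ) (ξ : EuclideanSpace ℝ (Fin d)) : ℝ :=
  fderiv ℝ F ξ (EuclideanSpace.single j 1)

theorem contDiff_partialD {F : EuclideanSpace ℝ (Fin d) → ℝ} (hF : ContDiff ℝ ∞ F) (j : Fin d) :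
    ContDiff ℝ ∞ (partialD j F) :=
  (hF.fderiv_right (m := ∞) (by simp)).clm_apply contDiff_const

theorem LatticePeriodic.partialD {F : EuclideanSpace ℝ (Fin d) → ℝ} (hF : LatticePeriodic F)
    (j : Fin d) : LatticePeriodic (partialD j F) := by
  intro ξ η h
  have h1 : F = fun x => F (x + (η - ξ)) := by
    funext x
    refine hF _ _ ?_
    rw [torusProj_add]
    have h2 : torusProj η = torusProj ξ + torusProj (η - ξ) := by
      rw [← torusProj_add, add_sub_cancel]
    rw [← h, left_eq_add] at h2
    rw [h2, add_zero]
  rw [DiscreteSchrodinger.partialD, DiscreteSchrodinger.partialD, h1, fderiv_comp_add_right,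
    add_sub_cancel, ← h1]

theorem hasDerivAt_line {F : EuclideanSpace ℝ (Fin d) → ℝ} (hF : ContDiff ℝ ∞ F) (j : Fin d)
    (ξ : EuclideanSpace ℝ (Fin d)) (t : ℝ) :
    HasDerivAt (fun t : ℝ => ((F (ξ + t • EuclideanSpace.single j 1) : ℝ) : ℂ))
      (partialD j F (ξ + t • EuclideanSpace.single j 1) : ℂ) t := by
  refine HasDerivAt.ofReal_comp ?_
  have h1 : HasDerivAt (fun t : ℝ => ξ + t • EuclideanSpace.single j (1 : ℝ))
      (EuclideanSpace.single j 1) t := by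
    simpa using ((hasDerivAt_id t).smul_const (EuclideanSpace.single j (1 : ℝ))).const_add ξ
  exact ((hF.differentiable (by simp)) _).hasFDerivAt.comp_hasDerivAt t h1

/-- One integration by parts; the boundary term vanishes by periodicity and the gain of 2π is
discarded. -/
theorem norm_fourierCoeffOn_le {f f' : ℝ → ℂ} (hf : ∀ x, HasDerivAt f (f' x) x)
    (hc : Continuous f') (h01 : f 0 = f 1) {l : ℤ} (hl : l ≠ 0) :
    ‖fourierCoeffOn zero_lt_one f l‖ * |(l : ℝ)| ≤ ‖fourierCoeffOn zero_lt_one f' l‖ := by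
  rw [fourierCoeffOn_of_hasDerivAt zero_lt_one hl (fun x _ => hf x) (hc.intervalIntegrable _ _),
    h01, sub_self, mul_zero, zero_sub, norm_mul, norm_neg]
  have hl' : 0 < |(l : ℝ)| := abs_pos.2 (Int.cast_ne_zero.2 hl)
  have h1 : ‖(1 / (-2 * Real.pi * Complex.I * l) : ℂ)‖ ≤ |(l : ℝ)|⁻¹ := by
    rw [norm_div, norm_one, one_div]
    refine inv_anti₀ hl' ?_
    rw [norm_mul, norm_mul, norm_mul, Complex.norm_I, norm_neg, Complex.norm_ofNat,
      Complex.norm_real, Complex.norm_intCast, Real.norm_eq_abs, abs_of_pos Real.pi_pos]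
    have := Real.pi_gt_three
    nlinarith
  have h2 : ‖((1 : ℝ) - (0 : ℝ) : ℂ) * fourierCoeffOn zero_lt_one f' l‖ =
      ‖fourierCoeffOn zero_lt_one f' l‖ := by simp
  rw [h2, mul_right_comm]
  calc _ ≤ |(l : ℝ)|⁻¹ * |(l : ℝ)| * ‖fourierCoeffOn zero_lt_one f' l‖ := by gcongr
    _ = _ := by rw [inv_mul_cancel₀ hl'.ne', one_mul]

theorem norm_fourierCoeffOn_le_of_bound {f : ℝ → ℂ} {M : ℝ} (h : ∀ x, ‖f x‖ ≤ M) (l : ℤ) :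
    ‖fourierCoeffOn zero_lt_one f l‖ ≤ M := by
  rw [fourierCoeffOn_eq_integral]
  have h1 : ∀ x ∈ Set.uIoc (0 : ℝ) 1, ‖(fourier (-l) (x : AddCircle (1 - 0 : ℝ)) : ℂ) • f x‖ ≤ M :=
    fun x _ => by
      rw [norm_smul, fourier_apply, Circle.norm_coe, one_mul]
      exact h x
  have h2 := intervalIntegral.norm_integral_le_of_norm_le_const h1
  simpa using h2

/-- The restriction of a continuous function on the torus to a line in direction `j`. -/
def lineRestrict (j : Fin d) (G : C(UnitAddTorus (Fin d), ℂ)) (θ : UnitAddTorus (Fin d)) :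
    C(UnitAddCircle, ℂ) :=
  ⟨fun τ => G (Function.update θ j τ), G.continuous.comp (continuous_const.update j continuous_id)⟩

theorem fourierCoeff_eq_fourierCoeffOn (p : UnitAddCircle → ℂ) (l : ℤ) :
    fourierCoeff p l = fourierCoeffOn zero_lt_one (fun t : ℝ => p (t : UnitAddCircle)) l := by
  rw [fourierCoeff_eq_intervalIntegral p l 0, fourierCoeffOn_eq_integral]
  simp

/-- Three integrations by parts along the line, uniformly in θ because periodic continuous
derivatives are bounded. The cube leaves a summable (1 + |l|)⁻² after the weight 1 + |l| required by
`CircleSymbol`. -/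
theorem exists_fourierCoeff_lineRestrict_le {g : UnitAddTorus (Fin d) → ℝ} (hg : TorusSmooth g)
    (j : Fin d) : ∃ B : ℝ, 0 ≤ B ∧ ∀ θ, (∀ τ, ‖lineRestrict j hg.toC θ τ‖ ≤ B) ∧
      ∀ l : ℤ, ‖fourierCoeff (lineRestrict j hg.toC θ) l‖ ≤ B / (1 + |(l : ℝ)|) ^ 3 := by
  let F : ℕ → EuclideanSpace ℝ (Fin d) → ℝ := fun k => (partialD j)^[k] fun ξ => g (torusProj ξ)
  have hFs : ∀ k, F (k + 1) = partialD j (F k) := fun k => Function.iterate_succ_apply' _ _ _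
  have hF : ∀ k, ContDiff ℝ ∞ (F k) ∧ LatticePeriodic (F k) := by
    intro k
    induction k with
    | zero => exact ⟨hg, fun ξ η h => congrArg g h⟩
    | succ k ih =>
      rw [hFs]
      exact ⟨contDiff_partialD ih.1 j, ih.2.partialD j⟩
  obtain ⟨M0, hM0⟩ := (hF 0).2.bounded (hF 0).1.continuous
  obtain ⟨M3, hM3⟩ := (hF 3).2.bounded (hF 3).1.continuous
  have p0 : 0 ≤ M0 := (norm_nonneg _).trans (hM0 0)
  have p3 : 0 ≤ M3 := (norm_nonneg _).trans (hM3 0)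
  -- `M0` covers the sup norm and the mode l = 0; the 8 comes from (1 + |l|)³ ≤ (2|l|)³ for l ≠ 0.
  refine ⟨M0 + 8 * M3, by positivity, fun θ => ?_⟩
  obtain ⟨ξ', hξ'⟩ := torusProj_surjective θ
  set ξ : EuclideanSpace ℝ (Fin d) := WithLp.toLp 2 (Function.update ξ' j 0) with hξ
  let f : ℕ → ℝ → ℂ := fun k t => ((F k (ξ + t • EuclideanSpace.single j 1) : ℝ) : ℂ)
  have hproj : ∀ t : ℝ, torusProj (ξ + t • EuclideanSpace.single j 1) =
      Function.update θ j (t : UnitAddCircle) := by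
    intro t
    funext i
    rw [torusProj]
    by_cases hi : i = j
    · subst hi
      simp [hξ]
    · simp [hξ, hi, ← hξ', torusProj]
  have hline : ∀ t : ℝ, lineRestrict j hg.toC θ (t : UnitAddCircle) = f 0 t := by
    intro t
    change ((g (Function.update θ j (t : UnitAddCircle)) : ℝ) : ℂ) = (g (torusProj _) : ℂ)
    rw [hproj]
  have hder : ∀ k t, HasDerivAt (f k) (f (k + 1) t) t := by
    intro k t
    simp only [f, hFs]
    exact hasDerivAt_line (hF k).1 j ξ t
  have hper : ∀ k, f k 0 = f k 1 := by
    intro k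
    simp only [f]
    congr 1
    refine (hF k).2 _ _ ?_
    rw [hproj, hproj]
    congr 1
    exact (AddCircle.coe_period 1).symm
  have hcont : ∀ k, Continuous (f k) := fun k =>
    continuous_iff_continuousAt.2 fun t => (hder k t).continuousAt
  have hb0 : ∀ t, ‖f 0 t‖ ≤ M0 := fun t => by
    rw [Complex.norm_real]; exact hM0 _
  have hb3 : ∀ t, ‖f 3 t‖ ≤ M3 := fun t => by
    rw [Complex.norm_real]; exact hM3 _
  refine ⟨fun τ => ?_, fun l => ?_⟩
  · induction τ using QuotientAddGroup.induction_on with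
    | H t =>
      refine le_trans (le_of_eq (congrArg norm (hline t))) ((hb0 t).trans ?_)
      linarith
  · rw [fourierCoeff_eq_fourierCoeffOn, funext hline]
    have c0 := norm_fourierCoeffOn_le_of_bound hb0 l
    have c3 := norm_fourierCoeffOn_le_of_bound hb3 l
    rw [le_div_iff₀ (by positivity)]
    by_cases hl : l = 0
    · subst hl
      simp only [Int.cast_zero, abs_zero, add_zero, one_pow, mul_one]
      linarith
    · have s0 := norm_fourierCoeffOn_le (hder 0) (hcont 1) (hper 0) hl
      have s1 := norm_fourierCoeffOn_le (hder 1) (hcont 2) (hper 1) hl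
      have s2 := norm_fourierCoeffOn_le (hder 2) (hcont 3) (hper 2) hl
      have hl1 : 1 ≤ |(l : ℝ)| := by exact_mod_cast Int.one_le_abs hl
      set A := |(l : ℝ)| with hA
      calc ‖fourierCoeffOn zero_lt_one (f 0) l‖ * (1 + A) ^ 3
          ≤ ‖fourierCoeffOn zero_lt_one (f 0) l‖ * (2 * A) ^ 3 := by gcongr; linarith
        _ = 8 * (‖fourierCoeffOn zero_lt_one (f 0) l‖ * A * A * A) := by ring
        _ ≤ 8 * (‖fourierCoeffOn zero_lt_one (f 1) l‖ * A * A) := by gcongr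
        _ ≤ 8 * (‖fourierCoeffOn zero_lt_one (f 2) l‖ * A) := by gcongr
        _ ≤ 8 * ‖fourierCoeffOn zero_lt_one (f 3) l‖ := by gcongr
        _ ≤ M0 + 8 * M3 := by linarith

theorem summable_decay : Summable fun l : ℤ => (1 + |(l : ℝ)|) * (1 / (1 + |(l : ℝ)|) ^ 3) := by
  have h : Summable fun n : ℕ => 1 / ((n : ℝ) + 1) ^ 2 := by
    have := (summable_nat_add_iff 1).2 (Real.summable_one_div_nat_pow.2 one_lt_two)
    simpa using this
  have h2 : Summable fun n : ℕ => (1 + |(n : ℝ)|) * (1 / (1 + |(n : ℝ)|) ^ 3) := by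
    refine h.congr fun n => ?_
    rw [abs_of_nonneg (Nat.cast_nonneg n)]
    have : (0 : ℝ) ≤ n := Nat.cast_nonneg n
    field_simp
    ring
  refine Summable.of_nat_of_neg ?_ ?_
  · simpa only [Int.cast_natCast] using h2
  · simpa only [Int.cast_neg, Int.cast_natCast, abs_neg] using h2

/-! ### The partial symbols of a cut-off resolvent -/

theorem torusH0_update (j : Fin d) (θ : UnitAddTorus (Fin d)) (τ : UnitAddCircle) :
    torusH0 d (Function.update θ j τ) = kap τ + ∑ i ∈ Finset.univ.erase j, kap (θ i) := by
  rw [torusH0, ← Finset.add_sum_erase _ _ (Finset.mem_univ j), Function.update_self]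
  congr 1
  refine Finset.sum_congr rfl fun i hi => ?_
  rw [Function.update_of_ne (Finset.ne_of_mem_erase hi)]

/-- The symbol of H₀ splits as κ(τ) plus a real number depending on the other variables, so the
latter only shifts z. Recentring the integral at θ_j produces the unimodular prefactor. -/
theorem partialSymbol_mul_symbolRes (j : Fin d) (n : ℤ) (G : C(UnitAddTorus (Fin d), ℂ)) {z : ℂ}
    (hz : z.im ≠ 0) (θ : UnitAddTorus (Fin d)) :
    partialSymbol j n (G * symbolRes d z hz) θ = fourier n (-θ j) *
      resCoeff (lineRestrict j G θ) n
        (z - ((∑ i ∈ Finset.univ.erase j, kap (θ i) : ℝ) : ℂ)) := by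
  rw [partialSymbol_apply, resCoeff, ← integral_const_mul]
  rw [← integral_sub_right_eq_self _ (θ j)]
  refine integral_congr_ae (.of_forall fun τ => ?_)
  have h1 : θ + Pi.single j (τ - θ j) = Function.update θ j τ := by
    funext i
    by_cases hi : i = j
    · subst hi; simp
    · simp [hi]
  have h2 : (fourier n (τ - θ j) : ℂ) = fourier n (-θ j) * fourier n τ := by
    simp [fourier_apply, sub_eq_add_neg, smul_add, AddCircle.toCircle_add, mul_comm]
  simp only [h1, h2]
  have h3 : (G * symbolRes d z hz) (Function.update θ j τ) = lineRestrict j G θ τ *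
      ((kap τ : ℂ) - (z - ((∑ i ∈ Finset.univ.erase j, kap (θ i) : ℝ) : ℂ)))⁻¹ := by
    change G (Function.update θ j τ) * ((torusH0 d (Function.update θ j τ) : ℂ) - z)⁻¹ =
      G (Function.update θ j τ) * _
    rw [torusH0_update, Complex.ofReal_add, sub_sub_eq_add_sub]
  rw [h3]
  ring

/-- The circle estimates depend on the restricted symbol only through constants uniform in θ. The
spectral shift is real, so it alters neither imaginary parts nor the difference z - z'. -/
theorem exists_bound_partialSymbol {g : UnitAddTorus (Fin d) → ℝ} (hg : TorusSmooth g) (j : Fin d)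
    {a : ℝ} (ha : 0 < a) (ha1 : a ≤ 1)
    (hsupp : ∀ θ, g θ ≠ 0 → a < kap (θ j) * (4 - kap (θ j))) :
    ∃ C : ℝ, 0 ≤ C ∧ ∀ (n : ℤ) (θ : UnitAddTorus (Fin d)),
      (∀ (z : ℂ) (hz : z.im ≠ 0), ‖partialSymbol j n (hg.toC * symbolRes d z hz) θ‖ ≤ C) ∧
      ∀ (z z' : ℂ) (hz : z.im ≠ 0) (hz' : z'.im ≠ 0), 0 < z.im * z'.im →
        ‖partialSymbol j n (hg.toC * symbolRes d z hz) θ -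
          partialSymbol j n (hg.toC * symbolRes d z' hz') θ‖ ≤
            C * ((1 + |(n : ℝ)|) * ‖z - z'‖) := by
  obtain ⟨B, hB, hdec⟩ := exists_fourierCoeff_lineRestrict_le hg j
  have hsum : HasSum (fun l : ℤ => (1 + |(l : ℝ)|) * (B / (1 + |(l : ℝ)|) ^ 3))
      (B * ∑' l : ℤ, (1 + |(l : ℝ)|) * (1 / (1 + |(l : ℝ)|) ^ 3)) := by
    convert! summable_decay.hasSum.mul_left B using 1
    funext l
    ring
  have hS : 0 ≤ B * ∑' l : ℤ, (1 + |(l : ℝ)|) * (1 / (1 + |(l : ℝ)|) ^ 3) :=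
    mul_nonneg hB (tsum_nonneg fun l => by positivity)
  obtain ⟨C, hC, hbd⟩ := exists_bound_resCoeff ha ha1 B _ hB hS
  refine ⟨C, hC, fun n θ => ?_⟩
  have hp : CircleSymbol a B
      (B * ∑' l : ℤ, (1 + |(l : ℝ)|) * (1 / (1 + |(l : ℝ)|) ^ 3))
      (fun l => B / (1 + |(l : ℝ)|) ^ 3) (lineRestrict j hg.toC θ) := by
    refine ⟨(hdec θ).1, fun τ hτ => ?_, (hdec θ).2, hsum⟩
    have := hsupp (Function.update θ j τ) fun h => hτ (by
      change ((g (Function.update θ j τ) : ℝ) : ℂ) = 0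
      rw [h, Complex.ofReal_zero])
    rwa [Function.update_self] at this
  obtain ⟨h1, h2⟩ := hbd _ _ hp n
  refine ⟨fun z hz => ?_, fun z z' hz hz' him => ?_⟩
  · rw [partialSymbol_mul_symbolRes, norm_mul, norm_fourier_apply, one_mul]
    exact h1 _ (by simpa using hz)
  · rw [partialSymbol_mul_symbolRes, partialSymbol_mul_symbolRes, ← mul_sub, norm_mul,
      norm_fourier_apply, one_mul]
    have h3 := h2 (z - ((∑ i ∈ Finset.univ.erase j, kap (θ i) : ℝ) : ℂ))
      (z' - ((∑ i ∈ Finset.univ.erase j, kap (θ i) : ℝ) : ℂ)) (by simpa using him)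
    rwa [sub_sub_sub_cancel_right] at h3

end Decay

end DiscreteSchrodinger

end

noncomputable section

namespace DiscreteSchrodinger

/-! ### Localization to regions where one partial derivative of `h₀` does not vanish -/

section Localization

variable {d : ℕ}

theorem gradient_h0_eq_zero {ξ : EuclideanSpace ℝ (Fin d)}
    (h : ∀ j, Real.sin (Real.pi * ξ j) * Real.cos (Real.pi * ξ j) = 0) : ∇ (h0 d) ξ = 0 := by
  have h1 : ∀ j : Fin d, HasFDerivAt
      (fun ξ : EuclideanSpace ℝ (Fin d) => Real.sin (Real.pi * ξ j) ^ 2)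
      (0 : EuclideanSpace ℝ (Fin d) →L[ℝ] ℝ) ξ := by
    intro j
    have h2 : HasDerivAt (fun t : ℝ => Real.sin (Real.pi * t) ^ 2) 0 (ξ j) := by
      have h3 := (((hasDerivAt_id (ξ j)).const_mul Real.pi).sin).pow 2
      convert! h3 using 1
      have := h j
      simp only [id, Nat.cast_ofNat]
      linear_combination (-2 * Real.pi) * this
    have h3 : HasFDerivAt (fun ξ : EuclideanSpace ℝ (Fin d) => ξ j)
        (EuclideanSpace.proj j : EuclideanSpace ℝ (Fin d) →L[ℝ] ℝ) ξ :=
      (EuclideanSpace.proj j : EuclideanSpace ℝ (Fin d) →L[ℝ] ℝ).hasFDerivAt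
    have h4 := HasDerivAt.comp_hasFDerivAt (f := fun ξ : EuclideanSpace ℝ (Fin d) => ξ j) ξ h2 h3
    rw [zero_smul] at h4
    exact h4
  have h5 : HasFDerivAt (h0 d) (0 : EuclideanSpace ℝ (Fin d) →L[ℝ] ℝ) ξ := by
    have h6 := (HasFDerivAt.fun_sum (u := Finset.univ) fun j _ => h1 j).const_mul 4
    rw [Finset.sum_const_zero, smul_zero] at h6
    exact h6
  rw [h5.hasGradientAt.gradient, map_zero]

/-- The function `κ (4 - κ)`, which vanishes exactly at the critical points of `κ`. -/
def critFun (τ : UnitAddCircle) : ℝ := kap τ * (4 - kap τ)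

theorem continuous_critFun : Continuous critFun :=
  continuous_kap.mul (continuous_const.sub continuous_kap)

theorem critFun_nonneg (τ : UnitAddCircle) : 0 ≤ critFun τ :=
  mul_nonneg (kap_mem τ).1 (sub_nonneg.2 (kap_mem τ).2)

theorem critFun_coe (t : ℝ) :
    critFun (t : UnitAddCircle) = (4 * (Real.sin (Real.pi * t) * Real.cos (Real.pi * t))) ^ 2 := by
  have h : Real.cos (2 * Real.pi * t) = 2 * Real.cos (Real.pi * t) ^ 2 - 1 := by
    rw [← Real.cos_two_mul]; ring_nf
  have h2 := Real.sin_sq_add_cos_sq (Real.pi * t)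
  rw [critFun, kap_coe, h]
  linear_combination (-16 * Real.cos (Real.pi * t) ^ 2) * h2

theorem exists_critFun_pos {θ : UnitAddTorus (Fin d)} (hθ : θ ∈ regularSet d) :
    0 < ∑ j, critFun (θ j) := by
  obtain ⟨ξ, rfl⟩ := torusProj_surjective θ
  refine lt_of_le_of_ne (Finset.sum_nonneg fun j _ => critFun_nonneg _) fun h => ?_
  refine hθ ξ rfl (gradient_h0_eq_zero fun j => ?_)
  have h1 := (Finset.sum_eq_zero_iff_of_nonneg fun j _ => critFun_nonneg _).1 h.symm j
    (Finset.mem_univ j)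
  rw [torusProj, critFun_coe, sq_eq_zero_iff] at h1
  simpa using h1

/-- A partition subordinate to the regions where a single κ(4 - κ) exceeds a: χ² is split in
proportion to smooth functions ρ(θ_j) that are positive exactly there. Compactness of the support of
χ supplies one a for all points. -/
theorem exists_localization {χ : UnitAddTorus (Fin d) → ℝ} (hχ : TorusSmooth χ)
    (hsupp : tsupport χ ⊆ regularSet d) :
    ∃ a : ℝ, 0 < a ∧ a ≤ 1 ∧ ∃ g : Fin d → UnitAddTorus (Fin d) → ℝ, (∀ j, TorusSmooth (g j)) ∧
      (∀ j θ, g j θ ≠ 0 → a < critFun (θ j)) ∧ ∀ θ, χ θ ^ 2 = ∑ j, g j θ := by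
  have hcont : Continuous fun θ : UnitAddTorus (Fin d) => ∑ j, critFun (θ j) :=
    continuous_finsetSum _ fun j _ => continuous_critFun.comp (continuous_apply j)
  obtain ⟨a', ha', hmin⟩ := (isClosed_tsupport χ).isCompact.exists_forall_le' hcont.continuousOn
    fun θ hθ => exists_critFun_pos (hsupp hθ)
  -- This makes d·a < a'. The d values of `critFun` sum to at least a' on the support, so they
  -- cannot all be ≤ a.
  set a := min 1 (a' / (2 * (d + 1))) with ha
  have ha0 : 0 < a := lt_min one_pos (by positivity)
  let ρ : UnitAddCircle → ℝ := fun τ => expNegInvGlue (critFun τ - a)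
  have hρ0 : ∀ τ, 0 ≤ ρ τ := fun τ => expNegInvGlue.nonneg _
  have hden : ∀ θ ∈ tsupport χ, ∑ i, ρ (θ i) ≠ 0 := by
    intro θ hθ h
    have h1 := (Finset.sum_eq_zero_iff_of_nonneg fun j _ => hρ0 (θ j)).1 h
    have h2 : ∑ j, critFun (θ j) ≤ ∑ _j : Fin d, a := by
      refine Finset.sum_le_sum fun j hj => ?_
      by_contra! hlt
      exact (expNegInvGlue.pos_of_pos (sub_pos.2 hlt)).ne' (h1 j hj)
    rw [Finset.sum_const, Finset.card_univ, Fintype.card_fin, nsmul_eq_mul] at h2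
    have h3 := (hmin θ hθ).trans h2
    have h4 : a ≤ a' / (2 * (d + 1)) := min_le_right _ _
    rw [le_div_iff₀ (by positivity)] at h4
    have h5 : (0 : ℝ) ≤ d := Nat.cast_nonneg d
    nlinarith
  refine ⟨a, ha0, min_le_left _ _, fun j θ => χ θ ^ 2 * ρ (θ j) / ∑ i, ρ (θ i), ?_, ?_, ?_⟩
  · intro j
    have hρs : ∀ i : Fin d, ContDiff ℝ ∞ fun ξ : EuclideanSpace ℝ (Fin d) => ρ (torusProj ξ i) := by
      intro i
      have h1 : (fun ξ : EuclideanSpace ℝ (Fin d) => ρ (torusProj ξ i)) = fun ξ =>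
          expNegInvGlue ((4 * (Real.sin (Real.pi * ξ i) * Real.cos (Real.pi * ξ i))) ^ 2 - a) := by
        funext ξ
        simp only [ρ]
        rw [torusProj, critFun_coe]
      rw [h1]
      have h2 : ContDiff ℝ ∞ expNegInvGlue := expNegInvGlue.contDiff
      refine h2.comp ?_
      have h3 : ContDiff ℝ ∞ fun ξ : EuclideanSpace ℝ (Fin d) => ξ i :=
        (EuclideanSpace.proj i : EuclideanSpace ℝ (Fin d) →L[ℝ] ℝ).contDiff
      fun_prop
    rw [TorusSmooth, contDiff_iff_contDiffAt]
    intro ξ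
    -- The denominator may vanish off the support of χ, but there the quotient is locally zero.
    by_cases hξ : torusProj ξ ∈ tsupport χ
    · refine ContDiffAt.div ?_ ?_ (hden _ hξ)
      · exact ((ContDiff.pow hχ 2).mul (hρs j)).contDiffAt
      · exact (ContDiff.sum fun i _ => hρs i).contDiffAt
    · have h1 : (fun ξ => χ (torusProj ξ) ^ 2 * ρ (torusProj ξ j) / ∑ i, ρ (torusProj ξ i)) =ᶠ[nhds ξ]
          fun _ => 0 := by
        have h2 := continuous_torusProj.continuousAt.eventually
          ((isClosed_tsupport χ).isOpen_compl.mem_nhds hξ)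
        filter_upwards [h2] with η hη
        rw [image_eq_zero_of_notMem_tsupport hη]
        simp
      exact contDiffAt_const.congr_of_eventuallyEq h1
  · intro j θ h
    by_contra! hle
    refine h ?_
    have : ρ (θ j) = 0 := expNegInvGlue.zero_of_nonpos (sub_nonpos.2 hle)
    simp only [this, mul_zero, zero_div]
  · intro θ
    rw [← Finset.sum_div, ← Finset.mul_sum]
    by_cases hθ : θ ∈ tsupport χ
    · rw [mul_div_cancel_right₀ _ (hden θ hθ)]
    · rw [image_eq_zero_of_notMem_tsupport hθ]
      simp

end Localization

/-! ### Weights -/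

/-- The weight `⟨t⟩^{-s}` on the real line. -/
def japW (s t : ℝ) : ℝ := Real.sqrt (1 + t ^ 2) ^ (-s)

theorem one_le_sqrt_one_add_sq (t : ℝ) : 1 ≤ Real.sqrt (1 + t ^ 2) :=
  Real.one_le_sqrt.2 (le_add_of_nonneg_right (sq_nonneg _))

theorem japW_pos (s t : ℝ) : 0 < japW s t :=
  Real.rpow_pos_of_pos (one_pos.trans_le (one_le_sqrt_one_add_sq t)) _

theorem japW_sq (s t : ℝ) : japW s t ^ 2 = (1 + t ^ 2) ^ (-s) := by
  rw [japW, ← Real.rpow_natCast, ← Real.rpow_mul (Real.sqrt_nonneg _), mul_comm,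
    Real.rpow_mul (Real.sqrt_nonneg _), Nat.cast_ofNat, Real.rpow_two,
    Real.sq_sqrt (by positivity)]

theorem summable_japW_sq {s : ℝ} (hs : 1 / 2 < s) : Summable fun n : ℤ => japW s n ^ 2 := by
  have h : Summable fun n : ℕ => japW s n ^ 2 := by
    refine (summable_nat_add_iff 1).1 ?_
    have h1 := (summable_nat_add_iff 1).2 (Real.summable_nat_rpow.2 (show -(2 * s) < -1 by linarith))
    refine h1.of_nonneg_of_le (fun n => sq_nonneg _) fun n => ?_
    rw [japW_sq, ← mul_neg, Real.rpow_mul (Nat.cast_nonneg _), Real.rpow_two]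
    refine Real.rpow_le_rpow_of_nonpos (by positivity) ?_ (by linarith)
    linarith
  refine Summable.of_nat_of_neg ?_ ?_
  · simpa only [Int.cast_natCast] using h
  · simpa only [japW_sq, Int.cast_neg, Int.cast_natCast, neg_sq] using h

/-- Only the decay of the weight in the single coordinate x_j is used, since the slices are taken in
that direction. -/
theorem latJap_rpow_le {d : ℕ} (j : Fin d) (x : Fin d → ℤ) {s : ℝ} (hs : 0 ≤ s) :
    latJap x ^ (-s) ≤ japW s (x j) := by
  refine Real.rpow_le_rpow_of_nonpos (one_pos.trans_le (one_le_sqrt_one_add_sq _)) ?_ (by linarith)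
  refine Real.sqrt_le_sqrt ?_
  rw [latNorm, Real.sq_sqrt (Finset.sum_nonneg fun i _ => sq_nonneg _)]
  have := Finset.single_le_sum (f := fun i => (x i : ℝ) ^ 2) (fun i _ => sq_nonneg _)
    (Finset.mem_univ j)
  linarith

theorem norm_latWeight_comp_le {d : ℕ} (j : Fin d) (T : Hil d →L[ℂ] Hil d) {s : ℝ} (hs : 0 ≤ s)
    (k : ℤ → ℤ → ℝ) (hk : ∀ m n u, ‖sliceProj j m (T (sliceProj j n u))‖ ≤ k m n * ‖u‖)
    {f : ℤ × ℤ → ℝ} {B : ℝ} (hf : HasSum f B)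
    (hle : ∀ m n : ℤ, (k m n * (japW s m * japW s n)) ^ 2 ≤ f (m, n)) :
    ‖latWeight d s hs ∘L T ∘L latWeight d s hs‖ ≤ Real.sqrt B := by
  have hle' : ∀ p : ℤ × ℤ, (k p.1 p.2 * (japW s p.1 * japW s p.2)) ^ 2 ≤ f p :=
    fun p => hle p.1 p.2
  have hsum : Summable fun p : ℤ × ℤ => (k p.1 p.2 * (japW s p.1 * japW s p.2)) ^ 2 :=
    hf.summable.of_nonneg_of_le (fun p => sq_nonneg _) hle'
  have hB := hasSum_le hle' hsum.hasSum hf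
  refine (norm_diagOp_comp_le j T _ 1 _ (fun n => japW s n) (fun n => (japW_pos s n).le)
    (fun x => ?_) k hk hsum.hasSum).trans ?_
  · rw [Complex.norm_real, Real.norm_eq_abs,
      abs_of_nonneg (Real.rpow_nonneg (by linarith [one_le_latJap x]) _)]
    exact latJap_rpow_le j x hs
  · exact Real.sqrt_le_sqrt hB

/-! ### Bounds for the cut-off resolvent on the lattice -/

/-- The quantity which governs the modulus of continuity. -/
def modulusSum (s δ : ℝ) : ℝ := ∑' n : ℤ, (japW s n * min 1 (δ * (1 + |(n : ℝ)|))) ^ 2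

theorem summable_modulus {s δ : ℝ} (hs : 1 / 2 < s) (hδ : 0 ≤ δ) :
    Summable fun n : ℤ => (japW s n * min 1 (δ * (1 + |(n : ℝ)|))) ^ 2 := by
  refine (summable_japW_sq hs).of_nonneg_of_le (fun n => sq_nonneg _) fun n => ?_
  have h1 := japW_pos s n
  have h2 : 0 ≤ min 1 (δ * (1 + |(n : ℝ)|)) := le_min zero_le_one (by positivity)
  refine pow_le_pow_left₀ (by positivity) ?_ 2
  exact mul_le_of_le_one_right h1.le (min_le_left _ _)

/-- Subadditivity replaces a kernel depending on m - n by a sum of functions of m and of n, so that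
the weighted double sum factorizes. -/
theorem min_modulus_le {δ : ℝ} (hδ : 0 ≤ δ) (m n : ℤ) :
    min 1 (δ * (1 + |((m - n : ℤ) : ℝ)|)) ≤
      min 1 (δ * (1 + |(m : ℝ)|)) + min 1 (δ * (1 + |(n : ℝ)|)) := by
  have h : |((m - n : ℤ) : ℝ)| ≤ |(m : ℝ)| + |(n : ℝ)| := by
    push_cast
    exact abs_sub _ _
  have hm : 0 ≤ δ * (1 + |(m : ℝ)|) := by positivity
  have hn : 0 ≤ δ * (1 + |(n : ℝ)|) := by positivity
  rcases le_total 1 (δ * (1 + |(m : ℝ)|)) with h1 | h1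
  · rw [min_eq_left h1]
    exact (min_le_left _ _).trans (le_add_of_nonneg_right (le_min zero_le_one hn))
  rcases le_total 1 (δ * (1 + |(n : ℝ)|)) with h2 | h2
  · rw [min_eq_left h2]
    exact (min_le_left _ _).trans (le_add_of_nonneg_left (le_min zero_le_one hm))
  rw [min_eq_right h1, min_eq_right h2]
  refine (min_le_right _ _).trans ?_
  have := mul_le_mul_of_nonneg_left h hδ
  linarith

theorem norm_latWeight_fmul_le {d : ℕ} (j : Fin d) (m : C(UnitAddTorus (Fin d), ℂ)) {s : ℝ}
    (hs : 1 / 2 < s) (hs0 : 0 ≤ s) {C : ℝ} (hC : 0 ≤ C)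
    (h : ∀ n θ, ‖partialSymbol j n m θ‖ ≤ C) :
    ‖latWeight d s hs0 ∘L fmul m ∘L latWeight d s hs0‖ ≤ C * ∑' n : ℤ, japW s n ^ 2 := by
  have hw := (summable_japW_sq hs).hasSum
  have hww := (hw.mul hw (hw.summable.mul_of_nonneg hw.summable (fun _ => sq_nonneg _)
    (fun _ => sq_nonneg _))).mul_left (C ^ 2)
  refine (norm_latWeight_comp_le j (fmul m) hs0 (fun _ _ => C)
    (fun p q u => norm_sliceProj_fmul_sliceProj_le j m p q hC (h _) u) hww fun p q => ?_).trans ?_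
  · exact le_of_eq (by ring)
  · rw [← pow_two, ← mul_pow, Real.sqrt_sq]
    exact mul_nonneg hC (tsum_nonneg fun _ => sq_nonneg _)

theorem hasSum_prod_mul_of_nonneg {f g : ℤ → ℝ} {a b : ℝ} (hf : HasSum f a) (hg : HasSum g b)
    (hf0 : ∀ n, 0 ≤ f n) (hg0 : ∀ n, 0 ≤ g n) :
    HasSum (fun p : ℤ × ℤ => f p.1 * g p.2) (a * b) :=
  hf.mul hg (hf.summable.mul_of_nonneg hg.summable hf0 hg0)

/-- By (μ m + μ n)² ≤ 2(μ m² + μ n²), the double sum is at most 4C² times Φ times the sum of the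
squared weights. -/
theorem norm_latWeight_comp_le_of_add {d : ℕ} (j : Fin d) (T : Hil d →L[ℂ] Hil d) {s : ℝ}
    (hs : 1 / 2 < s) (hs0 : 0 ≤ s) {C Φ : ℝ} (hC : 0 ≤ C) (μ : ℤ → ℝ)
    (hk : ∀ m n u, ‖sliceProj j m (T (sliceProj j n u))‖ ≤ C * (μ m + μ n) * ‖u‖)
    (hΦ : HasSum (fun n : ℤ => (japW s n * μ n) ^ 2) Φ) :
    ‖latWeight d s hs0 ∘L T ∘L latWeight d s hs0‖ ≤
      2 * C * Real.sqrt (∑' n : ℤ, japW s n ^ 2) * Real.sqrt Φ := by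
  have hw := (summable_japW_sq hs).hasSum
  have hW : 0 ≤ ∑' n : ℤ, japW s n ^ 2 := tsum_nonneg fun _ => sq_nonneg _
  set W := ∑' n : ℤ, japW s n ^ 2 with hWdef
  have h1 := hasSum_prod_mul_of_nonneg hΦ hw (fun _ => sq_nonneg _) fun _ => sq_nonneg _
  have h2 := hasSum_prod_mul_of_nonneg hw hΦ (fun _ => sq_nonneg _) fun _ => sq_nonneg _
  refine (norm_latWeight_comp_le j T hs0 (fun m n => C * (μ m + μ n)) hk
    ((h1.add h2).mul_left (2 * C ^ 2)) fun m n => ?_).trans (le_of_eq ?_)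
  · have e : 2 * C ^ 2 * ((japW s m * μ m) ^ 2 * japW s n ^ 2 + japW s m ^ 2 * (japW s n * μ n) ^ 2) -
        (C * (μ m + μ n) * (japW s m * japW s n)) ^ 2 =
        (C * (μ m - μ n) * (japW s m * japW s n)) ^ 2 := by ring
    have := sq_nonneg (C * (μ m - μ n) * (japW s m * japW s n))
    linarith
  · have e : 2 * C ^ 2 * (Φ * W + W * Φ) = (2 * C) ^ 2 * (W * Φ) := by ring
    rw [e, Real.sqrt_mul (by positivity), Real.sqrt_sq (by positivity), Real.sqrt_mul hW]
    ring

theorem norm_latWeight_fmul_le_modulus {d : ℕ} (j : Fin d) (m : C(UnitAddTorus (Fin d), ℂ)) {s : ℝ}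
    (hs : 1 / 2 < s) (hs0 : 0 ≤ s) {C δ : ℝ} (hC : 0 ≤ C) (hδ : 0 ≤ δ)
    (h : ∀ (n : ℤ) θ, ‖partialSymbol j n m θ‖ ≤ C * min 1 (δ * (1 + |(n : ℝ)|))) :
    ‖latWeight d s hs0 ∘L fmul m ∘L latWeight d s hs0‖ ≤
      2 * C * Real.sqrt (∑' n : ℤ, japW s n ^ 2) * Real.sqrt (modulusSum s δ) := by
  refine norm_latWeight_comp_le_of_add j (fmul m) hs hs0 hC
    (fun n => min 1 (δ * (1 + |(n : ℝ)|))) (fun p q u => ?_) (summable_modulus hs hδ).hasSum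
  have hmin : 0 ≤ min 1 (δ * (1 + |((p - q : ℤ) : ℝ)|)) := le_min zero_le_one (by positivity)
  refine (norm_sliceProj_fmul_sliceProj_le j m p q (mul_nonneg hC hmin) (h _) u).trans ?_
  exact mul_le_mul_of_nonneg_right (mul_le_mul_of_nonneg_left (min_modulus_le hδ p q) hC)
    (norm_nonneg _)

theorem partialSymbol_sub {d : ℕ} (j : Fin d) (n : ℤ) (m m' : C(UnitAddTorus (Fin d), ℂ))
    (θ : UnitAddTorus (Fin d)) :
    partialSymbol j n (m - m') θ = partialSymbol j n m θ - partialSymbol j n m' θ := by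
  have hi : ∀ m : C(UnitAddTorus (Fin d), ℂ), Integrable (fun τ : UnitAddCircle =>
      m (θ + Pi.single j τ) * fourier n τ) AddCircle.haarAddCircle := by
    intro m
    have hsing : Continuous (fun τ : UnitAddCircle => (Pi.single j τ : UnitAddTorus (Fin d))) :=
      continuous_single (A := fun _ : Fin d => UnitAddCircle) j
    exact Continuous.integrable_of_hasCompactSupport (by fun_prop)
      (HasCompactSupport.of_compactSpace _)
  rw [partialSymbol_apply, partialSymbol_apply, partialSymbol_apply, ← integral_sub (hi m) (hi m')]
  simp only [ContinuousMap.sub_apply, sub_mul]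

theorem fmul_sub {d : ℕ} (m m' : C(UnitAddTorus (Fin d), ℂ)) : fmul (m - m') = fmul m - fmul m' :=
  map_sub (fmulHom d) m m'

/-- Boundedness and modulus of continuity of the cut-off resolvent. -/
theorem exists_cutoffResolvent_bound {d : ℕ} {χ : UnitAddTorus (Fin d) → ℝ} (hχ : TorusSmooth χ)
    (hsupp : tsupport χ ⊆ regularSet d) {ε : ℝ} (hε : 0 < ε) :
    ∃ C : ℝ, 0 ≤ C ∧ (∀ z : ℂ, z.im ≠ 0 → ‖cutoffResolvent χ hχ ε hε z‖ ≤ C) ∧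
      ∀ z z' : ℂ, 0 < z.im * z'.im →
        ‖cutoffResolvent χ hχ ε hε z - cutoffResolvent χ hχ ε hε z'‖ ≤
          C * Real.sqrt (modulusSum (1 / 2 + ε) ‖z - z'‖) := by
  obtain ⟨a, ha, ha1, g, hg, hga, hsum⟩ := exists_localization hχ hsupp
  choose C hC hbd using fun j => exists_bound_partialSymbol (hg j) j ha ha1 (hga j)
  have hs : 1 / 2 < 1 / 2 + ε := by linarith
  have hs0 : 0 ≤ 1 / 2 + ε := by linarith
  set L := latWeight d (1 / 2 + ε) hs0 with hL
  set W := ∑' n : ℤ, japW (1 / 2 + ε) n ^ 2 with hW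
  have hW0 : 0 ≤ W := tsum_nonneg fun _ => sq_nonneg _
  have hsplit : ∀ (z : ℂ) (hz : z.im ≠ 0), cutoffResolvent χ hχ ε hε z =
      ∑ j, L ∘L fmul ((hg j).toC * symbolRes d z hz) ∘L L := by
    intro z hz
    have h1 : hχ.toC ^ 2 = ∑ j, (hg j).toC := by
      ext θ
      have := congrArg (fun x : ℝ => (x : ℂ)) (hsum θ)
      simpa [TorusSmooth.toC] using this
    rw [cutoffResolvent_eq hχ hε hz, h1, Finset.sum_mul, ← fmulHom_apply, map_sum]
    simp only [fmulHom_apply]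
    ext1 u
    simp [map_sum, hL]
  refine ⟨∑ j, (C j * W + 2 * (2 * C j) * Real.sqrt W), Finset.sum_nonneg fun j _ => by
    have := hC j; positivity, fun z hz => ?_, fun z z' him => ?_⟩
  · rw [hsplit z hz]
    refine norm_sum_le_of_le _ fun j _ => ?_
    refine (norm_latWeight_fmul_le j _ hs hs0 (hC j) fun n θ => (hbd j n θ).1 z hz).trans ?_
    have := hC j
    exact le_add_of_nonneg_right (by positivity)
  · have hz : z.im ≠ 0 := (mul_ne_zero_iff.1 him.ne').1
    have hz' : z'.im ≠ 0 := (mul_ne_zero_iff.1 him.ne').2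
    rw [hsplit z hz, hsplit z' hz', ← Finset.sum_sub_distrib, Finset.sum_mul]
    refine norm_sum_le_of_le _ fun j _ => ?_
    have hCj := hC j
    have e : L ∘L fmul ((hg j).toC * symbolRes d z hz) ∘L L -
        L ∘L fmul ((hg j).toC * symbolRes d z' hz') ∘L L =
        L ∘L fmul ((hg j).toC * symbolRes d z hz - (hg j).toC * symbolRes d z' hz') ∘L L := by
      rw [fmul_sub]
      ext1 u
      simp
    rw [e]
    -- The factor 2 lets a single constant cover both the sum of two uniform bounds and the
    -- Lipschitz bound.
    refine (norm_latWeight_fmul_le_modulus j _ hs hs0 (C := 2 * C j) (δ := ‖z - z'‖)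
      (by positivity) (norm_nonneg _) fun n θ => ?_).trans ?_
    · rw [partialSymbol_sub]
      have b1 := (hbd j n θ).1 z hz
      have b2 := (hbd j n θ).1 z' hz'
      have b3 := (hbd j n θ).2 z z' hz hz' him
      rw [mul_min_of_nonneg _ _ (by positivity), mul_one]
      refine le_min ((norm_sub_le _ _).trans (by linarith)) (b3.trans ?_)
      rw [mul_comm (1 + |(n : ℝ)|)]
      refine mul_le_mul_of_nonneg_right (by linarith) (by positivity)
    · refine mul_le_mul_of_nonneg_right ?_ (Real.sqrt_nonneg _)
      exact le_add_of_nonneg_left (by positivity)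

end DiscreteSchrodinger

end

noncomputable section

namespace DiscreteSchrodinger

/-! ### Translations and the resolvent of `D_{η₁}` -/

section Translation

variable {n : ℕ}

/-- Translation by `v` on `L²(ℝⁿ)`. -/
def translate (v : EuclideanSpace ℝ (Fin n)) (f : L2Euc n) : L2Euc n :=
  Lp.compMeasurePreserving (fun η => η - v) (measurePreserving_sub_right volume v) f

theorem coeFn_translate (v : EuclideanSpace ℝ (Fin n)) (f : L2Euc n) :
    translate v f =ᵐ[volume] fun η => f (η - v) :=
  Lp.coeFn_compMeasurePreserving f _

theorem memLp_modulation (v : EuclideanSpace ℝ (Fin n)) :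
    MemLp (fun ξ : EuclideanSpace ℝ (Fin n) => ((Real.fourierChar (-inner ℝ v ξ) : Circle) : ℂ)) ∞
      volume := by
  refine memLp_top_of_bound (C := 1) ?_ (.of_forall fun ξ => (Circle.norm_coe _).le)
  refine Continuous.aestronglyMeasurable ?_
  have := Real.continuous_fourierChar
  fun_prop

theorem fourier_compSubConst (v : EuclideanSpace ℝ (Fin n))
    (φ : SchwartzMap (EuclideanSpace ℝ (Fin n)) ℂ) (ξ : EuclideanSpace ℝ (Fin n)) :
    𝓕 (φ.compSubConstCLM ℂ v) ξ =
      ((Real.fourierChar (-inner ℝ v ξ) : Circle) : ℂ) * 𝓕 φ ξ := by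
  rw [SchwartzMap.fourier_coe, SchwartzMap.fourier_coe, Real.fourier_eq, Real.fourier_eq,
    ← integral_add_right_eq_self _ v, ← integral_const_mul]
  refine integral_congr_ae (.of_forall fun x => ?_)
  simp only [SchwartzMap.compSubConstCLM_apply, add_sub_cancel_right, inner_add_left, neg_add,
    AddChar.map_add_eq_mul, Circle.smul_def, Circle.coe_mul, smul_eq_mul]
  ring

theorem translate_toLp (v : EuclideanSpace ℝ (Fin n))
    (φ : SchwartzMap (EuclideanSpace ℝ (Fin n)) ℂ) :
    translate v (φ.toLp 2 volume) = (φ.compSubConstCLM ℂ v).toLp 2 volume := by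
  refine Lp.ext ((coeFn_translate v _).trans ?_)
  have h2 := (measurePreserving_sub_right volume v).quasiMeasurePreserving.ae_eq_comp
    (φ.coeFn_toLp 2 volume)
  filter_upwards [h2, (φ.compSubConstCLM ℂ v).coeFn_toLp 2 volume] with x hx hx'
  rw [hx', SchwartzMap.compSubConstCLM_apply]
  exact hx

theorem mulOp_modulation_toLp (v : EuclideanSpace ℝ (Fin n))
    (φ : SchwartzMap (EuclideanSpace ℝ (Fin n)) ℂ) :
    mulOp _ (memLp_modulation v) ((𝓕 φ).toLp 2 volume) =
      (𝓕 (φ.compSubConstCLM ℂ v)).toLp 2 volume := by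
  refine Lp.ext ?_
  filter_upwards [SchwartzMap.coeFn_toLp (𝓕 (φ.compSubConstCLM ℂ v)) 2 volume,
    coeFn_mulOp _ (memLp_modulation v) ((𝓕 φ).toLp 2 volume),
    SchwartzMap.coeFn_toLp (𝓕 φ) 2 volume] with ξ e1 e2 e3
  rw [e1, e2, e3, fourier_compSubConst]

/-- Both sides are continuous in f, so the explicit computation on Schwartz functions suffices by
density. -/
theorem fourier_translate (v : EuclideanSpace ℝ (Fin n)) (f : L2Euc n) :
    Lp.fourierTransformₗᵢ (EuclideanSpace ℝ (Fin n)) ℂ (translate v f) =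
      mulOp _ (memLp_modulation v) (Lp.fourierTransformₗᵢ (EuclideanSpace ℝ (Fin n)) ℂ f) := by
  refine DenseRange.induction_on
    (p := fun f => Lp.fourierTransformₗᵢ (EuclideanSpace ℝ (Fin n)) ℂ (translate v f) =
      mulOp _ (memLp_modulation v) (Lp.fourierTransformₗᵢ (EuclideanSpace ℝ (Fin n)) ℂ f))
    (SchwartzMap.denseRange_toLpCLM (p := 2) ENNReal.ofNat_ne_top) f ?_ ?_
  · refine isClosed_eq ?_ ?_
    · exact (LinearIsometryEquiv.continuous _).comp (Lp.isometry_compMeasurePreserving _).continuous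
    · exact (ContinuousLinearMap.continuous _).comp (LinearIsometryEquiv.continuous _)
  · intro φ
    have h3 : ∀ ψ : SchwartzMap (EuclideanSpace ℝ (Fin n)) ℂ,
        Lp.fourierTransformₗᵢ (EuclideanSpace ℝ (Fin n)) ℂ (ψ.toLp 2 volume) =
          (𝓕 ψ).toLp 2 volume :=
      fun ψ => SchwartzMap.toLp_fourier_eq ψ
    change Lp.fourierTransformₗᵢ (EuclideanSpace ℝ (Fin n)) ℂ (translate v (φ.toLp 2 volume)) =
      mulOp _ (memLp_modulation v)
        (Lp.fourierTransformₗᵢ (EuclideanSpace ℝ (Fin n)) ℂ (φ.toLp 2 volume))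
    rw [translate_toLp, h3, h3, mulOp_modulation_toLp]

/-! ### The resolvent of D_{η₁} as an integral of translations -/

theorem inner_resD1 [NeZero n] {z : ℂ} (hz : z.im ≠ 0) (u f : L2Euc n) :
    inner ℂ u (resD1 n z hz f) = ∫ ξ : EuclideanSpace ℝ (Fin n), (((ξ 0 : ℝ) : ℂ) - z)⁻¹ *
      inner ℂ (Lp.fourierTransformₗᵢ (EuclideanSpace ℝ (Fin n)) ℂ u ξ)
        (Lp.fourierTransformₗᵢ (EuclideanSpace ℝ (Fin n)) ℂ f ξ) := by
  rw [← (Lp.fourierTransformₗᵢ (EuclideanSpace ℝ (Fin n)) ℂ).inner_map_map]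
  have h : Lp.fourierTransformₗᵢ (EuclideanSpace ℝ (Fin n)) ℂ (resD1 n z hz f) =
      mulOp _ (memLp_resSymbol n z hz) (Lp.fourierTransformₗᵢ (EuclideanSpace ℝ (Fin n)) ℂ f) :=
    LinearIsometryEquiv.apply_symm_apply _ _
  rw [h, L2.inner_def]
  refine integral_congr_ae ?_
  filter_upwards [coeFn_mulOp _ (memLp_resSymbol n z hz)
    (Lp.fourierTransformₗᵢ (EuclideanSpace ℝ (Fin n)) ℂ f)] with ξ hξ
  rw [hξ, RCLike.inner_apply, RCLike.inner_apply, mul_assoc]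

theorem inner_translate (v : EuclideanSpace ℝ (Fin n)) (u f : L2Euc n) :
    inner ℂ u (translate v f) = ∫ ξ : EuclideanSpace ℝ (Fin n),
      ((Real.fourierChar (-inner ℝ v ξ) : Circle) : ℂ) *
      inner ℂ (Lp.fourierTransformₗᵢ (EuclideanSpace ℝ (Fin n)) ℂ u ξ)
        (Lp.fourierTransformₗᵢ (EuclideanSpace ℝ (Fin n)) ℂ f ξ) := by
  rw [← (Lp.fourierTransformₗᵢ (EuclideanSpace ℝ (Fin n)) ℂ).inner_map_map, fourier_translate,
    L2.inner_def]
  refine integral_congr_ae ?_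
  filter_upwards [coeFn_mulOp _ (memLp_modulation v)
    (Lp.fourierTransformₗᵢ (EuclideanSpace ℝ (Fin n)) ℂ f)] with ξ hξ
  rw [hξ, RCLike.inner_apply, RCLike.inner_apply, mul_assoc]

/-- The propagator `e^{2πiσtz}`. -/
def propag (σ : ℝ) (z : ℂ) (t : ℝ) : ℂ := Complex.exp (2 * Real.pi * Complex.I * σ * z * t)

theorem norm_propag (σ : ℝ) (z : ℂ) (t : ℝ) :
    ‖propag σ z t‖ = Real.exp (-(2 * Real.pi * (σ * z.im)) * t) := by
  rw [propag, Complex.norm_exp]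
  have h : 2 * Real.pi * Complex.I * σ * z * t =
      ((2 * Real.pi * σ * t : ℝ) : ℂ) * (Complex.I * z) := by
    push_cast
    ring
  rw [h, Complex.re_ofReal_mul, Complex.I_mul_re]
  congr 1
  ring

theorem continuous_propag (σ : ℝ) (z : ℂ) : Continuous (propag σ z) := by
  unfold propag
  fun_prop

/-- The unit vector in the first coordinate direction. -/
def firstVec (n : ℕ) [NeZero n] : EuclideanSpace ℝ (Fin n) := EuclideanSpace.single 0 1

theorem propag_mul_modulation [NeZero n] (σ : ℝ) (z : ℂ) (t : ℝ)
    (ξ : EuclideanSpace ℝ (Fin n)) :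
    propag σ z t * ((Real.fourierChar (-inner ℝ ((σ * t) • firstVec n) ξ) : Circle) : ℂ) =
      Complex.exp (2 * Real.pi * Complex.I * σ * (z - (ξ 0 : ℝ)) * t) := by
  have h : inner ℝ ((σ * t) • firstVec n) ξ = σ * t * ξ 0 := by
    rw [inner_smul_left, firstVec, EuclideanSpace.inner_single_left]
    simp
  rw [h, Real.fourierChar_apply, propag, ← Complex.exp_add]
  congr 1
  push_cast
  ring

/-- The time-dependent representation of the resolvent of `D_{η₁}`. -/
theorem inner_resD1_eq_integral [NeZero n] {σ : ℝ} (hσ : σ ≠ 0) {z : ℂ} (hz : 0 < σ * z.im)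
    (hz' : z.im ≠ 0) (u f : L2Euc n) :
    IntegrableOn (fun t : ℝ => propag σ z t * inner ℂ u (translate ((σ * t) • firstVec n) f))
      (Set.Ioi 0) ∧
    inner ℂ u (resD1 n z hz' f) = 2 * Real.pi * Complex.I * σ *
      ∫ t in Set.Ioi (0 : ℝ), propag σ z t * inner ℂ u (translate ((σ * t) • firstVec n) f) := by
  set A := Lp.fourierTransformₗᵢ (EuclideanSpace ℝ (Fin n)) ℂ u with hA
  set B := Lp.fourierTransformₗᵢ (EuclideanSpace ℝ (Fin n)) ℂ f with hB
  have hpos : 0 < 2 * Real.pi * (σ * z.im) := by positivity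
  have hAB : Integrable (fun ξ : EuclideanSpace ℝ (Fin n) => (inner ℂ (A ξ) (B ξ) : ℂ)) :=
    L2.integrable_inner A B
  have hexp : IntegrableOn (fun t : ℝ => Real.exp (-(2 * Real.pi * (σ * z.im)) * t)) (Set.Ioi 0) :=
    exp_neg_integrableOn_Ioi 0 hpos
  have hp1 : Integrable (fun t : ℝ => propag σ z t) (volume.restrict (Set.Ioi 0)) := by
    refine hexp.mono' (continuous_propag σ z).aestronglyMeasurable (.of_forall fun t => ?_)
    rw [norm_propag]
  have hI0 : Integrable (fun p : ℝ × EuclideanSpace ℝ (Fin n) =>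
      propag σ z p.1 * inner ℂ (A p.2) (B p.2)) ((volume.restrict (Set.Ioi 0)).prod volume) :=
    hp1.mul_prod hAB
  have hI : Integrable (fun p : ℝ × EuclideanSpace ℝ (Fin n) =>
      ((Real.fourierChar (-inner ℝ ((σ * p.1) • firstVec n) p.2) : Circle) : ℂ) *
      (propag σ z p.1 * inner ℂ (A p.2) (B p.2))) ((volume.restrict (Set.Ioi 0)).prod volume) := by
    refine hI0.bdd_mul (c := 1) ?_ (.of_forall fun p => (Circle.norm_coe _).le)
    refine Continuous.aestronglyMeasurable ?_
    have := Real.continuous_fourierChar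
    fun_prop
  have hinner : ∀ t : ℝ, propag σ z t * inner ℂ u (translate ((σ * t) • firstVec n) f) =
      ∫ ξ : EuclideanSpace ℝ (Fin n),
        ((Real.fourierChar (-inner ℝ ((σ * t) • firstVec n) ξ) : Circle) : ℂ) *
        (propag σ z t * inner ℂ (A ξ) (B ξ)) := by
    intro t
    rw [inner_translate, ← integral_const_mul]
    refine integral_congr_ae (.of_forall fun ξ => ?_)
    simp only [← hA, ← hB]
    ring
  refine ⟨?_, ?_⟩
  · simp only [hinner]
    exact hI.integral_prod_left
  · simp only [hinner]
    rw [integral_integral_swap hI, inner_resD1, ← integral_const_mul]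
    refine integral_congr_ae (.of_forall fun ξ => ?_)
    simp only [← hA, ← hB, ← mul_assoc]
    rw [integral_mul_const, ← mul_assoc]
    congr 1
    have e1 : ∀ t : ℝ, ((Real.fourierChar (-inner ℝ ((σ * t) • firstVec n) ξ) : Circle) : ℂ) *
        propag σ z t = Complex.exp (2 * Real.pi * Complex.I * σ * (z - (ξ 0 : ℝ)) * t) := by
      intro t
      rw [mul_comm, propag_mul_modulation]
    simp only [e1]
    -- The real part is -2πσ Im z; choosing σ as the sign of Im z makes the time integral converge,
    -- in either half-plane.
    have hre : (2 * Real.pi * Complex.I * σ * (z - (ξ 0 : ℝ))).re < 0 := by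
      simp [Complex.mul_re, Complex.mul_im]
      nlinarith
    rw [integral_exp_mul_complex_Ioi hre]
    have h1 : (ξ 0 : ℂ) - z ≠ 0 := ofReal_sub_ne_zero hz' _
    have h2 : z - (ξ 0 : ℂ) ≠ 0 := by rw [← neg_sub]; exact neg_ne_zero.2 h1
    have h3 : (σ : ℂ) ≠ 0 := Complex.ofReal_ne_zero.2 hσ
    have h4 : (Real.pi : ℂ) ≠ 0 := Complex.ofReal_ne_zero.2 Real.pi_ne_zero
    rw [Complex.ofReal_zero, mul_zero, Complex.exp_zero]
    field_simp
    ring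

theorem inner_mulOp_left_of_real {X : Type*} [MeasurableSpace X] {μ : Measure X} (m : X → ℝ)
    (hm : MemLp (fun x => (m x : ℂ)) ∞ μ) (f g : Lp ℂ 2 μ) :
    inner ℂ f (mulOp _ hm g) = inner ℂ (mulOp _ hm f) g := by
  rw [L2.inner_def, L2.inner_def]
  refine integral_congr_ae ?_
  filter_upwards [coeFn_mulOp _ hm f, coeFn_mulOp _ hm g] with x h1 h2
  rw [h1, h2, RCLike.inner_apply, RCLike.inner_apply, map_mul, Complex.conj_ofReal]
  ring

theorem eucWeight_coeFn [NeZero n] {s : ℝ} (hs : 0 ≤ s) (f : L2Euc n) :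
    eucWeight n s hs f =ᵐ[volume] fun η => (japW s (η 0) : ℂ) * f η :=
  coeFn_mulOp _ _ _

/-- The representation of the difference of two weighted resolvents. -/
theorem inner_modelResolvent_sub [NeZero n] {ε : ℝ} (hε : 0 < ε) {σ : ℝ} (hσ : σ ≠ 0) {z z' : ℂ}
    (hz : 0 < σ * z.im) (hz' : 0 < σ * z'.im) (h0 : z.im ≠ 0) (h0' : z'.im ≠ 0) (u f : L2Euc n) :
    IntegrableOn (fun t : ℝ => (propag σ z t - propag σ z' t) *
      inner ℂ (eucWeight n (1 / 2 + ε) (by positivity) u)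
        (translate ((σ * t) • firstVec n) (eucWeight n (1 / 2 + ε) (by positivity) f)))
      (Set.Ioi 0) ∧
    inner ℂ u ((modelResolvent n ε hε z h0 - modelResolvent n ε hε z' h0') f) =
      2 * Real.pi * Complex.I * σ *
      ∫ t in Set.Ioi (0 : ℝ), (propag σ z t - propag σ z' t) *
        inner ℂ (eucWeight n (1 / 2 + ε) (by positivity) u)
          (translate ((σ * t) • firstVec n) (eucWeight n (1 / 2 + ε) (by positivity) f)) := by
  have hw : ∀ g : L2Euc n, inner ℂ u (eucWeight n (1 / 2 + ε) (by positivity) g) =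
      inner ℂ (eucWeight n (1 / 2 + ε) (by positivity) u) g := fun g =>
    inner_mulOp_left_of_real _ _ _ _
  obtain ⟨i1, e1⟩ := inner_resD1_eq_integral hσ hz h0
    (eucWeight n (1 / 2 + ε) (by positivity) u) (eucWeight n (1 / 2 + ε) (by positivity) f)
  obtain ⟨i2, e2⟩ := inner_resD1_eq_integral hσ hz' h0'
    (eucWeight n (1 / 2 + ε) (by positivity) u) (eucWeight n (1 / 2 + ε) (by positivity) f)
  simp only [sub_mul]
  refine ⟨i1.sub i2, ?_⟩
  rw [integral_sub i1 i2, mul_sub, ← e1, ← e2, sub_apply, inner_sub_right]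
  congr 1
  · exact hw _
  · exact hw _

end Translation

end DiscreteSchrodinger

end

noncomputable section

namespace DiscreteSchrodinger

/-! ### Hölder continuity of the weighted resolvent of `D_{η₁}` -/

/-- Mean value inequality on the convex left half-plane, where the derivative of the exponential has
modulus at most 1. -/
theorem norm_exp_sub_exp_le {a b : ℂ} (ha : a.re ≤ 0) (hb : b.re ≤ 0) :
    ‖Complex.exp a - Complex.exp b‖ ≤ ‖a - b‖ := by
  have h := Convex.norm_image_sub_le_of_norm_deriv_le (𝕜 := ℂ) (f := Complex.exp) (C := 1)
    (s := {z : ℂ | z.re ≤ 0}) (fun x _ => Complex.differentiableAt_exp)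
    (fun x hx => by
      rw [Complex.deriv_exp, Complex.norm_exp]
      exact Real.exp_le_one_iff.2 hx)
    (convex_halfSpace_re_le 0) hb ha
  rwa [one_mul] at h

theorem norm_propag_le_one {σ : ℝ} {z : ℂ} (hz : 0 < σ * z.im) {t : ℝ} (ht : 0 ≤ t) :
    ‖propag σ z t‖ ≤ 1 := by
  rw [norm_propag, Real.exp_le_one_iff, neg_mul, neg_nonpos]
  have := Real.pi_pos
  positivity

/-- Interpolation between the Lipschitz bound x and the trivial bound 2, both of which are at most
2x^α in their respective ranges x ≤ 1 and x ≥ 1. -/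
theorem norm_propag_sub_le {σ : ℝ} (hσ : |σ| = 1) {z z' : ℂ} (hz : 0 < σ * z.im)
    (hz' : 0 < σ * z'.im) {t : ℝ} (ht : 0 ≤ t) {α : ℝ} (hα : 0 ≤ α) (hα1 : α ≤ 1) :
    ‖propag σ z t - propag σ z' t‖ ≤ 2 * (2 * Real.pi * t * ‖z - z'‖) ^ α := by
  have hpi := Real.pi_pos
  set x := 2 * Real.pi * t * ‖z - z'‖ with hx
  have hx0 : 0 ≤ x := by positivity
  have hre : ∀ w : ℂ, 0 < σ * w.im → (2 * Real.pi * Complex.I * σ * w * t).re ≤ 0 := by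
    intro w hw
    have h := norm_propag_le_one hw ht
    rwa [propag, Complex.norm_exp, Real.exp_le_one_iff] at h
  have h1 : ‖propag σ z t - propag σ z' t‖ ≤ x := by
    refine (norm_exp_sub_exp_le (hre z hz) (hre z' hz')).trans (le_of_eq ?_)
    have e : 2 * Real.pi * Complex.I * σ * z * t - 2 * Real.pi * Complex.I * σ * z' * t =
        ((2 * Real.pi * t * σ : ℝ) : ℂ) * (Complex.I * (z - z')) := by
      push_cast
      ring
    rw [e, norm_mul, norm_mul, Complex.norm_I, one_mul, Complex.norm_real, Real.norm_eq_abs,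
      abs_mul, hσ, mul_one, abs_of_nonneg (by positivity)]
  have h2 : ‖propag σ z t - propag σ z' t‖ ≤ 2 := by
    refine (norm_sub_le _ _).trans ?_
    have := norm_propag_le_one hz ht
    have := norm_propag_le_one hz' ht
    linarith
  rcases le_total x 1 with h | h
  · have h3 : x ≤ x ^ α := Real.self_le_rpow_of_le_one hx0 h hα1
    have : 0 ≤ x ^ α := Real.rpow_nonneg hx0 _
    linarith
  · have h3 : 1 ≤ x ^ α := Real.one_le_rpow h hα
    linarith

theorem japW_le_one {s : ℝ} (hs : 0 ≤ s) (t : ℝ) : japW s t ≤ 1 :=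
  Real.rpow_le_one_of_one_le_of_nonpos (one_le_sqrt_one_add_sq t) (by linarith)

theorem continuous_japW (s : ℝ) : Continuous (japW s) := by
  unfold japW
  refine Continuous.rpow_const (by fun_prop) fun t => Or.inl ?_
  exact (one_pos.trans_le (one_le_sqrt_one_add_sq t)).ne'

theorem japW_le_of_le {s s' : ℝ} (h : s' ≤ s) (t : ℝ) : japW s t ≤ japW s' t :=
  Real.rpow_le_rpow_of_exponent_le (one_le_sqrt_one_add_sq t) (by linarith)

theorem abs_rpow_mul_japW_le {α : ℝ} (hα : 0 ≤ α) (s t : ℝ) :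
    |t| ^ α * japW s t ≤ japW (s - α) t := by
  have h0 : 0 < Real.sqrt (1 + t ^ 2) := one_pos.trans_le (one_le_sqrt_one_add_sq t)
  have h1 : |t| ≤ Real.sqrt (1 + t ^ 2) := by
    rw [← Real.sqrt_sq_eq_abs]
    exact Real.sqrt_le_sqrt (by linarith)
  have e : japW (s - α) t = Real.sqrt (1 + t ^ 2) ^ α * japW s t := by
    rw [japW, japW, ← Real.rpow_add h0]
    congr 1
    ring
  rw [e]
  exact mul_le_mul_of_nonneg_right (Real.rpow_le_rpow (abs_nonneg _) h1 hα) (japW_pos s t).le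

/-- A power α of the travelled distance is paid for by the weights at its two ends, whose exponent
drops from s to s - α. -/
theorem rpow_mul_japW_mul_le {α : ℝ} (hα : 0 ≤ α) (hα1 : α ≤ 1) (s a b : ℝ) :
    |a - b| ^ α * (japW s a * japW s b) ≤ 2 * (japW (s - α) a * japW (s - α) b) := by
  have h1 : |a - b| ^ α ≤ |a| ^ α + |b| ^ α :=
    (Real.rpow_le_rpow (abs_nonneg _) (abs_sub _ _) hα).trans
      (Real.rpow_add_le_add_rpow (abs_nonneg _) (abs_nonneg _) hα hα1)
  have pa := japW_pos s a
  have pb := japW_pos s b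
  have pa' := japW_pos (s - α) a
  have pb' := japW_pos (s - α) b
  have la := japW_le_of_le (sub_le_self s hα) a
  have lb := japW_le_of_le (sub_le_self s hα) b
  calc _ ≤ (|a| ^ α + |b| ^ α) * (japW s a * japW s b) := by gcongr
    _ = (|a| ^ α * japW s a) * japW s b + japW s a * (|b| ^ α * japW s b) := by ring
    _ ≤ japW (s - α) a * japW (s - α) b + japW (s - α) a * japW (s - α) b := by
        gcongr
        · exact abs_rpow_mul_japW_le hα s a
        · exact abs_rpow_mul_japW_le hα s b
    _ = _ := by ring

theorem integrable_japW_sq {s : ℝ} (hs : 1 / 2 < s) : Integrable fun t : ℝ => japW s t ^ 2 := by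
  have h := integrable_rpow_neg_one_add_norm_sq (E := ℝ) (μ := volume) (r := 2 * s)
    (by simp; linarith)
  refine h.congr (.of_forall fun t => ?_)
  simp only [japW_sq, Real.norm_eq_abs, sq_abs]
  congr 1
  ring

section Slide

variable {n : ℕ}

theorem integrable_norm_sq_L2 (g : L2Euc n) : Integrable fun η => ‖g η‖ ^ 2 :=
  (memLp_two_iff_integrable_sq_norm (Lp.aestronglyMeasurable g)).1 (Lp.memLp g)

theorem integral_norm_sq_L2 (g : L2Euc n) : ∫ η, ‖g η‖ ^ 2 = ‖g‖ ^ 2 := by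
  have h : (inner ℂ g g : ℂ) = ((∫ η, ‖g η‖ ^ 2 : ℝ) : ℂ) := by
    rw [L2.inner_def, ← integral_complex_ofReal]
    refine integral_congr_ae (.of_forall fun η => ?_)
    simp only [inner_self_eq_norm_sq_to_K]
    push_cast
    rfl
  refine Complex.ofReal_injective ?_
  rw [← h, inner_self_eq_norm_sq_to_K]
  push_cast
  rfl

/-- Test with the multiple of T f that has the norm of f. The quadratic form of the hypothesis suits
an estimate in which u and f have been decoupled. -/
theorem opNorm_le_of_quadratic {T : L2Euc n →L[ℂ] L2Euc n} {K : ℝ} (hK : 0 ≤ K)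
    (h : ∀ u f, ‖(inner ℂ u (T f) : ℂ)‖ ≤ K * (‖u‖ ^ 2 + ‖f‖ ^ 2)) : ‖T‖ ≤ 2 * K := by
  refine ContinuousLinearMap.opNorm_le_bound _ (by positivity) fun f => ?_
  by_cases hT : T f = 0
  · rw [hT, norm_zero]; positivity
  have hT' : 0 < ‖T f‖ := norm_pos_iff.2 hT
  have h1 := h (((‖f‖ / ‖T f‖ : ℝ) : ℂ) • T f) f
  rw [inner_smul_left, norm_mul, inner_self_eq_norm_sq_to_K, norm_smul, RCLike.norm_conj,
    Complex.norm_real, Real.norm_eq_abs, abs_of_nonneg (by positivity),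
    div_mul_cancel₀ _ hT'.ne', norm_pow] at h1
  have h2 : ‖((‖T f‖ : ℝ) : ℂ)‖ = ‖T f‖ := by simp
  have h3 : ‖f‖ / ‖T f‖ * ‖T f‖ ^ 2 = ‖f‖ * ‖T f‖ := by field_simp
  have h4 : ‖f‖ * ‖T f‖ ≤ K * (‖f‖ ^ 2 + ‖f‖ ^ 2) := by
    rw [← h3]
    refine le_trans (le_of_eq ?_) h1
    congr 2
    exact h2.symm
  have hf : 0 < ‖f‖ := norm_pos_iff.2 fun h0 => hT (by rw [h0, map_zero])
  nlinarith

variable [NeZero n]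

/-- By Tonelli, integrate in t first: sliding the profile past a fixed point η contributes its full
integral whatever η is. -/
theorem integrable_slide {wt : ℝ → ℝ} (hc : Continuous wt) (hwt : Integrable wt) (h0 : ∀ x, 0 ≤ wt x)
    {τ : ℝ} (hτ : τ = 1 ∨ τ = -1) (g : L2Euc n) :
    Integrable (fun t : ℝ => ∫ η : EuclideanSpace ℝ (Fin n), wt (η 0 + τ * t) * ‖g η‖ ^ 2) ∧
    ∫ t : ℝ, ∫ η : EuclideanSpace ℝ (Fin n), wt (η 0 + τ * t) * ‖g η‖ ^ 2 =
      (∫ x, wt x) * ‖g‖ ^ 2 := by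
  have h1 : ∀ c : ℝ, Integrable (fun t : ℝ => wt (c + τ * t)) ∧ ∫ t, wt (c + τ * t) = ∫ x, wt x := by
    intro c
    rcases hτ with rfl | rfl
    · simp only [one_mul]
      exact ⟨hwt.comp_add_left c, integral_add_left_eq_self wt c⟩
    · simp only [neg_mul, one_mul, ← sub_eq_add_neg]
      exact ⟨hwt.comp_sub_left c, integral_sub_left_eq_self wt volume c⟩
  have h2 : Integrable (fun p : ℝ × EuclideanSpace ℝ (Fin n) =>
      wt (p.2 0 + τ * p.1) * ‖g p.2‖ ^ 2) (volume.prod volume) := by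
    have hm : AEStronglyMeasurable (fun p : ℝ × EuclideanSpace ℝ (Fin n) =>
        wt (p.2 0 + τ * p.1) * ‖g p.2‖ ^ 2) (volume.prod volume) := by
      refine AEStronglyMeasurable.mul ?_ ?_
      · refine Continuous.aestronglyMeasurable ?_
        fun_prop
      · exact (((Lp.aestronglyMeasurable g).norm).pow 2).comp_snd
    refine (integrable_prod_iff' hm).2 ⟨.of_forall fun η => ?_, ?_⟩
    · exact ((h1 (η 0)).1).mul_const (‖g η‖ ^ 2)
    · simp only [norm_mul, norm_pow, Real.norm_eq_abs, abs_of_nonneg (h0 _), abs_norm,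
        integral_mul_const, (h1 _).2]
      exact (integrable_norm_sq_L2 g).const_mul _
  refine ⟨h2.integral_prod_left, ?_⟩
  rw [integral_integral_swap h2]
  simp only [integral_mul_const, (h1 _).2, integral_const_mul, integral_norm_sq_L2]

theorem coeFn_translate_eucWeight {s : ℝ} (hs : 0 ≤ s) (f : L2Euc n)
    (v : EuclideanSpace ℝ (Fin n)) :
    translate v (eucWeight n s hs f) =ᵐ[volume] fun η => (japW s (η 0 - v 0) : ℂ) * f (η - v) := by
  have h := (measurePreserving_sub_right volume v).quasiMeasurePreserving.ae_eq_comp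
    (eucWeight_coeFn hs f)
  filter_upwards [coeFn_translate v (eucWeight n s hs f), h] with η h1 h2
  rw [h1]
  exact h2

theorem firstVec_smul_apply (r : ℝ) : (r • firstVec n) 0 = r := by
  simp [firstVec]

/-- The distance r separates the points where u and f are evaluated, so |r|^α is absorbed by the two
weights; the arithmetic-geometric inequality then decouples u and f. -/
theorem rpow_mul_norm_inner_le {s α : ℝ} (hs : 0 ≤ s) (hα : 0 ≤ α) (hα1 : α ≤ 1) (hαs : α ≤ s)
    {r : ℝ} (u f : L2Euc n) :
    |r| ^ α * ‖(inner ℂ (eucWeight n s hs u)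
        (translate (r • firstVec n) (eucWeight n s hs f)) : ℂ)‖ ≤
      (∫ η : EuclideanSpace ℝ (Fin n), japW (s - α) (η 0 - r) ^ 2 * ‖u η‖ ^ 2) +
      ∫ η : EuclideanSpace ℝ (Fin n), japW (s - α) (η 0 + r) ^ 2 * ‖f η‖ ^ 2 := by
  have hbd : ∀ (g : L2Euc n) (c : ℝ), Integrable fun η : EuclideanSpace ℝ (Fin n) =>
      japW (s - α) (η 0 + c) ^ 2 * ‖g η‖ ^ 2 := by
    intro g c
    refine (integrable_norm_sq_L2 g).bdd_mul (c := 1) ?_ (.of_forall fun η => ?_)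
    · refine Continuous.aestronglyMeasurable ?_
      have := continuous_japW (s - α)
      fun_prop
    · rw [norm_pow, Real.norm_eq_abs, abs_of_pos (japW_pos _ _)]
      exact pow_le_one₀ (japW_pos _ _).le (japW_le_one (sub_nonneg.2 hαs) _)
  have i1 := hbd u (-r)
  simp only [← sub_eq_add_neg] at i1
  have i2 : Integrable fun η : EuclideanSpace ℝ (Fin n) =>
      japW (s - α) (η 0) ^ 2 * ‖f (η - r • firstVec n)‖ ^ 2 := by
    have := (hbd f r).comp_sub_right (r • firstVec n)
    refine this.congr (.of_forall fun η => ?_)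
    simp only [PiLp.sub_apply, firstVec_smul_apply, sub_add_cancel]
  have e2 : ∫ η : EuclideanSpace ℝ (Fin n), japW (s - α) (η 0 + r) ^ 2 * ‖f η‖ ^ 2 =
      ∫ η : EuclideanSpace ℝ (Fin n), japW (s - α) (η 0) ^ 2 * ‖f (η - r • firstVec n)‖ ^ 2 := by
    rw [← integral_sub_right_eq_self _ (r • firstVec n)]
    simp only [PiLp.sub_apply, firstVec_smul_apply, sub_add_cancel]
  rw [e2, ← integral_add i1 i2, L2.inner_def]
  have hr : 0 ≤ |r| ^ α := Real.rpow_nonneg (abs_nonneg _) _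
  have e3 : |r| ^ α * ‖∫ η, (inner ℂ (eucWeight n s hs u η)
      (translate (r • firstVec n) (eucWeight n s hs f) η) : ℂ)‖ =
      ‖∫ η, ((|r| ^ α : ℝ) : ℂ) * (inner ℂ (eucWeight n s hs u η)
        (translate (r • firstVec n) (eucWeight n s hs f) η) : ℂ)‖ := by
    rw [integral_const_mul, norm_mul, Complex.norm_real, Real.norm_eq_abs, abs_of_nonneg hr]
  rw [e3]
  refine norm_integral_le_of_norm_le (i1.add i2) ?_
  filter_upwards [eucWeight_coeFn hs u, coeFn_translate_eucWeight hs f (r • firstVec n)]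
    with η h1 h2
  rw [h1, h2, firstVec_smul_apply, RCLike.inner_apply, norm_mul, norm_mul, norm_mul,
    RCLike.norm_conj, norm_mul, Complex.norm_real, Complex.norm_real, Complex.norm_real,
    Real.norm_eq_abs, Real.norm_eq_abs, Real.norm_eq_abs, abs_of_nonneg hr,
    abs_of_pos (japW_pos _ _), abs_of_pos (japW_pos _ _)]
  have h3 := rpow_mul_japW_mul_le hα hα1 s (η 0) (η 0 - r)
  rw [sub_sub_cancel] at h3
  set U := ‖u η‖ with hU
  set V := ‖f (η - r • firstVec n)‖ with hV
  have hUV : 0 ≤ U * V := by positivity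
  calc _ = |r| ^ α * (japW s (η 0) * japW s (η 0 - r)) * (U * V) := by ring
    _ ≤ 2 * (japW (s - α) (η 0) * japW (s - α) (η 0 - r)) * (U * V) := by gcongr
    -- Each function is paired with the weight at the other one's position. This crossing makes the
    -- weights move with r, so that they can be integrated in time.
    _ ≤ _ := by
        nlinarith [sq_nonneg (japW (s - α) (η 0 - r) * U - japW (s - α) (η 0) * V)]

/-- The propagators differ by O((t|z - z'|)^α), and t^α is absorbed by the weights. The time
integral then converges because α < ε keeps s - α above 1/2. -/
theorem norm_modelResolvent_sub_le {ε : ℝ} (hε : 0 < ε) {α : ℝ} (hα : 0 ≤ α) (hα1 : α ≤ 1)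
    (hαε : α < ε) : ∃ C : ℝ, ∀ (z z' : ℂ) (hz : z.im ≠ 0) (hz' : z'.im ≠ 0),
      0 < z.im * z'.im →
        ‖modelResolvent n ε hε z hz - modelResolvent n ε hε z' hz'‖ ≤ C * ‖z - z'‖ ^ α := by
  set s := 1 / 2 + ε with hs
  have hs1 : 1 / 2 < s - α := by linarith
  have hs0 : 0 ≤ s := by linarith
  set J := ∫ x, japW (s - α) x ^ 2 with hJ
  have hJ0 : 0 ≤ J := integral_nonneg fun x => sq_nonneg _
  have hpi := Real.pi_pos
  refine ⟨2 * (2 * Real.pi * (2 * (2 * Real.pi) ^ α) * J), fun z z' hz hz' him => ?_⟩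
  obtain ⟨σ, hσ, h1, h2⟩ : ∃ σ : ℝ, (σ = 1 ∨ σ = -1) ∧ 0 < σ * z.im ∧ 0 < σ * z'.im := by
    rcases pos_and_pos_or_neg_and_neg_of_mul_pos him with ⟨a, b⟩ | ⟨a, b⟩
    · exact ⟨1, Or.inl rfl, by linarith, by linarith⟩
    · exact ⟨-1, Or.inr rfl, by linarith, by linarith⟩
  have hσabs : |σ| = 1 := by rcases hσ with rfl | rfl <;> simp
  have hσ0 : σ ≠ 0 := by rintro rfl; simp at hσabs
  have hδ : 0 ≤ ‖z - z'‖ ^ α := Real.rpow_nonneg (norm_nonneg _) _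
  have hK : 0 ≤ 2 * Real.pi * (2 * (2 * Real.pi) ^ α) * J * ‖z - z'‖ ^ α := by positivity
  refine (opNorm_le_of_quadratic hK fun u f => ?_).trans (le_of_eq (by ring))
  obtain ⟨hi, he⟩ := inner_modelResolvent_sub hε hσ0 h1 h2 hz hz' u f
  rw [he]
  have hω : Integrable fun t : ℝ => japW (s - α) t ^ 2 := integrable_japW_sq hs1
  have hωc : Continuous fun t : ℝ => japW (s - α) t ^ 2 := (continuous_japW _).pow 2
  obtain ⟨ia, ea⟩ := integrable_slide hωc hω (fun _ => sq_nonneg _)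
    (τ := -σ) (by rcases hσ with rfl | rfl <;> simp) u
  obtain ⟨ib, eb⟩ := integrable_slide hωc hω (fun _ => sq_nonneg _) hσ f
  set c := 2 * (2 * Real.pi * ‖z - z'‖) ^ α with hc
  have hc0 : 0 ≤ c := by positivity
  have hbound : ‖∫ t in Set.Ioi (0 : ℝ), (propag σ z t - propag σ z' t) *
      inner ℂ (eucWeight n s hs0 u)
        (translate ((σ * t) • firstVec n) (eucWeight n s hs0 f))‖ ≤
      c * (J * ‖u‖ ^ 2 + J * ‖f‖ ^ 2) := by
    have h5 := (ia.add ib).const_mul c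
    refine (norm_integral_le_of_norm_le h5.integrableOn ?_).trans ?_
    · refine (ae_restrict_iff' measurableSet_Ioi).2 (.of_forall fun t ht => ?_)
      have ht0 : (0 : ℝ) < t := ht
      have h6 := rpow_mul_norm_inner_le hs0 hα hα1 (by linarith) (r := σ * t) u f
      rw [abs_mul, hσabs, one_mul, abs_of_pos ht0] at h6
      have h7 := norm_propag_sub_le hσabs h1 h2 ht0.le hα hα1
      have h8 : 2 * (2 * Real.pi * t * ‖z - z'‖) ^ α = c * t ^ α := by
        have h9 : 2 * Real.pi * t * ‖z - z'‖ = (2 * Real.pi * ‖z - z'‖) * t := by ring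
        rw [hc, h9, Real.mul_rpow (by positivity) ht0.le]
        ring
      rw [h8] at h7
      rw [norm_mul]
      calc _ ≤ c * t ^ α * ‖(inner ℂ (eucWeight n s hs0 u)
            (translate ((σ * t) • firstVec n) (eucWeight n s hs0 f)) : ℂ)‖ := by gcongr
        _ = c * (t ^ α * ‖(inner ℂ (eucWeight n s hs0 u)
            (translate ((σ * t) • firstVec n) (eucWeight n s hs0 f)) : ℂ)‖) := by ring
        _ ≤ _ := by
            refine mul_le_mul_of_nonneg_left (h6.trans (le_of_eq ?_)) hc0
            simp only [Pi.add_apply, neg_mul, ← sub_eq_add_neg]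
    · rw [← ea, ← eb, ← integral_add ia ib, ← integral_const_mul]
      refine setIntegral_le_integral h5 (.of_forall fun t => ?_)
      refine mul_nonneg hc0 (add_nonneg ?_ ?_) <;>
      exact integral_nonneg fun η => mul_nonneg (sq_nonneg _) (sq_nonneg _)
  rw [norm_mul, norm_mul, norm_mul, norm_mul, Complex.norm_I, Complex.norm_ofNat,
    Complex.norm_real, Complex.norm_real, Real.norm_eq_abs, Real.norm_eq_abs, hσabs,
    abs_of_pos hpi, mul_one, mul_one]
  calc _ ≤ 2 * Real.pi * (c * (J * ‖u‖ ^ 2 + J * ‖f‖ ^ 2)) := by gcongr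
    _ = _ := by
        rw [hc, Real.mul_rpow (by positivity) (norm_nonneg _)]
        ring

theorem isModelHolderExponent_half {ε : ℝ} (hε : 0 < ε) (hε1 : ε ≤ 1) :
    IsModelHolderExponent n ε hε (ε / 2) :=
  ⟨by linarith, by linarith, norm_modelResolvent_sub_le hε (by linarith) (by linarith) (by linarith)⟩

end Slide

end DiscreteSchrodinger

end

noncomputable section

namespace DiscreteSchrodinger

/-! ### A lower bound for the modulus of continuity of the model -/

theorem japW_anti {s : ℝ} (hs : 0 ≤ s) {a b : ℝ} (h : |a| ≤ |b|) : japW s b ≤ japW s a := by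
  refine Real.rpow_le_rpow_of_nonpos (one_pos.trans_le (one_le_sqrt_one_add_sq a)) ?_ (by linarith)
  refine Real.sqrt_le_sqrt ?_
  have := sq_le_sq.2 h
  linarith

theorem japW_add_half_ge {s : ℝ} (hs : 0 ≤ s) (k : ℝ) :
    (2 : ℝ) ^ (-s) * japW s k ≤ japW s (k + 1 / 2) := by
  rw [japW, japW, ← Real.mul_rpow zero_le_two (Real.sqrt_nonneg _)]
  refine Real.rpow_le_rpow_of_nonpos (one_pos.trans_le (one_le_sqrt_one_add_sq _)) ?_ (by linarith)
  have h : (2 : ℝ) = Real.sqrt (2 ^ 2) := by rw [Real.sqrt_sq zero_le_two]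
  rw [h, ← Real.sqrt_mul (by positivity)]
  refine Real.sqrt_le_sqrt ?_
  nlinarith [sq_nonneg (k - 1)]

theorem min_one_div_two_le {x : ℝ} (hx : 0 ≤ x) : min 1 x / 2 ≤ 1 - Real.exp (-x) := by
  have h1 : Real.exp (-x) ≤ (1 + x)⁻¹ := by
    rw [Real.exp_neg]
    refine inv_anti₀ (by positivity) ?_
    have := Real.add_one_le_exp x
    linarith
  have h2 : min 1 x / 2 ≤ 1 - (1 + x)⁻¹ := by
    have h3 : 1 - (1 + x)⁻¹ = x / (1 + x) := by field_simp; ring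
    rw [h3, le_div_iff₀ (by positivity)]
    rcases le_total 1 x with h | h
    · rw [min_eq_left h]; linarith
    · rw [min_eq_right h]; nlinarith
  linarith

section Bump

variable {n : ℕ} [NeZero n]

theorem norm_firstVec : ‖firstVec n‖ = 1 := by
  rw [firstVec, PiLp.norm_single, norm_one]

theorem abs_apply_zero_le (η : EuclideanSpace ℝ (Fin n)) : |η 0| ≤ ‖η‖ :=
  PiLp.norm_apply_le η 0

/-- The ball of radius `1/2` around `c e₁`. -/
def bumpBall (n : ℕ) [NeZero n] (c : ℝ) : Set (EuclideanSpace ℝ (Fin n)) :=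
  Metric.ball (c • firstVec n) (1 / 2)

theorem measurableSet_bumpBall (c : ℝ) : MeasurableSet (bumpBall n c) := measurableSet_ball

theorem volume_bumpBall_ne_top (c : ℝ) : volume (bumpBall n c) ≠ (⊤ : ℝ≥0∞) := measure_ball_lt_top.ne

/-- The indicator function of the ball of radius `1/2` around `c e₁`, as an element of `L²`. -/
def bump (n : ℕ) [NeZero n] (c : ℝ) : L2Euc n :=
  indicatorConstLp 2 (measurableSet_bumpBall c) (volume_bumpBall_ne_top c) (1 : ℂ)

theorem coeFn_bump (c : ℝ) :
    bump n c =ᵐ[volume] (bumpBall n c).indicator fun _ => (1 : ℂ) :=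
  indicatorConstLp_coeFn

theorem norm_bump (c : ℝ) : ‖bump n c‖ = ‖bump n 0‖ := by
  rw [bump, bump, norm_indicatorConstLp (by simp) (by simp),
    norm_indicatorConstLp (by simp) (by simp), bumpBall, bumpBall,
    Measure.addHaar_real_ball_center, zero_smul]

/-- Open balls of radius 1/2 about distinct integer points of the first axis are disjoint. -/
theorem inner_bump_eq_zero {k l : ℕ} (h : k ≠ l) : (inner ℂ (bump n k) (bump n l) : ℂ) = 0 := by
  rw [L2.inner_def]
  refine integral_eq_zero_of_ae ?_
  filter_upwards [coeFn_bump (n := n) k, coeFn_bump (n := n) l] with η h1 h2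
  rw [h1, h2, Pi.zero_apply]
  by_cases hk : η ∈ bumpBall n k
  · by_cases hl : η ∈ bumpBall n l
    · exfalso
      rw [bumpBall, Metric.mem_ball] at hk hl
      have h3 := dist_triangle_left ((k : ℝ) • firstVec n) ((l : ℝ) • firstVec n) η
      rw [dist_eq_norm, ← sub_smul, norm_smul, norm_firstVec, mul_one, Real.norm_eq_abs] at h3
      have h4 : (1 : ℝ) ≤ |(k : ℝ) - l| := by
        have h5 : (1 : ℤ) ≤ |(k : ℤ) - l| := Int.one_le_abs (by omega)
        exact_mod_cast h5
      linarith
    · rw [Set.indicator_of_notMem hl, inner_zero_right]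
  · rw [Set.indicator_of_notMem hk, inner_zero_left]

theorem norm_sum_bump_sq (c : ℕ → ℝ) (N : ℕ) :
    ‖∑ k ∈ Finset.range N, (c k : ℂ) • bump n k‖ ^ 2 =
      ‖bump n 0‖ ^ 2 * ∑ k ∈ Finset.range N, c k ^ 2 := by
  induction N with
  | zero => simp
  | succ N ih =>
    rw [Finset.sum_range_succ, Finset.sum_range_succ, mul_add, ← ih, sq, sq,
      norm_add_sq_eq_norm_sq_add_norm_sq_of_inner_eq_zero (𝕜 := ℂ), norm_smul, norm_bump,
      Complex.norm_real, Real.norm_eq_abs]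
    · have := abs_mul_abs_self (c N)
      nlinarith
    · rw [sum_inner]
      refine Finset.sum_eq_zero fun k hk => ?_
      rw [inner_smul_left, inner_smul_right, inner_bump_eq_zero (Finset.mem_range.1 hk).ne,
        mul_zero, mul_zero]

/-- The overlap integrand of two weighted bumps. -/
def overlap (s c t : ℝ) (η : EuclideanSpace ℝ (Fin n)) : ℝ :=
  (bumpBall n c).indicator (fun η => japW s (η 0)) η *
    (bumpBall n (-1)).indicator (fun η => japW s (η 0)) (η - t • firstVec n)

theorem inner_bump_translate {s : ℝ} (hs : 0 ≤ s) (c t : ℝ) :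
    (inner ℂ (eucWeight n s hs (bump n c))
      (translate (t • firstVec n) (eucWeight n s hs (bump n (-1)))) : ℂ) =
      ((∫ η : EuclideanSpace ℝ (Fin n), overlap s c t η : ℝ) : ℂ) := by
  rw [L2.inner_def, ← integral_complex_ofReal]
  refine integral_congr_ae ?_
  have h := (measurePreserving_sub_right volume
    (t • firstVec n)).quasiMeasurePreserving.ae_eq_comp (coeFn_bump (n := n) (-1))
  filter_upwards [eucWeight_coeFn hs (bump n c), coeFn_bump (n := n) c, h,
    coeFn_translate_eucWeight hs (bump n (-1)) (t • firstVec n)] with η h1 h2 h3 h4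
  simp only [Function.comp_apply] at h3
  rw [h4, h1, h2, h3, RCLike.inner_apply, overlap]
  by_cases hk : η ∈ bumpBall n c <;> by_cases hl : η - t • firstVec n ∈ bumpBall n (-1) <;>
    simp [hk, hl, mul_comm]

theorem indicator_japW_nonneg (s c : ℝ) (η : EuclideanSpace ℝ (Fin n)) :
    0 ≤ (bumpBall n c).indicator (fun η => japW s (η 0)) η :=
  Set.indicator_nonneg (fun _ _ => (japW_pos _ _).le) _

theorem overlap_nonneg (s c t : ℝ) (η : EuclideanSpace ℝ (Fin n)) : 0 ≤ overlap s c t η :=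
  mul_nonneg (indicator_japW_nonneg s c η) (indicator_japW_nonneg s (-1) _)

theorem measurable_indicator_japW (s c : ℝ) :
    Measurable ((bumpBall n c).indicator fun η : EuclideanSpace ℝ (Fin n) => japW s (η 0)) := by
  refine Measurable.indicator ?_ (measurableSet_bumpBall c)
  have := continuous_japW s
  exact Continuous.measurable (by fun_prop)

theorem integrable_overlap {s : ℝ} (hs : 0 ≤ s) (c t : ℝ) :
    Integrable (overlap (n := n) s c t) := by
  have h1 : Integrable ((bumpBall n c).indicator fun _ => (1 : ℝ)) :=
    (integrable_indicator_iff (measurableSet_bumpBall c)).2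
      (integrableOn_const (volume_bumpBall_ne_top c))
  refine h1.mono' ?_ (.of_forall fun η => ?_)
  · refine ((measurable_indicator_japW s c).mul ((measurable_indicator_japW s (-1)).comp
      (measurable_id.sub_const _))).aestronglyMeasurable
  · rw [Real.norm_eq_abs, abs_of_nonneg (overlap_nonneg s c t η), overlap]
    have h2 : (bumpBall n (-1)).indicator (fun η => japW s (η 0)) (η - t • firstVec n) ≤ 1 :=
      Set.indicator_le' (fun _ _ => japW_le_one hs _) (fun _ _ => zero_le_one) _
    have h3 : (bumpBall n c).indicator (fun η => japW s (η 0)) η ≤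
        (bumpBall n c).indicator (fun _ => 1) η :=
      Set.indicator_le_indicator (japW_le_one hs _)
    calc _ ≤ (bumpBall n c).indicator (fun η => japW s (η 0)) η * 1 :=
          mul_le_mul_of_nonneg_left h2 (indicator_japW_nonneg s c η)
      _ ≤ _ := by rw [mul_one]; exact h3

/-! ### Positivity on the imaginary axis and lower bounds -/

/-- For t within 1/4 of k + 1, translation carries the ball about -e₁ onto one that contains the
ball of radius 1/4 about k e₁. On the latter η₁ ≤ k + 1/2 and |η₁ - t| ≤ 3/2, which bounds both
weights from below. -/
theorem integral_overlap_ge {s : ℝ} (hs : 0 ≤ s) (k : ℕ) {t : ℝ} (ht : |t - (k + 1)| ≤ 1 / 4) :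
    (2 : ℝ) ^ (-s) * japW s (3 / 2) *
      volume.real (Metric.ball (0 : EuclideanSpace ℝ (Fin n)) (1 / 4)) * japW s k ≤
      ∫ η : EuclideanSpace ℝ (Fin n), overlap s k t η := by
  set B := Metric.ball ((k : ℝ) • firstVec n) (1 / 4) with hB
  have hk : (0 : ℝ) ≤ k := Nat.cast_nonneg k
  have hge : ∀ η, B.indicator (fun _ => (2 : ℝ) ^ (-s) * japW s k * japW s (3 / 2)) η ≤
      overlap s k t η := by
    intro η
    by_cases hη : η ∈ B
    · rw [Set.indicator_of_mem hη]
      have h1 : ‖η - (k : ℝ) • firstVec n‖ < 1 / 4 := by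
        rwa [hB, Metric.mem_ball, dist_eq_norm] at hη
      have h0 : |η 0 - k| < 1 / 4 := by
        have := abs_apply_zero_le (η - (k : ℝ) • firstVec n)
        rw [PiLp.sub_apply, firstVec_smul_apply] at this
        linarith
      have m1 : η ∈ bumpBall n k := by
        rw [bumpBall, Metric.mem_ball, dist_eq_norm]
        linarith
      have m2 : η - t • firstVec n ∈ bumpBall n (-1) := by
        rw [bumpBall, Metric.mem_ball, dist_eq_norm]
        have e : η - t • firstVec n - (-1 : ℝ) • firstVec n =
            (η - (k : ℝ) • firstVec n) - (t - (k + 1)) • firstVec n := by module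
        rw [e]
        refine (norm_sub_le _ _).trans_lt ?_
        rw [norm_smul, norm_firstVec, mul_one, Real.norm_eq_abs]
        linarith
      rw [overlap, Set.indicator_of_mem m1, Set.indicator_of_mem m2, PiLp.sub_apply,
        firstVec_smul_apply]
      rw [abs_lt] at h0
      rw [abs_le] at ht
      have j1 : (2 : ℝ) ^ (-s) * japW s k ≤ japW s (η 0) := by
        refine (japW_add_half_ge hs _).trans (japW_anti hs ?_)
        rw [abs_of_nonneg (by positivity : (0 : ℝ) ≤ k + 1 / 2), abs_le]
        constructor <;> linarith
      have j2 : japW s (3 / 2) ≤ japW s (η 0 - t) := by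
        refine japW_anti hs ?_
        rw [abs_of_nonneg (by norm_num : (0 : ℝ) ≤ 3 / 2), abs_le]
        constructor <;> linarith
      exact mul_le_mul j1 j2 (japW_pos _ _).le (japW_pos _ _).le
    · rw [Set.indicator_of_notMem hη]
      exact overlap_nonneg _ _ _ _
  have h1 : ∫ η, B.indicator (fun _ => (2 : ℝ) ^ (-s) * japW s k * japW s (3 / 2)) η =
      volume.real B * ((2 : ℝ) ^ (-s) * japW s k * japW s (3 / 2)) := by
    rw [integral_indicator measurableSet_ball, setIntegral_const, smul_eq_mul]
  have h2 := integral_mono ((integrable_indicator_iff measurableSet_ball).2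
    (integrableOn_const measure_ball_lt_top.ne)) (integrable_overlap hs k t) hge
  rw [h1, hB, Measure.addHaar_real_ball_center] at h2
  refine le_trans (le_of_eq (by ring)) h2

/-- On the imaginary axis the propagators are positive exponentials, so the overlap integrals cannot
cancel. -/
theorem propag_imaginary (μ t : ℝ) :
    propag 1 (μ * Complex.I) t = ((Real.exp (-(2 * Real.pi * μ * t)) : ℝ) : ℂ) := by
  rw [propag, Complex.ofReal_exp]
  congr 1
  push_cast
  linear_combination (2 * Real.pi * μ * t : ℂ) * Complex.I_sq

/-- Factor out e^{-2πμt}, which is at least e^{-2π} since μt ≤ 1. The other factor is controlled by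
κ - μ ≥ κ/2 and 1 + k ≤ 3t. -/
theorem exp_sub_exp_ge {κ μ t : ℝ} {k : ℕ} (hκ : 0 < κ) (hμ : 0 < μ) (hμκ : μ ≤ κ / 2)
    (ht : |t - (k + 1)| ≤ 1 / 4) (hμt : μ * (k + 2) ≤ 1) :
    Real.exp (-(2 * Real.pi)) / 2 * min 1 (κ * (1 + k)) ≤
      Real.exp (-(2 * Real.pi * μ * t)) - Real.exp (-(2 * Real.pi * κ * t)) := by
  rw [abs_le] at ht
  have hk : (0 : ℝ) ≤ k := Nat.cast_nonneg k
  have ht0 : 0 < t := by linarith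
  have hpi := Real.pi_gt_three
  have e : Real.exp (-(2 * Real.pi * κ * t)) = Real.exp (-(2 * Real.pi * μ * t)) *
      Real.exp (-(2 * Real.pi * (κ - μ) * t)) := by
    rw [← Real.exp_add]
    congr 1
    ring
  rw [e, ← mul_one_sub]
  have hμt' : μ * t ≤ 1 := le_trans (mul_le_mul_of_nonneg_left (by linarith) hμ.le) hμt
  have h1 : Real.exp (-(2 * Real.pi)) ≤ Real.exp (-(2 * Real.pi * μ * t)) := by
    refine Real.exp_le_exp.2 (neg_le_neg ?_)
    nlinarith
  have h2 : κ * (1 + k) ≤ 2 * Real.pi * (κ - μ) * t := by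
    have h3 : (1 + (k : ℝ)) ≤ 3 * t := by linarith
    calc κ * (1 + k) ≤ κ * (3 * t) := by gcongr
      _ = 2 * 3 * (κ / 2) * t := by ring
      _ ≤ 2 * Real.pi * (κ - μ) * t := by
          gcongr
          linarith
  have h4 : min 1 (κ * (1 + k)) / 2 ≤ 1 - Real.exp (-(2 * Real.pi * (κ - μ) * t)) := by
    refine le_trans ?_ (min_one_div_two_le (le_trans (by positivity) h2))
    gcongr
  have h5 : 0 ≤ min 1 (κ * (1 + k)) := le_min zero_le_one (by positivity)
  calc _ = Real.exp (-(2 * Real.pi)) * (min 1 (κ * (1 + k)) / 2) := by ring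
    _ ≤ _ := mul_le_mul h1 h4 (by positivity) (Real.exp_nonneg _)

/-- The time integrand is nonnegative, so it may be restricted to times within 1/4 of k + 1, when
the bump from -e₁ passes k e₁. That window has length 1/2, which turns the factor 1/2 of
`exp_sub_exp_ge` into 1/4. -/
theorem inner_bump_modelResolvent {ε : ℝ} (hε : 0 < ε) {κ μ : ℝ} (hκ : 0 < κ) (hμ : 0 < μ)
    (hμκ : μ ≤ κ / 2) (h0 : ((μ : ℂ) * Complex.I).im ≠ 0) (h0' : ((κ : ℂ) * Complex.I).im ≠ 0)
    (k : ℕ) (hμk : μ * (k + 2) ≤ 1) :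
    ∃ X : ℝ, (inner ℂ (bump n k) ((modelResolvent n ε hε (μ * Complex.I) h0 -
        modelResolvent n ε hε (κ * Complex.I) h0') (bump n (-1))) : ℂ) =
          2 * Real.pi * Complex.I * X ∧
      Real.exp (-(2 * Real.pi)) / 4 * ((2 : ℝ) ^ (-(1 / 2 + ε)) * japW (1 / 2 + ε) (3 / 2) *
      volume.real (Metric.ball (0 : EuclideanSpace ℝ (Fin n)) (1 / 4))) *
        (japW (1 / 2 + ε) k * min 1 (κ * (1 + k))) ≤ X := by
  have hs : 0 ≤ 1 / 2 + ε := by positivity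
  obtain ⟨hi, he⟩ := inner_modelResolvent_sub (n := n) hε (σ := 1) one_ne_zero
    (z := μ * Complex.I) (z' := κ * Complex.I) (by simpa using hμ) (by simpa using hκ) h0 h0'
    (bump n k) (bump n (-1))
  set s := 1 / 2 + ε with hsdef
  set A := (2 : ℝ) ^ (-s) * japW s (3 / 2) *
      volume.real (Metric.ball (0 : EuclideanSpace ℝ (Fin n)) (1 / 4)) with hA
  have hA0 : 0 ≤ A := by
    have := japW_pos s (3 / 2)
    positivity
  let F : ℝ → ℝ := fun t => (Real.exp (-(2 * Real.pi * μ * t)) - Real.exp (-(2 * Real.pi * κ * t))) *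
    ∫ η : EuclideanSpace ℝ (Fin n), overlap s k t η
  have hF : ∀ t : ℝ, (propag 1 (μ * Complex.I) t - propag 1 (κ * Complex.I) t) *
      inner ℂ (eucWeight n s hs (bump n k))
        (translate ((1 * t) • firstVec n) (eucWeight n s hs (bump n (-1)))) = (F t : ℂ) := by
    intro t
    rw [propag_imaginary, propag_imaginary, one_mul, inner_bump_translate]
    simp only [F]
    push_cast
    rfl
  replace hi : IntegrableOn (fun t => (F t : ℂ)) (Set.Ioi 0) := by
    rw [← funext hF]
    exact hi
  replace he := he.trans (congrArg (fun G : ℝ → ℂ => 2 * Real.pi * Complex.I * ((1 : ℝ) : ℂ) *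
    ∫ t in Set.Ioi (0 : ℝ), G t) (funext hF))
  have hi' : IntegrableOn F (Set.Ioi 0) := hi.re
  have hF0 : ∀ t ∈ Set.Ioi (0 : ℝ), 0 ≤ F t := by
    intro t ht
    refine mul_nonneg (sub_nonneg.2 (Real.exp_le_exp.2 (neg_le_neg ?_)))
      (integral_nonneg fun η => overlap_nonneg _ _ _ _)
    have ht' : (0 : ℝ) < t := ht
    have := Real.pi_pos
    gcongr
    linarith
  refine ⟨∫ t in Set.Ioi 0, F t, ?_, ?_⟩
  · rw [he, Complex.ofReal_one, mul_one, integral_complex_ofReal]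
  · have hk : (0 : ℝ) ≤ k := Nat.cast_nonneg k
    have hsub : Set.Icc ((k : ℝ) + 3 / 4) (k + 5 / 4) ⊆ Set.Ioi 0 := fun t ht => by
      have := ht.1
      exact lt_of_lt_of_le (by positivity) this
    have h1 : ∫ t in Set.Icc ((k : ℝ) + 3 / 4) (k + 5 / 4), F t ≤ ∫ t in Set.Ioi 0, F t :=
      setIntegral_mono_set hi' ((ae_restrict_iff' measurableSet_Ioi).2 (.of_forall hF0))
        (.of_forall hsub)
    refine le_trans ?_ h1
    have hm : 0 ≤ min 1 (κ * (1 + k)) := le_min zero_le_one (by positivity)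
    have h2 : ∀ t ∈ Set.Icc ((k : ℝ) + 3 / 4) (k + 5 / 4),
        Real.exp (-(2 * Real.pi)) / 2 * min 1 (κ * (1 + k)) * (A * japW s k) ≤ F t := by
      intro t ht
      have ht' : |t - (k + 1)| ≤ 1 / 4 := by
        rw [abs_le]
        constructor <;> linarith [ht.1, ht.2]
      have hw := japW_pos s k
      refine mul_le_mul (exp_sub_exp_ge hκ hμ hμκ ht' hμk) (integral_overlap_ge hs k ht')
        (by positivity) ?_
      exact le_trans (by positivity) (exp_sub_exp_ge hκ hμ hμκ ht' hμk)
    have h3 := setIntegral_mono_on (integrableOn_const (by simp)) (hi'.mono_set hsub)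
      measurableSet_Icc h2
    rw [setIntegral_const, smul_eq_mul, Real.volume_real_Icc] at h3
    refine le_trans (le_of_eq ?_) h3
    have h4 : max ((k : ℝ) + 5 / 4 - (k + 3 / 4)) 0 = 1 / 2 := by
      rw [max_eq_left] <;> linarith
    rw [h4]
    ring

/-- A Hölder exponent of the model is a Hölder exponent for `modulusSum`. -/
theorem IsModelHolderExponent.modulusSum_le {ε : ℝ} {hε : 0 < ε} {α : ℝ}
    (h : IsModelHolderExponent n ε hε α) :
    ∃ K : ℝ, 0 ≤ K ∧ ∀ δ : ℝ, 0 < δ → Real.sqrt (modulusSum (1 / 2 + ε) δ) ≤ K * δ ^ α := by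
  obtain ⟨hα, -, C, hC⟩ := h
  set s := 1 / 2 + ε with hs
  set A := Real.exp (-(2 * Real.pi)) / 4 * ((2 : ℝ) ^ (-s) * japW s (3 / 2) *
      volume.real (Metric.ball (0 : EuclideanSpace ℝ (Fin n)) (1 / 4))) with hA
  have hvol : 0 < volume.real (Metric.ball (0 : EuclideanSpace ℝ (Fin n)) (1 / 4)) :=
    ENNReal.toReal_pos (Metric.measure_ball_pos volume _ (by norm_num)).ne' measure_ball_lt_top.ne
  have hA0 : 0 < A := by
    have := japW_pos s (3 / 2)
    positivity
  have hpi := Real.pi_pos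
  set V := ‖bump n 0‖ with hV
  have hV0 : 0 ≤ V := norm_nonneg _
  set K := |C| * V ^ 2 / (2 * Real.pi * A) with hK
  have hK0 : 0 ≤ K := by positivity
  have fin : ∀ δ : ℝ, 0 < δ → ∀ N : ℕ,
      ∑ k ∈ Finset.range N, (japW s k * min 1 (δ * (1 + (k : ℝ)))) ^ 2 ≤ (K * δ ^ α) ^ 2 := by
    intro δ hδ N
    set c : ℕ → ℝ := fun k => japW s k * min 1 (δ * (1 + (k : ℝ))) with hc
    have hc0 : ∀ k, 0 ≤ c k := fun k =>
      mul_nonneg (japW_pos _ _).le (le_min zero_le_one (by positivity))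
    set S := ∑ k ∈ Finset.range N, c k ^ 2 with hS
    have hS0 : 0 ≤ S := Finset.sum_nonneg fun k _ => sq_nonneg _
    -- A stand-in for the boundary value at 0: small enough that e^{-2πμt} stays bounded below for
    -- all k < N, while no constant depends on μ or N.
    set μ := min (δ / 2) (1 / (N + 2)) with hμ
    have hμ0 : 0 < μ := lt_min (by positivity) (by positivity)
    have hμδ : μ ≤ δ / 2 := min_le_left _ _
    have i1 : ((μ : ℂ) * Complex.I).im ≠ 0 := by simpa using hμ0.ne'
    have i2 : ((δ : ℂ) * Complex.I).im ≠ 0 := by simpa using hδ.ne'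
    have hX : ∀ k ∈ Finset.range N, ∃ X : ℝ, (inner ℂ (bump n k)
        ((modelResolvent n ε hε (μ * Complex.I) i1 - modelResolvent n ε hε (δ * Complex.I) i2)
          (bump n (-1))) : ℂ) = 2 * Real.pi * Complex.I * X ∧ A * c k ≤ X := by
      intro k hk
      refine inner_bump_modelResolvent hε hδ hμ0 hμδ i1 i2 k ?_
      have h1 : μ ≤ 1 / (N + 2) := min_le_right _ _
      rw [le_div_iff₀ (by positivity)] at h1
      have h2 : (k : ℝ) ≤ N := by exact_mod_cast (Finset.mem_range.1 hk).le
      exact le_trans (mul_le_mul_of_nonneg_left (by linarith) hμ0.le) h1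
    choose! X hX1 hX2 using hX
    set T := modelResolvent n ε hε (μ * Complex.I) i1 - modelResolvent n ε hε (δ * Complex.I) i2
    have hT : ‖T‖ ≤ |C| * δ ^ α := by
      refine (hC _ _ i1 i2 (by simpa using mul_pos hμ0 hδ)).trans ?_
      have e : ‖(μ : ℂ) * Complex.I - δ * Complex.I‖ = δ - μ := by
        rw [← sub_mul, norm_mul, Complex.norm_I, mul_one, ← Complex.ofReal_sub, Complex.norm_real,
          Real.norm_eq_abs, abs_sub_comm, abs_of_nonneg (by linarith)]
      rw [e]
      refine mul_le_mul (le_abs_self _) (Real.rpow_le_rpow (by linarith) (by linarith) hα.le)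
        (Real.rpow_nonneg (by linarith) _) (abs_nonneg _)
    -- Coefficients equal to the expected lower bounds: the pairing is at least 2πA·S while ‖u‖ =
    -- V√S, so one factor √S cancels.
    set u : L2Euc n := ∑ k ∈ Finset.range N, (c k : ℂ) • bump n k with hu
    have e1 : (inner ℂ u (T (bump n (-1))) : ℂ) =
        2 * Real.pi * Complex.I * ((∑ k ∈ Finset.range N, c k * X k : ℝ) : ℂ) := by
      rw [hu, sum_inner]
      push_cast
      rw [Finset.mul_sum]
      refine Finset.sum_congr rfl fun k hk => ?_
      rw [inner_smul_left, hX1 k hk, Complex.conj_ofReal]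
      ring
    have e2 : A * S ≤ ∑ k ∈ Finset.range N, c k * X k := by
      rw [hS, Finset.mul_sum]
      refine Finset.sum_le_sum fun k hk => ?_
      calc A * c k ^ 2 = c k * (A * c k) := by ring
        _ ≤ c k * X k := mul_le_mul_of_nonneg_left (hX2 k hk) (hc0 k)
    have e3 : 2 * Real.pi * (A * S) ≤ ‖(inner ℂ u (T (bump n (-1))) : ℂ)‖ := by
      rw [e1, norm_mul, norm_mul, norm_mul, Complex.norm_I, Complex.norm_ofNat, Complex.norm_real,
        Complex.norm_real, Real.norm_eq_abs, Real.norm_eq_abs, abs_of_pos hpi, mul_one]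
      gcongr
      exact e2.trans (le_abs_self _)
    have e4 : ‖(inner ℂ u (T (bump n (-1))) : ℂ)‖ ≤ ‖u‖ * (|C| * δ ^ α * V) := by
      refine (norm_inner_le_norm _ _).trans ?_
      refine mul_le_mul_of_nonneg_left ?_ (norm_nonneg _)
      have := T.le_of_opNorm_le hT (bump n (-1))
      rwa [norm_bump] at this
    have e5 : ‖u‖ = V * Real.sqrt S := by
      have := norm_sum_bump_sq (n := n) c N
      rw [← Real.sqrt_sq (norm_nonneg u), this, Real.sqrt_mul (sq_nonneg _), Real.sqrt_sq hV0]
    have e6 : 2 * Real.pi * A * S ≤ Real.sqrt S * (|C| * V ^ 2 * δ ^ α) := by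
      calc 2 * Real.pi * A * S = 2 * Real.pi * (A * S) := by ring
        _ ≤ _ := e3.trans e4
        _ = _ := by rw [e5]; ring
    have e7 : Real.sqrt S ≤ K * δ ^ α := by
      rcases hS0.eq_or_lt with h0 | h0
      · rw [← h0, Real.sqrt_zero]
        positivity
      · have hsq := Real.mul_self_sqrt hS0
        have hpos := Real.sqrt_pos.2 h0
        have e8 : 2 * Real.pi * A * Real.sqrt S ≤ |C| * V ^ 2 * δ ^ α := by
          refine le_of_mul_le_mul_left ?_ hpos
          calc Real.sqrt S * (2 * Real.pi * A * Real.sqrt S) =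
              2 * Real.pi * A * (Real.sqrt S * Real.sqrt S) := by ring
            _ ≤ _ := by rw [hsq]; exact e6
        rw [hK, div_mul_eq_mul_div, le_div_iff₀ (by positivity)]
        linarith
    calc S = Real.sqrt S ^ 2 := (Real.sq_sqrt hS0).symm
      _ ≤ _ := pow_le_pow_left₀ (Real.sqrt_nonneg _) e7 2
  -- The estimate covers k ≥ 0. The summand is even, so the sum over ℤ is at most twice that, and 2K
  -- more than suffices.
  refine ⟨2 * K, by positivity, fun δ hδ => ?_⟩
  have hδα : 0 ≤ δ ^ α := Real.rpow_nonneg hδ.le _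
  have hsum := summable_modulus (s := s) (by rw [hs]; linarith) hδ.le
  let f : ℤ → ℝ := fun k => (japW s k * min 1 (δ * (1 + |(k : ℝ)|))) ^ 2
  have hfneg : ∀ k : ℤ, f (-k) = f k := by
    intro k
    simp only [f, japW, Int.cast_neg, neg_sq, abs_neg]
  have hnat : Summable fun k : ℕ => f k := hsum.comp_injective Nat.cast_injective
  have h1 : ∑' k : ℕ, f k ≤ (K * δ ^ α) ^ 2 := by
    refine Real.tsum_le_of_sum_range_le (fun k => sq_nonneg _) fun N => ?_
    refine le_trans (le_of_eq (Finset.sum_congr rfl fun k _ => ?_)) (fin δ hδ N)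
    simp only [f, Int.cast_natCast, Nat.abs_cast]
  have h2 : HasSum f (∑' k : ℕ, f k + ∑' k : ℕ, f k - f 0) :=
    HasSum.of_nat_of_neg hnat.hasSum (by simpa only [hfneg] using hnat.hasSum)
  have h3 : modulusSum s δ = ∑' k : ℕ, f k + ∑' k : ℕ, f k - f 0 := h2.tsum_eq
  rw [h3]
  refine Real.sqrt_le_iff.2 ⟨by positivity, ?_⟩
  have h4 : 0 ≤ f 0 := sq_nonneg _
  have h5 : 0 ≤ (K * δ ^ α) ^ 2 := sq_nonneg _
  have h6 : (2 * K * δ ^ α) ^ 2 = 4 * (K * δ ^ α) ^ 2 := by ring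
  rw [h6]
  linarith

end Bump

end DiscreteSchrodinger

end
-- Conclusion: transfer of the exponent from the model to the lattice
theorem propositionB4 (d : ℕ) [NeZero d] (χ : UnitAddTorus (Fin d) → ℝ) (hχ : TorusSmooth χ)
    (hsupp : tsupport χ ⊆ regularSet d) (ε : ℝ) (hε : 0 < ε) :
    (∃ C : ℝ, ∀ z : ℂ, z.im ≠ 0 → ‖cutoffResolvent χ hχ ε hε z‖ ≤ C) ∧
    (ε ≤ 1 →
      (∃ α : ℝ, ∀ (n : ℕ) [NeZero n], IsModelHolderExponent n ε hε α) ∧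
      ∀ α : ℝ, IsModelHolderExponent d ε hε α →
        ∃ C : ℝ, ∀ z z' : ℂ, 0 < z.im * z'.im →
          ‖cutoffResolvent χ hχ ε hε z - cutoffResolvent χ hχ ε hε z'‖ ≤
            C * ‖z - z'‖ ^ α) := by
  obtain ⟨C, hC, h1, h2⟩ := exists_cutoffResolvent_bound hχ hsupp hε
  refine ⟨⟨C, h1⟩, fun hε1 => ⟨⟨ε / 2, fun n _ => isModelHolderExponent_half hε hε1⟩,
    fun α hα => ?_⟩⟩
  -- `modulusSum` depends only on ε and |z - z'|, so a bound obtained from the model applies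
  -- verbatim to the lattice.
  obtain ⟨K, hK, hmod⟩ := hα.modulusSum_le
  refine ⟨C * K, fun z z' him => ?_⟩
  -- The bound on `modulusSum` is available only for δ > 0.
  rcases eq_or_ne z z' with rfl | hne
  · rw [sub_self, norm_zero]
    positivity
  · rw [mul_assoc]
    exact (h2 z z' him).trans
      (mul_le_mul_of_nonneg_left (hmod _ (norm_pos_iff.2 (sub_ne_zero.2 hne))) hC)
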